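/- **Theorem 4.9.** *Setting.* For a set $I$ let $\Omega_I=\{-1,1\}^I$ be the compact dyadic group with its Borel field and normalized Haar measure $\mathbb P_I$, let $r_\alpha(\omega)=\omega(\alpha)$, and let $W_I=\{\prod_{\alpha\in F}r_\alpha: F\subset I \text{ finite}\}$ be its dual group (Walsh characters; the order of $\prod_{\alpha\in F}r_\alpha$ is $\#F$), $R_I=\{r_\alpha:\alpha\in I\}$. Write $\widehat f(w)=\int f w\,d\mathbb P_I$ for $f\in L^\infty(\Omega_I,\mathbb P_I)$ and $\widehat\mu(w)=\int w\,d\mu$ for a regular complex Borel measure $\mu\in M(\Omega_I)$ (with total variation norm $\|\mu\|_M$). Let $L^\infty_{(s)}(\Omega_I,\mathbb P_I)=\{f\in L^\infty:\widehat f\in l^s(W_I)\}$, $\|f\|_{L^\infty_{(s)}}=\max\{\|f\|_{L^\infty},\|\widehat f\|_s\}$, and $M_{(s)}(\Omega_I)=\{\mu\in M:\widehat\mu\in l^s(W_I)\}$, $\|\mu\|_{M_{(s)}}=\max\{\|\mu\|_M,\|\widehat\mu\|_s\}$. Elements of these spaces are identified with their Walsh series. For $z\in\mathbb C^I$ let $\mathfrak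 R_I(z)=\prod_{\alpha\in I}(1+z(\alpha)r_\alpha)$ be the Walsh series whose coefficient at $\prod_{\alpha\in F}r_\alpha$ is $\prod_{\alpha\in F}z(\alpha)$. For $s\in[1,\infty]$ and real $x\in l^s(I)$, $x\ne0$, put $$Q_I^{(s)}(x)=\|x\|_s\,\mathrm{Im}\,\mathfrak R_I\big(\mathfrak i\,x/\|x\|_s\big),\qquad P_I^{(s)}(x)=\|x\|_s\Big(\mathfrak R_I\big(\tfrac{x}{2\|x\|_s}\big)-\mathfrak R_I\big(-\tfrac{x}{2\|x\|_s}\big)\Big),$$ where the imaginary part is taken coefficientwise, and $Q_I^{(s)}(0)=P_I^{(s)}(0)=0$. Given any set $A$, let $A_1=A$, let $A_{j+1}$ be the set of Walsh characters of odd order on $\Omega_{A_j}$ that are not in $R_{A_j}$, and let $A'$ be the disjoint union $\bigcup_{j\ge1}A_j$, so that $\Omega_{A'}=\prod_j\Omega_{A_j}$. For real $x\in l^s(A)$ let $x^{(1)}=x$ and let $x^{(j+1)}\in l^s(A_{j+1})$ be the restriction to $A_{j+1}$ of the transform of $Q_{A_j}^{(s)}(x^{(j)})$ if $s\le2$, and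 of $P_{A_j}^{(s)}(x^{(j)})$ if $s>2$. Viewing series on $\Omega_{A_j}$ as series on $\Omega_{A'}$, let $\Phi_A^{(s)}(x)$ be the Walsh series $$\Phi^{(1)}_A(x)=\sum_{\alpha\in A}x(\alpha)r_\alpha,\quad \Phi_A^{(s)}(x)=\sum_{j\ge1}\mathfrak i^{\,j-1}Q_{A_j}^{(s)}(x^{(j)})\ (1<s\le2),\quad \Phi_A^{(s)}(x)=\sum_{j\ge1}\mathfrak i^{\,j-1}P_{A_j}^{(s)}(x^{(j)})\ (2<s<\infty),\quad \Phi_A^{(\infty)}(x)=P_A^{(\infty)}(x),$$ and for complex $x=u+\mathfrak iv$ ($u,v$ real) let $\Phi_A^{(s)}(x)=\Phi_A^{(s)}(u)+\mathfrak i\,\Phi_A^{(s)}(v)$. Let $$\delta_s=(\sinh1-1)^{1/s}\ (1\le s\le2),\qquad \delta_s=2\big(\sinh 2^{-s}-2^{-s}\big)^{1/s}\ (2<s<\infty),\qquad \delta_\infty=\lim_{s\to\infty}\delta_s=\tfrac14 .$$ *Claim.* For every $s\in[1,\infty]$ the series $\Phi_A^{(s)}(x)$, $x\in l^s(A)$,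 represent elements of $L^\infty_{(s)}(\Omega_{A'},\mathbb P_{A'})$ if $s\le2$ and of $M_{(s)}(\Omega_{A'})$ if $s>2$, the maps $\Phi_A^{(s)}$ from $l^s(A)$ into these spaces are injective, and: (i) $\big(\Phi_A^{(s)}(x)\big)^\wedge(r_\alpha)=x(\alpha)$ for all $x\in l^s(A)$, $\alpha\in A$. (ii) For all $x\in l^s(A)$: $\frac2\pi\|x\|_1\le\|\Phi_A^{(1)}(x)\|_{L^\infty}\le\|x\|_1$ for $s=1$; $\ \|x\|_s\le\|\Phi_A^{(s)}(x)\|_{L^\infty_{(s)}}\le\frac{2\sqrt e}{1-\delta_s}\|x\|_s$ for $s\in(1,2]$; $\ \|x\|_s\le\|\Phi_A^{(s)}(x)\|_{M_{(s)}}\le\frac{4}{1-\delta_s}\|x\|_s$ for $s\in(2,\infty]$; and $\|x\|_\infty\le\|\Phi_A^{(\infty)}(x)\|_M\le4\|x\|_\infty$ for $s=\infty$. (iii) Let $1\le s\le2\le s^\star\le\infty$, $\frac1s+\frac1{s^\star}=1$, $x\in l^s(A)$, $y\in l^{s^\star}(A)$. Then $$\sum_{\alpha\in A}x(\alpha)y(\alpha)=\int_{\Omega_{A'}}\big(\Phi_A^{(s)}(x)\big)(\omega)\,\big(\Phi_A^{(s^\star)}(y)\big)(d\omega).$$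 For $s=2$ the right side is $\int\Phi_A^{(2)}(x)\,\Phi_A^{(2)}(y)\,d\mathbb P_{A'}$. For $s<2$ the formula holds in two senses: the convolution $\Phi_A^{(s)}(x)\ast\Phi_A^{(s^\star)}(y)$ has an absolutely summable transform, and its value $\sum_{w\in W_{A'}}\big(\Phi_A^{(s)}(x)\big)^\wedge(w)\big(\Phi_A^{(s^\star)}(y)\big)^\wedge(w)$ at the identity is the left side; and the class $\Phi_A^{(s)}(x)$ has a bounded Borel representative, depending only on $s$ and $x$, whose Lebesgue integral against the complex measure $\Phi_A^{(s^\star)}(y)$ is the left side for every $y\in l^{s^\star}(A)$. (iv) $\Phi_A^{(s)}(cx)=c\,\Phi_A^{(s)}(x)$ for all $x\in l^s(A)$ and $c\in\mathbb R$. (v) The transform map $x\mapsto\widehat{\Phi_A^{(s)}(x)}$ from $l^s(A)$ to $l^s(W_{A'})$ is continuous with respect to the $l^s$-norms. -/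

import Mathlib

open scoped ENNReal
open MeasureTheory

noncomputable section

/-- The dyadic group `{-1, 1}^ι`.  A separate definition, so that it carries the Borel `σ`-algebra
of the product topology (for uncountable `ι` this is larger than the product `σ`-algebra). -/
def Cube (ι : Type*) : Type _ := ι → ℤˣ

namespace Cube

variable {ι : Type*}

instance : TopologicalSpace (Cube ι) := inferInstanceAs (TopologicalSpace (ι → ℤˣ))
instance : CommGroup (Cube ι) := inferInstanceAs (CommGroup (ι → ℤˣ))
instance : IsTopologicalGroup (Cube ι) := inferInstanceAs (IsTopologicalGroup (ι → ℤˣ))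
instance : CompactSpace (Cube ι) := inferInstanceAs (CompactSpace (ι → ℤˣ))
instance : T2Space (Cube ι) := inferInstanceAs (T2Space (ι → ℤˣ))
instance : MeasurableSpace (Cube ι) := borel (Cube ι)
instance : BorelSpace (Cube ι) := ⟨rfl⟩

/-- The uniform probability measure on `{-1, 1}^ι`: the Haar measure of total mass `1`. -/
def prob (ι : Type*) : Measure (Cube ι) := Measure.haarMeasure ⊤

/-- The Walsh character `∏_{a ∈ w} r_a`.  The dual group of `Cube ι` is indexed by the finite
subsets `w` of `ι`; the Rademacher character `r_a` is indexed by `{a}` and `1` by `∅`. -/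
def walsh (w : Finset ι) (ω : Cube ι) : ℂ := ∏ a ∈ w, (((ω a : ℤˣ) : ℤ) : ℂ)

/-- Walsh transform of a function (Walsh characters are real, so no conjugate is needed). -/
def fnTransform (f : Cube ι → ℂ) (w : Finset ι) : ℂ := ∫ ω, walsh w ω * f ω ∂(prob ι)

/-- The integral `∫ f dμ` of a function against a complex measure. -/
def cint (f : Cube ι → ℂ) (μ : ComplexMeasure (Cube ι)) : ℂ :=
  ∫ᵛ ω, f ω ∂[ContinuousLinearMap.mul ℝ ℂ; μ]

/-- Walsh (Fourier--Stieltjes) transform of a complex measure. -/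
def measTransform (μ : ComplexMeasure (Cube ι)) (w : Finset ι) : ℂ := cint (walsh w) μ

end Cube

/-- The `l^s` norm of a function on `ι` (with value `0` if the function is not in `l^s`). -/
def lNorm {ι E : Type*} [NormedAddCommGroup E] (s : ℝ≥0∞) (x : ι → E) : ℝ :=
  open Classical in if h : Memℓp x s then ‖(⟨x, h⟩ : lp (fun _ : ι => E) s)‖ else 0

theorem lNorm_coe {ι E : Type*} [NormedAddCommGroup E] (s : ℝ≥0∞) (x : lp (fun _ : ι => E) s) :
    lNorm s (x : ι → E) = ‖x‖ := by
  unfold lNorm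
  rw [dif_pos (lp.memℓp x)]

/-- `L^∞_{(s)}`: the essentially bounded `f` on the cube whose Walsh transform is in `l^s`. -/
def LInfSpace (s : ℝ≥0∞) (ι : Type*) : Type _ :=
  {f : Lp ℂ ∞ (Cube.prob ι) // Memℓp (Cube.fnTransform f) s}

/-- `M_{(s)}`: the regular complex Borel measures (the total variation measure is finite and
regular) on the cube whose Walsh transform is in `l^s`. -/
def MSpace (s : ℝ≥0∞) (ι : Type*) : Type _ :=
  {μ : ComplexMeasure (Cube ι) //
    (IsFiniteMeasure μ.variation ∧ μ.variation.Regular) ∧ Memℓp (Cube.measTransform μ) s}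

namespace LInfSpace

variable {s : ℝ≥0∞} {ι : Type*}

/-- The Walsh transform of an element of `L^∞_{(s)}`, as an element of `l^s`. -/
def hat (f : LInfSpace s ι) : lp (fun _ : Finset ι => ℂ) s := ⟨Cube.fnTransform f.1, f.2⟩

/-- The norm `max {‖f‖_{L^∞}, ‖f^‖_s}` of `L^∞_{(s)}`. -/
def nrm (f : LInfSpace s ι) : ℝ := max ‖f.1‖ ‖f.hat‖

end LInfSpace

namespace MSpace

variable {s : ℝ≥0∞} {ι : Type*}

/-- The Walsh transform of an element of `M_{(s)}`, as an element of `l^s`. -/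
def hat (μ : MSpace s ι) : lp (fun _ : Finset ι => ℂ) s := ⟨Cube.measTransform μ.1, μ.2.2⟩

/-- The total variation norm. -/
def tv (μ : MSpace s ι) : ℝ := (μ.1.variation Set.univ).toReal

/-- The norm `max {‖μ‖_M, ‖μ^‖_s}` of `M_{(s)}`. -/
def nrm (μ : MSpace s ι) : ℝ := max μ.tv ‖μ.hat‖

end MSpace

/-! Riesz products, as formal Walsh series (functions of the character `w`). -/

section Riesz

variable {ι : Type*}

/-- The Riesz product `∏_a (1 + z(a) r_a)`: the coefficient at `w` is `∏_{a ∈ w} z(a)`. -/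
def rieszCoeff {R : Type*} [CommRing R] (z : ι → R) (w : Finset ι) : R := ∏ a ∈ w, z a

/-- The normalization `x / ‖x‖_s` (and `0` for `x = 0`). -/
def sphNormalize (s : ℝ≥0∞) (x : ι → ℝ) (a : ι) : ℝ := x a / lNorm s x

/-- `Q^{(s)}_ε(x) = (‖x‖_s / ε) Im ∏_a (1 + i ε (x(a)/‖x‖_s) r_a)`.  As the Walsh characters are
real-valued, the imaginary part of the series is taken coefficientwise. -/
def qCoeff (s : ℝ≥0∞) (ε : ℝ) (x : ι → ℝ) (w : Finset ι) : ℝ :=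
  lNorm s x / ε *
    (rieszCoeff (fun a => Complex.I * (ε : ℂ) * (sphNormalize s x a : ℂ)) w).im

/-- `P^{(s)}_ε(x) = (‖x‖_s / ε) (∏_a (1 + ε (x(a)/‖x‖_s) r_a / 2) - ∏_a (1 - ε (x(a)/‖x‖_s) r_a / 2))`. -/
def pCoeff (s : ℝ≥0∞) (ε : ℝ) (x : ι → ℝ) (w : Finset ι) : ℝ :=
  lNorm s x / ε *
    (rieszCoeff (fun a => ε * sphNormalize s x a / 2) w -
      rieszCoeff (fun a => -(ε * sphNormalize s x a / 2)) w)

/-- The Rademacher series `∑_a x(a) r_a`. -/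
def uCoeff (x : ι → ℝ) (w : Finset ι) : ℝ := if w.card = 1 then ∏ a ∈ w, x a else 0

/-- `Q^{(s)}_1(x)` for `s ≤ 2` and `P^{(s)}_1(x)` for `s > 2`. -/
def blockCoeff (s : ℝ≥0∞) (x : ι → ℝ) (w : Finset ι) : ℝ :=
  if s ≤ 2 then qCoeff s 1 x w else pCoeff s 1 x w

end Riesz

/-! The cascade of sets generated by `A`, and the maps `Φ`. -/

section Cascade

/-- The set cascade, indexed from `0`: `A_0 = A`, and `A_{n+1}` consists of the Walsh characters
on `Cube A_n` of odd order other than the Rademacher characters. -/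
def cascade (A : Type*) : ℕ → Type _
  | 0 => A
  | n + 1 => {w : Finset (cascade A n) // Odd w.card ∧ w.card ≠ 1}

/-- `A'`, the disjoint union of the sets of the cascade. -/
def CascadeUnion (A : Type*) : Type _ := Σ n : ℕ, cascade A n

variable {A : Type*}

/-- The inclusion of `A` in `A'`. -/
def incl (a : A) : CascadeUnion A := ⟨0, a⟩

/-- The vector cascade: the vector on `A_{n+1}` is the restriction to `A_{n+1}` of the transform
of `Q^{(s)}_1` (if `s ≤ 2`) or `P^{(s)}_1` (if `s > 2`) of the vector on `A_n`. -/
def vecCascade (s : ℝ≥0∞) (x : A → ℝ) : (n : ℕ) → cascade A n → ℝ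
  | 0 => x
  | n + 1 => fun w => blockCoeff s (vecCascade s x n) w.1

/-- A Walsh series on `Cube A_n`, viewed as a Walsh series on `Cube A'` by composition with the
projection: the coefficients at characters that do not come from `A_n` vanish. -/
def liftCoeff (n : ℕ) (c : Finset (cascade A n) → ℝ) (w : Finset (CascadeUnion A)) : ℝ :=
  open Classical in
  if ∀ b ∈ w, b.1 = n then c (w.preimage (Sigma.mk n) sigma_mk_injective.injOn) else 0

/-- The Walsh series `Φ^{(s)}(x)` on `Cube A'` for real `x`: it is `∑_a x(a) r_a` for `s = 1`,
`P^{(∞)}_1(x)` for `s = ∞`, and `∑_n i^n Q^{(s)}_1(x_n)` or `∑_n i^n P^{(s)}_1(x_n)` for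
`1 < s ≤ 2` or `2 < s < ∞`, with `(x_n)` the vector cascade.  For each `w` at most one term of the
sum is nonzero. -/
def phiReal (s : ℝ≥0∞) (x : A → ℝ) (w : Finset (CascadeUnion A)) : ℂ :=
  if s = 1 then (liftCoeff 0 (uCoeff x) w : ℂ)
  else if s = ∞ then (liftCoeff 0 (pCoeff ∞ 1 x) w : ℂ)
  else ∑' n : ℕ, Complex.I ^ n * (liftCoeff n (blockCoeff s (vecCascade s x n)) w : ℂ)

/-- The Walsh series `Φ^{(s)}(u + i v) = Φ^{(s)}(u) + i Φ^{(s)}(v)`. -/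
def phiSeries (s : ℝ≥0∞) (x : A → ℂ) (w : Finset (CascadeUnion A)) : ℂ :=
  phiReal s (fun a => (x a).re) w + Complex.I * phiReal s (fun a => (x a).im) w

/-- The constant `δ_s`; its value at `s = ∞` is the limit as `s → ∞`. -/
def deltaConst (s : ℝ≥0∞) : ℝ :=
  if s ≤ 2 then (Real.sinh 1 - 1) ^ (1 / s.toReal)
  else if s = ∞ then 1 / 4
  else 2 * (Real.sinh (2 ^ (-s.toReal)) - 2 ^ (-s.toReal)) ^ (1 / s.toReal)

end Cascade

end

/-! A Riesz product with vector `z` has Rademacher coefficients `z`, so it completes a Rademacher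
series to a bounded function or a measure at the price of higher-order coefficients. For real `z` in
the unit ball of `l^s`, `s ≤ 2`, one has `|∏ (1 + i z r)|² = ∏ (1 + z²) ≤ e`; for real `|y| ≤ 1` the
product of the `1 + y r` is a weak limit of probability densities. The odd part (an imaginary part
or a difference) removes the even orders. After rescaling, the block of `x` has Rademacher part `x`,
and for `s < ∞` a remainder of orders 3, 5, ... with `l^s` norm at most `δ_s ‖x‖`, since sums over
odd subsets are dominated by `sinh` (`subsetSum_parity_le`, `norm_restrLp_blockLp_le`).

The remainder serves as Rademacher data on fresh coordinates, and so on. The vectors decay like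
`δ_s^n` with `δ_s < 1`, so the blocks sum absolutely. For conjugate finite exponents let `T n` be
the pairing of the `n`-th vectors. The `n`-th blocks pair to `T n + T (n + 1)`, and the factors
`i^n` contribute `(-1)^n`, so the sum telescopes to `T 0 = ∑ x y` (`tsum_phiRealLp_mul_phiRealLp`).
For `s = ∞` only the first block is used; its partner at `s = 1` is a pure Rademacher series, so
nothing needs cancelling.

The integral form needs one function that serves all measures `Φ(y)` at once. It is built from
limits of finite Riesz products along finite sets chosen from `|z|^s` alone. By Hölder these
converge almost everywhere for every Riesz measure whose vector lies in the unit ball of the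
conjugate space (`ae_tendsto_rieszFun`), and `Φ(y)` is dominated by a countable sum of such
measures. A linear functional continuous under bounded a.e. convergence is then determined on the
limit by its values on characters (`hasSum_rieszCoeff_mul`, `apply_phiFun`). Haar integration
against a bounded function and integration against `Φ(y)` are both of this kind.

Real homogeneity comes from oddness of the blocks, continuity from Lipschitz bounds for them
(`exists_norm_blockLp_sub_le`) and locally uniform convergence. The constant `2/π` for `s = 1` is
obtained by averaging `|Re (e^{iθ} x)|` over `θ`. -/

open Filter Topology
open scoped symmDiff CompactlySupported

noncomputable section

/-! ### Walsh characters and finite Riesz products. -/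

namespace Cube

variable {ι : Type*}

instance : IsProbabilityMeasure (prob ι) := ⟨Measure.haarMeasure_self⟩
instance : (prob ι).IsHaarMeasure := inferInstanceAs ((Measure.haarMeasure ⊤).IsHaarMeasure)
instance : (prob ι).Regular := inferInstanceAs ((Measure.haarMeasure ⊤).Regular)

/-- The Rademacher character, as a real number. -/
def rad (a : ι) (ω : Cube ι) : ℝ := ((ω a : ℤˣ) : ℤ)

theorem rad_eq (a : ι) (ω : Cube ι) : rad a ω = 1 ∨ rad a ω = -1 := by
  unfold rad
  rcases Int.units_eq_one_or (ω a) with h | h <;> simp [h]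

theorem rad_mul_self (a : ι) (ω : Cube ι) : rad a ω * rad a ω = 1 := by
  rcases rad_eq a ω with h | h <;> simp [h]

theorem abs_rad (a : ι) (ω : Cube ι) : |rad a ω| = 1 := by
  rcases rad_eq a ω with h | h <;> simp [h]

@[fun_prop]
theorem continuous_rad (a : ι) : Continuous (rad a : Cube ι → ℝ) := by
  have h : Continuous fun ω : Cube ι => (ω a : ℤˣ) := continuous_apply (A := fun _ : ι => ℤˣ) a
  exact (continuous_of_discreteTopology (f := fun u : ℤˣ => (((u : ℤ)) : ℝ))).comp h

theorem walsh_eq (w : Finset ι) (ω : Cube ι) : walsh w ω = ∏ a ∈ w, (rad a ω : ℂ) := by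
  simp [walsh, rad]

@[fun_prop]
theorem continuous_walsh (w : Finset ι) : Continuous (walsh w : Cube ι → ℂ) := by
  have : (walsh w : Cube ι → ℂ) = fun ω => ∏ a ∈ w, (rad a ω : ℂ) := by
    ext ω; exact walsh_eq w ω
  rw [this]
  fun_prop

theorem measurable_walsh (w : Finset ι) : Measurable (walsh w : Cube ι → ℂ) :=
  (continuous_walsh w).measurable

theorem norm_walsh (w : Finset ι) (ω : Cube ι) : ‖walsh w ω‖ = 1 := by
  rw [walsh_eq, norm_prod]
  exact Finset.prod_eq_one fun a _ => by rw [Complex.norm_real, Real.norm_eq_abs, abs_rad]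

@[simp] theorem walsh_empty (ω : Cube ι) : walsh ∅ ω = 1 := by simp [walsh]

theorem walsh_singleton (a : ι) (ω : Cube ι) : walsh {a} ω = rad a ω := by simp [walsh_eq]

theorem walsh_mul [DecidableEq ι] (w v : Finset ι) (ω : Cube ι) :
    walsh w ω * walsh v ω = walsh (w ∆ v) ω := by
  simp only [walsh_eq]
  have hw : w = (w \ v) ∪ (w ∩ v) := (Finset.sdiff_union_inter w v).symm
  have hv : v = (v \ w) ∪ (w ∩ v) := by
    rw [Finset.inter_comm]; exact (Finset.sdiff_union_inter v w).symm
  have h1 : ∏ a ∈ w, (rad a ω : ℂ) = (∏ a ∈ w \ v, (rad a ω : ℂ)) * ∏ a ∈ w ∩ v, (rad a ω : ℂ) := by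
    conv_lhs => rw [hw]
    exact Finset.prod_union (Finset.disjoint_sdiff_inter w v)
  have h2 : ∏ a ∈ v, (rad a ω : ℂ) = (∏ a ∈ v \ w, (rad a ω : ℂ)) * ∏ a ∈ w ∩ v, (rad a ω : ℂ) := by
    conv_lhs => rw [hv]
    rw [Finset.inter_comm]
    exact Finset.prod_union (Finset.disjoint_sdiff_inter v w)
  have h3 : (∏ a ∈ w ∩ v, (rad a ω : ℂ)) * ∏ a ∈ w ∩ v, (rad a ω : ℂ) = 1 := by
    rw [← Finset.prod_mul_distrib]
    exact Finset.prod_eq_one fun a _ => by exact_mod_cast rad_mul_self a ω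
  have h4 : ∏ a ∈ w ∆ v, (rad a ω : ℂ)
      = (∏ a ∈ w \ v, (rad a ω : ℂ)) * ∏ a ∈ v \ w, (rad a ω : ℂ) := by
    rw [symmDiff_def, Finset.sup_eq_union]
    exact Finset.prod_union disjoint_sdiff_sdiff
  rw [h1, h2, h4]
  linear_combination (∏ a ∈ w \ v, (rad a ω : ℂ)) * (∏ a ∈ v \ w, (rad a ω : ℂ)) * h3

theorem integral_walsh [DecidableEq ι] (w : Finset ι) : ∫ ω, walsh w ω ∂(prob ι) = if w = ∅ then 1 else 0 := by
  split_ifs with h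
  · simp [h]
  · obtain ⟨a, ha⟩ := Finset.nonempty_iff_ne_empty.mpr h
    -- Translation by the point that flips the single coordinate `a ∈ w` changes the sign of the
    -- character, while Haar measure is invariant.
    set g : Cube ι := (Pi.mulSingle a (-1) : ι → ℤˣ) with hg
    have key : ∀ ω, walsh w (g * ω) = - walsh w ω := by
      intro ω
      have hr : ∀ b, rad b (g * ω) = (if b = a then -1 else 1) * rad b ω := by
        intro b
        have : (g * ω) b = g b * ω b := rfl
        rw [rad, this, rad]
        simp only [hg]
        by_cases hb : b = a
        · subst hb; simp
        · simp [hb]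
      simp only [walsh_eq, hr]
      push_cast
      rw [Finset.prod_mul_distrib, Finset.prod_eq_single a]
      · simp
      · intro b _ hb; simp [hb]
      · intro h; exact absurd ha h
    have := integral_mul_left_eq_self (μ := prob ι) (fun ω => walsh w ω) g
    simp only [key, integral_neg] at this
    linear_combination (-1/2 : ℂ) * this

theorem integrable_walsh (w : Finset ι) (μ : Measure (Cube ι)) [IsFiniteMeasure μ] :
    Integrable (walsh w) μ :=
  .of_bound (continuous_walsh w).measurable.aestronglyMeasurable 1
    (.of_forall fun ω => (norm_walsh w ω).le)

/-- The finite Riesz product `∏_{a ∈ S} (1 + z(a) r_a)`. -/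
def rieszFin (S : Finset ι) (z : ι → ℂ) (ω : Cube ι) : ℂ := ∏ a ∈ S, (1 + z a * rad a ω)

theorem rieszFin_eq_sum (S : Finset ι) (z : ι → ℂ) (ω : Cube ι) :
    rieszFin S z ω = ∑ w ∈ S.powerset, rieszCoeff z w * walsh w ω := by
  rw [rieszFin, Finset.prod_one_add]
  refine Finset.sum_congr rfl fun w _ => ?_
  rw [Finset.prod_mul_distrib, walsh_eq, rieszCoeff]

@[fun_prop]
theorem continuous_rieszFin (S : Finset ι) (z : ι → ℂ) : Continuous (rieszFin S z) := by
  unfold rieszFin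
  fun_prop

theorem integral_walsh_mul_walsh [DecidableEq ι] (w v : Finset ι) :
    ∫ ω, walsh w ω * walsh v ω ∂(prob ι) = if w = v then 1 else 0 := by
  simp only [walsh_mul, integral_walsh]
  simp only [← Finset.bot_eq_empty, symmDiff_eq_bot]

theorem integral_walsh_mul_rieszFin [DecidableEq ι] (S : Finset ι) (z : ι → ℂ) (w : Finset ι) :
    ∫ ω, walsh w ω * rieszFin S z ω ∂(prob ι) =
      if w ⊆ S then rieszCoeff z w else 0 := by
  simp only [rieszFin_eq_sum, Finset.mul_sum]
  rw [integral_finsetSum]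
  · have : ∀ v, ∫ ω, walsh w ω * (rieszCoeff z v * walsh v ω) ∂(prob ι)
        = if w = v then rieszCoeff z v else 0 := by
      intro v
      simp only [mul_left_comm _ (rieszCoeff z v)]
      rw [integral_const_mul, integral_walsh_mul_walsh]
      split_ifs <;> simp
    simp only [this]
    simp
  · intro v _
    refine Integrable.of_bound (C := ‖rieszCoeff z v‖) ?_ (.of_forall fun ω => ?_)
    · exact (by fun_prop : Continuous fun ω => walsh w ω * (rieszCoeff z v * walsh v ω)).measurable.aestronglyMeasurable
    · simp [norm_walsh]

end Cube

/-! ### Riesz measures. -/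

namespace Cube

variable {ι : Type*}

/-- `μ` has the Walsh transform of the Riesz product `∏_a (1 + y(a) r_a)`. -/
structure IsRieszMeasure (y : ι → ℝ) (μ : Measure (Cube ι)) : Prop where
  isProb : IsProbabilityMeasure μ
  regular : μ.Regular
  transform : ∀ w, ∫ ω, walsh w ω ∂μ = rieszCoeff (fun a => (y a : ℂ)) w

theorem isRieszMeasure_prob : IsRieszMeasure (0 : ι → ℝ) (prob ι) := by
  classical
  refine ⟨inferInstance, inferInstance, fun w => ?_⟩
  rw [integral_walsh, rieszCoeff]
  split_ifs with h
  · simp [h]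
  · obtain ⟨a, ha⟩ := Finset.nonempty_iff_ne_empty.mpr h
    exact (Finset.prod_eq_zero ha (by simp)).symm

/-- The nonnegative density `∏_{a ∈ S} (1 + y(a) r_a)` for real `y`. -/
def rieszDensity (S : Finset ι) (y : ι → ℝ) (ω : Cube ι) : ℝ := ∏ a ∈ S, (1 + y a * rad a ω)

@[fun_prop]
theorem continuous_rieszDensity (S : Finset ι) (y : ι → ℝ) : Continuous (rieszDensity S y) := by
  unfold rieszDensity
  fun_prop

theorem ofReal_rieszDensity (S : Finset ι) (y : ι → ℝ) (ω : Cube ι) :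
    (rieszDensity S y ω : ℂ) = rieszFin S (fun a => (y a : ℂ)) ω := by
  simp [rieszDensity, rieszFin]

theorem rieszDensity_nonneg (S : Finset ι) {y : ι → ℝ} (hy : ∀ a, |y a| ≤ 1) (ω : Cube ι) :
    0 ≤ rieszDensity S y ω := by
  refine Finset.prod_nonneg fun a _ => ?_
  have h := abs_le.mp (hy a)
  rcases rad_eq a ω with h' | h' <;> rw [h'] <;> linarith [h.1, h.2]

theorem integral_rieszDensity (S : Finset ι) (y : ι → ℝ) :
    ∫ ω, rieszDensity S y ω ∂(prob ι) = 1 := by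
  classical
  have h := integral_walsh_mul_rieszFin S (fun a => (y a : ℂ)) ∅
  simp only [walsh_empty, one_mul, ← ofReal_rieszDensity, Finset.empty_subset, if_true] at h
  rw [integral_complex_ofReal] at h
  simpa [rieszCoeff] using h

theorem integrable_of_continuous {E : Type*} [NormedAddCommGroup E] [SecondCountableTopology E]
    [MeasurableSpace E] [BorelSpace E] {f : Cube ι → E} (hf : Continuous f)
    (μ : Measure (Cube ι)) [IsFiniteMeasure μ] : Integrable f μ := by
  obtain ⟨C, hC⟩ := isCompact_univ.exists_bound_of_continuousOn hf.continuousOn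
  exact .of_bound hf.measurable.aestronglyMeasurable C (.of_forall fun ω => hC ω (Set.mem_univ ω))

/-- The finite products are probability densities, so their integrals against a continuous function
stay bounded and have a limit along an ultrafilter. The limit is a positive functional, hence a
regular measure by Riesz-Markov. For a character the approximating integrals are eventually
constant, which gives the transform. -/
theorem exists_isRieszMeasure {y : ι → ℝ} (hy : ∀ a, |y a| ≤ 1) :
    ∃ μ, IsRieszMeasure y μ := by
  classical
  -- One ultrafilter finer than `atTop` gives limits for all test functions simultaneously, so
  -- linearity passes to the limit.
  let U : Ultrafilter (Finset ι) := Ultrafilter.of atTop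
  have hU : (U : Filter (Finset ι)) ≤ atTop := Ultrafilter.of_le _
  let Λ₀ (f : C_c(Cube ι, ℝ)) (S : Finset ι) : ℝ := ∫ ω, f ω * rieszDensity S y ω ∂(prob ι)
  have hint : ∀ (f : C_c(Cube ι, ℝ)) S,
      Integrable (fun ω => f ω * rieszDensity S y ω) (prob ι) := fun f S =>
    integrable_of_continuous (f.continuous.mul (continuous_rieszDensity S y)) _
  have hlim : ∀ f : C_c(Cube ι, ℝ), ∃ l, Tendsto (Λ₀ f) U (𝓝 l) := by
    intro f
    obtain ⟨C, hC⟩ := isCompact_univ.exists_bound_of_continuousOn f.continuous.continuousOn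
    have hb : ∀ S, Λ₀ f S ∈ Set.Icc (-C) C := by
      intro S
      have : ‖Λ₀ f S‖ ≤ ∫ ω, C * rieszDensity S y ω ∂(prob ι) := by
        refine norm_integral_le_of_norm_le
          ((integrable_of_continuous (continuous_rieszDensity S y) _).const_mul C)
          (.of_forall fun ω => ?_)
        rw [norm_mul, Real.norm_of_nonneg (rieszDensity_nonneg S hy ω)]
        exact mul_le_mul_of_nonneg_right (hC ω (Set.mem_univ ω)) (rieszDensity_nonneg S hy ω)
      rw [integral_const_mul, integral_rieszDensity, mul_one, Real.norm_eq_abs] at this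
      exact abs_le.mp this
    obtain ⟨l, -, hl⟩ := (isCompact_Icc (a := -C) (b := C)).ultrafilter_le_nhds (U.map (Λ₀ f))
      (le_principal_iff.mpr (Ultrafilter.mem_map.mpr (Filter.univ_mem' hb)))
    exact ⟨l, hl⟩
  choose Λ₁ hΛ₁ using hlim
  let Λ₂ : C_c(Cube ι, ℝ) →ₗ[ℝ] ℝ :=
    { toFun := Λ₁
      map_add' := fun f g => by
        refine tendsto_nhds_unique (hΛ₁ (f + g)) (((hΛ₁ f).add (hΛ₁ g)).congr fun S => ?_)
        simp only [Λ₀]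
        rw [← integral_add (hint f S) (hint g S)]
        simp [add_mul]
      map_smul' := fun c f => by
        refine tendsto_nhds_unique (hΛ₁ (c • f)) (((hΛ₁ f).const_mul c).congr fun S => ?_)
        simp only [Λ₀]
        rw [← integral_const_mul]
        simp [mul_assoc] }
  let Λ : C_c(Cube ι, ℝ) →ₚ[ℝ] ℝ := PositiveLinearMap.mk₀ Λ₂ (fun f hf =>
    ge_of_tendsto' (hΛ₁ f) fun S => integral_nonneg fun ω =>
      mul_nonneg (hf ω) (rieszDensity_nonneg S hy ω))
  have hreal : ∀ w : Finset ι, ∃ g : C_c(Cube ι, ℝ), (∀ ω, (g ω : ℂ) = walsh w ω) := by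
    intro w
    refine ⟨⟨⟨fun ω => ∏ a ∈ w, rad a ω, by fun_prop⟩,
      HasCompactSupport.of_compactSpace _⟩, fun ω => ?_⟩
    simp [walsh_eq]
  have htr : ∀ w, ∫ ω, walsh w ω ∂(RealRMK.rieszMeasure Λ) = rieszCoeff (fun a => (y a : ℂ)) w := by
    intro w
    obtain ⟨g, hg⟩ := hreal w
    have h1 : ∫ ω, walsh w ω ∂(RealRMK.rieszMeasure Λ) = ((Λ₁ g : ℝ) : ℂ) := by
      simp only [← hg]
      rw [integral_complex_ofReal]
      congr 1
      exact RealRMK.integral_rieszMeasure Λ g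
    have h2 : Tendsto (fun S => ((Λ₀ g S : ℝ) : ℂ)) U (𝓝 ((Λ₁ g : ℝ) : ℂ)) :=
      (Complex.continuous_ofReal.tendsto _).comp (hΛ₁ g)
    have h3 : (fun S => ((Λ₀ g S : ℝ) : ℂ)) =ᶠ[U] fun _ => rieszCoeff (fun a => (y a : ℂ)) w := by
      refine Filter.Eventually.filter_mono hU ?_
      filter_upwards [eventually_ge_atTop w] with S hS
      simp only [Λ₀]
      rw [← integral_complex_ofReal]
      simp only [Complex.ofReal_mul,
        hg, ofReal_rieszDensity] 
      rw [integral_walsh_mul_rieszFin, if_pos hS]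
    rw [h1]
    exact tendsto_nhds_unique (h2.congr' h3) tendsto_const_nhds
  refine ⟨RealRMK.rieszMeasure Λ, ⟨?_⟩, inferInstance, htr⟩
  have h := htr ∅
  simp only [walsh_empty, rieszCoeff, Finset.prod_empty] at h
  have h' : (RealRMK.rieszMeasure Λ).real Set.univ = 1 := by
    have : ∫ _, (1 : ℂ) ∂(RealRMK.rieszMeasure Λ) = 1 := h
    rw [integral_const] at this
    simpa using this
  rw [Measure.real, ENNReal.toReal_eq_one_iff] at h'
  exact h'

/-- A regular probability measure with the Walsh transform of `∏_a (1 + y(a) r_a)`,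
for `|y| ≤ 1`. -/
def rieszMeasure (y : ι → ℝ) : Measure (Cube ι) :=
  open Classical in if h : ∃ μ, IsRieszMeasure y μ then h.choose else prob ι

theorem isRieszMeasure_rieszMeasure {y : ι → ℝ} (hy : ∀ a, |y a| ≤ 1) :
    IsRieszMeasure y (rieszMeasure y) := by
  have h := exists_isRieszMeasure hy
  rw [rieszMeasure, dif_pos h]
  exact h.choose_spec

instance (y : ι → ℝ) : IsProbabilityMeasure (rieszMeasure y) := by
  unfold rieszMeasure
  split_ifs with h
  · exact h.choose_spec.isProb
  · infer_instance

instance (y : ι → ℝ) : (rieszMeasure y).Regular := by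
  unfold rieszMeasure
  split_ifs with h
  · exact h.choose_spec.regular
  · infer_instance

end Cube

/-! ### Sequences of finite sets exhausting a summable family. -/

theorem exists_exhaustion {ι : Type*} {t : ι → ℝ} (ht : Summable t) :
    ∃ S : ℕ → Finset ι, Monotone S ∧
      ∀ n (T : Finset ι), Disjoint T (S n) → ∑ a ∈ T, t a ≤ (1 / 16) ^ n := by
  classical
  -- The ratio 1/16 has square root 1/4, which remains summable after multiplication by `2 ^ n` in
  -- the convergence proof for Riesz products.
  have h : ∀ n : ℕ, ∃ S : Finset ι, ∀ T : Finset ι, Disjoint T S → ‖∑ a ∈ T, t a‖ < (1 / 16) ^ n :=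
    fun n => summable_iff_vanishing_norm.mp ht _ (by positivity)
  choose S₀ hS₀ using h
  refine ⟨fun n => (Finset.range (n + 1)).biUnion S₀, fun m n hmn => ?_, fun n T hT => ?_⟩
  · exact Finset.biUnion_subset_biUnion_of_subset_left _ (by gcongr)
  · refine (le_abs_self _).trans (hS₀ n T (hT.mono_right ?_)).le
    exact Finset.subset_biUnion_of_mem S₀ (by simp)

/-- An increasing sequence of finite sets outside of which the sums of `t` decay geometrically. -/
def exhaustion {ι : Type*} (t : ι → ℝ) : ℕ → Finset ι :=
  open Classical in if h : Summable t then (exists_exhaustion h).choose else fun _ => ∅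

theorem monotone_exhaustion {ι : Type*} (t : ι → ℝ) : Monotone (exhaustion t) := by
  unfold exhaustion
  split_ifs with h
  · exact (exists_exhaustion h).choose_spec.1
  · exact monotone_const

theorem sum_le_of_disjoint_exhaustion {ι : Type*} {t : ι → ℝ} (h : Summable t) (n : ℕ)
    {T : Finset ι} (hT : Disjoint T (exhaustion t n)) : ∑ a ∈ T, t a ≤ (1 / 16) ^ n := by
  rw [exhaustion, dif_pos h] at hT
  exact (exists_exhaustion h).choose_spec.2 n T hT

theorem exists_mem_exhaustion {ι : Type*} {t : ι → ℝ} (h : Summable t) {a : ι} (ha : 0 < t a) :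
    ∃ n, a ∈ exhaustion t n := by
  by_contra! hn
  obtain ⟨n, hn'⟩ := exists_pow_lt_of_lt_one ha (by norm_num : (1 / 16 : ℝ) < 1)
  have := sum_le_of_disjoint_exhaustion h n (T := {a}) (by simpa using hn n)
  simp only [Finset.sum_singleton] at this
  linarith

/-- The sums of a summable function over an increasing sequence of finite sets that exhausts its
support. -/
theorem tendsto_sum_of_exhausts {κ E : Type*} [NormedAddCommGroup E] [CompleteSpace E]
    {c : κ → E} (hc : Summable fun w => ‖c w‖) {W : ℕ → Finset κ} (hW : Monotone W)
    (hsupp : ∀ w, c w ≠ 0 → ∃ n, w ∈ W n) :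
    Tendsto (fun n => ∑ w ∈ W n, c w) atTop (𝓝 (∑' w, c w)) := by
  classical
  have h : ∀ n, ∑ w ∈ W n, c w = ∑' w, if w ∈ W n then c w else 0 := by
    intro n
    rw [tsum_eq_sum (s := W n)]
    · exact Finset.sum_congr rfl fun w hw => by simp [hw]
    · intro w hw; simp [hw]
  simp only [h]
  refine tendsto_tsum_of_dominated_convergence hc (fun w => ?_) (.of_forall fun n w => ?_)
  · by_cases hw : c w = 0
    · simp [hw]
    · obtain ⟨n, hn⟩ := hsupp w hw
      refine tendsto_const_nhds.congr' ?_
      filter_upwards [eventually_ge_atTop n] with m hm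
      rw [if_pos (hW hm hn)]
  · split_ifs <;> simp

/-! ### Almost everywhere convergence of the Riesz products of imaginary vectors. -/

namespace Cube

variable {ι : Type*}

/-- Each factor satisfies `|1 + i z r|² = 1 + z²` because `r = ±1`; the modulus does not depend on
`ω`. -/
theorem norm_rieszFin_I_sq (S : Finset ι) (z : ι → ℝ) (ω : Cube ι) :
    ‖rieszFin S (fun a => Complex.I * z a) ω‖ ^ 2 = ∏ a ∈ S, (1 + z a ^ 2) := by
  rw [rieszFin, norm_prod, ← Finset.prod_pow]
  refine Finset.prod_congr rfl fun a _ => ?_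
  rw [Complex.sq_norm]
  have h := rad_mul_self a ω
  simp [Complex.normSq_apply]
  linear_combination (z a) ^ 2 * h

theorem integral_rieszFin {y : ι → ℝ} {μ : Measure (Cube ι)} (hμ : IsRieszMeasure y μ)
    (S : Finset ι) (z : ι → ℂ) : ∫ ω, rieszFin S z ω ∂μ = ∏ a ∈ S, (1 + z a * y a) := by
  have := hμ.isProb
  simp only [rieszFin_eq_sum]
  rw [integral_finsetSum _ fun w _ => (integrable_walsh w μ).const_mul _, Finset.prod_one_add]
  refine Finset.sum_congr rfl fun w _ => ?_
  rw [integral_const_mul, hμ.transform, rieszCoeff, rieszCoeff, Finset.prod_mul_distrib]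

theorem exp_sub_one_le_two_mul {x : ℝ} (h0 : 0 ≤ x) (h1 : x ≤ 1) : Real.exp x - 1 ≤ 2 * x := by
  have h := Real.abs_exp_sub_one_sub_id_le (x := x) (by rwa [abs_of_nonneg h0])
  have := (abs_le.mp h).2
  nlinarith

/-- Expand `|g - 1|² = |g|² - 2 Re g + 1`. Here `|g|²` is the constant `∏ (1 + z²)` and `∫ g dμ = ∏
(1 + i z y)`; both are within `exp η - 1 ≤ 2η` of 1, which yields `2η + 2 · 2η`. -/
theorem integral_norm_rieszFin_sub_one_sq_le {y : ι → ℝ} {μ : Measure (Cube ι)}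
    (hμ : IsRieszMeasure y μ) (T : Finset ι) (z : ι → ℝ) {η : ℝ} (hη : η ≤ 1)
    (h1 : ∑ a ∈ T, z a ^ 2 ≤ η) (h2 : ∑ a ∈ T, |z a * y a| ≤ η) :
    ∫ ω, ‖rieszFin T (fun a => Complex.I * z a) ω - 1‖ ^ 2 ∂μ ≤ 6 * η := by
  have := hμ.isProb
  have h0 : 0 ≤ η := (Finset.sum_nonneg fun a _ => sq_nonneg (z a)).trans h1
  set g := rieszFin T (fun a => Complex.I * z a) with hg
  have hgc : Continuous g := continuous_rieszFin _ _
  have e1 : ∀ ω, ‖g ω - 1‖ ^ 2 = ∏ a ∈ T, (1 + z a ^ 2) - 2 * (g ω).re + 1 := by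
    intro ω
    rw [← norm_rieszFin_I_sq T z ω, Complex.sq_norm, Complex.sq_norm, Complex.normSq_apply,
      Complex.normSq_apply]
    simp only [Complex.sub_re, Complex.sub_im, Complex.one_re, Complex.one_im, ← hg]
    ring
  have hre : ∫ ω, (g ω).re ∂μ = (∏ a ∈ T, (1 + Complex.I * z a * y a)).re := by
    rw [← integral_rieszFin hμ T]
    exact integral_re (𝕜 := ℂ) (integrable_of_continuous hgc μ)
  simp only [e1]
  rw [integral_add, integral_sub, integral_const_mul, hre]
  · simp only [integral_const, probReal_univ, one_smul]
    have a1 : ∏ a ∈ T, (1 + z a ^ 2) - 1 ≤ Real.exp (∑ a ∈ T, z a ^ 2) - 1 := by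
      have := Finset.norm_prod_one_add_sub_one_le T (fun a => z a ^ 2)
      refine (le_abs_self _).trans (this.trans_eq ?_)
      simp
    have a2 : ‖∏ a ∈ T, (1 + Complex.I * z a * y a) - 1‖ ≤ Real.exp (∑ a ∈ T, |z a * y a|) - 1 := by
      have := Finset.norm_prod_one_add_sub_one_le T (fun a => Complex.I * z a * y a)
      simpa [abs_mul] using this
    have a3 : 1 - (∏ a ∈ T, (1 + Complex.I * z a * y a)).re
        ≤ ‖∏ a ∈ T, (1 + Complex.I * z a * y a) - 1‖ := by
      have := (Complex.abs_re_le_norm (∏ a ∈ T, (1 + Complex.I * z a * y a) - 1))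
      simp only [Complex.sub_re, Complex.one_re] at this
      linarith [(abs_le.mp this).1]
    have a4 := exp_sub_one_le_two_mul (Finset.sum_nonneg fun a (_ : a ∈ T) => sq_nonneg (z a))
      (h1.trans hη)
    have a5 := exp_sub_one_le_two_mul (Finset.sum_nonneg fun a (_ : a ∈ T) => abs_nonneg (z a * y a))
      (h2.trans hη)
    linarith
  · exact integrable_const _
  · exact (integrable_of_continuous (by fun_prop : Continuous fun ω => (g ω).re) μ).const_mul 2
  · exact (integrable_const _).sub
      ((integrable_of_continuous (by fun_prop : Continuous fun ω => (g ω).re) μ).const_mul 2)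
  · exact integrable_const _

/-- The finite Riesz products of `i z` along a sequence of finite sets adapted to `|z|^p`. -/
def rieszSeq (p : ℝ) (z : ι → ℝ) (n : ℕ) : Cube ι → ℂ :=
  rieszFin (exhaustion (fun a => |z a| ^ p) n) (fun a => Complex.I * z a)

/-- The function represented by the Riesz product `∏_a (1 + i z(a) r_a)`. -/
def rieszFun (p : ℝ) (z : ι → ℝ) (ω : Cube ι) : ℂ :=
  open Classical in
  if h : ∃ l, Tendsto (fun n => rieszSeq p z n ω) atTop (𝓝 l) then h.choose else 0

theorem tendsto_rieszFun {p : ℝ} {z : ι → ℝ} {ω : Cube ι}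
    (h : ∃ l, Tendsto (fun n => rieszSeq p z n ω) atTop (𝓝 l)) :
    Tendsto (fun n => rieszSeq p z n ω) atTop (𝓝 (rieszFun p z ω)) := by
  rw [rieszFun, dif_pos h]
  exact h.choose_spec

theorem measurable_rieszSeq (p : ℝ) (z : ι → ℝ) (n : ℕ) : Measurable (rieszSeq p z n) :=
  (continuous_rieszFin _ _).measurable

theorem measurable_rieszFun (p : ℝ) (z : ι → ℝ) : Measurable (rieszFun p z) := by
  classical
  set K := {ω : Cube ι | ∃ l, Tendsto (fun n => rieszSeq p z n ω) atTop (𝓝 l)} with hK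
  have hKm : MeasurableSet K := measurableSet_exists_tendsto (measurable_rieszSeq p z)
  -- Cutting off to the convergence set matches the default value 0 of `rieszFun`, so the truncated
  -- sequence converges everywhere.
  refine measurable_of_tendsto_metrizable (f := fun n => K.indicator (rieszSeq p z n))
    (fun n => (measurable_rieszSeq p z n).indicator hKm) ?_
  rw [tendsto_pi_nhds]
  intro ω
  by_cases h : ω ∈ K
  · simpa [h] using tendsto_rieszFun h
  · have hn : ¬∃ l, Tendsto (fun n => rieszSeq p z n ω) atTop (𝓝 l) := h
    have : rieszFun p z ω = 0 := by rw [rieszFun, dif_neg hn]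
    simp [h, this]

/-- The vectors of the closed unit ball of `l^p`, without reference to the norm. -/
def InUnitBall (p : ℝ) (z : ι → ℝ) : Prop := ∀ S : Finset ι, ∑ a ∈ S, |z a| ^ p ≤ 1

theorem InUnitBall.neg {p : ℝ} {z : ι → ℝ} (h : InUnitBall p z) : InUnitBall p (-z) := by
  intro S; simpa using h S

theorem InUnitBall.summable {p : ℝ} {z : ι → ℝ} (h : InUnitBall p z) :
    Summable fun a => |z a| ^ p :=
  summable_of_sum_le (fun a => by positivity) h

theorem InUnitBall.abs_le_one {p : ℝ} (hp : 0 < p) {z : ι → ℝ} (h : InUnitBall p z) (a : ι) :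
    |z a| ≤ 1 := by
  have := h {a}
  simp only [Finset.sum_singleton] at this
  by_contra! hlt
  linarith [Real.one_lt_rpow hlt hp]

theorem InUnitBall.sq_le {p : ℝ} (hp : 0 < p) (hp2 : p ≤ 2) {z : ι → ℝ} (h : InUnitBall p z)
    (a : ι) : z a ^ 2 ≤ |z a| ^ p := by
  have := Real.rpow_le_rpow_of_exponent_ge' (abs_nonneg (z a)) (h.abs_le_one hp a) hp.le hp2
  simpa using this

theorem norm_rieszFin_I_le {p : ℝ} (hp : 0 < p) (hp2 : p ≤ 2) {z : ι → ℝ} (h : InUnitBall p z)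
    (S : Finset ι) (ω : Cube ι) :
    ‖rieszFin S (fun a => Complex.I * z a) ω‖ ≤ Real.sqrt (Real.exp 1) := by
  refine Real.le_sqrt_of_sq_le ?_
  rw [norm_rieszFin_I_sq]
  calc ∏ a ∈ S, (1 + z a ^ 2) ≤ ∏ a ∈ S, Real.exp (z a ^ 2) :=
        Finset.prod_le_prod (fun a _ => by positivity) fun a _ => by
          rw [add_comm]; exact Real.add_one_le_exp _
    _ = Real.exp (∑ a ∈ S, z a ^ 2) := (Real.exp_sum _ _).symm
    _ ≤ Real.exp 1 := Real.exp_le_exp.mpr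
        ((Finset.sum_le_sum fun a _ => h.sq_le hp hp2 a).trans (h S))

theorem norm_rieszFun_le {p : ℝ} (hp : 0 < p) (hp2 : p ≤ 2) {z : ι → ℝ} (h : InUnitBall p z)
    (ω : Cube ι) : ‖rieszFun p z ω‖ ≤ Real.sqrt (Real.exp 1) := by
  by_cases hω : ∃ l, Tendsto (fun n => rieszSeq p z n ω) atTop (𝓝 l)
  · exact le_of_tendsto' (tendsto_rieszFun hω).norm fun n => norm_rieszFin_I_le hp hp2 h _ _
  · rw [rieszFun, dif_neg hω]; simp

/-- Let `1 + u n` be the product over the `n`-th increment of the exhaustion. Its second moment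
bound makes `∑ 2^n |u n|²`, hence `∑ |u n|`, finite almost everywhere; as the partial products are
bounded, they form a Cauchy sequence. The sets depend on `z` only, so the same limit serves every
admissible `μ`. The hypothesis `hzy` covers both `y = 0` (Haar measure) and `y` in the conjugate
unit ball. -/
theorem ae_tendsto_rieszFun {p : ℝ} (hp : 1 ≤ p) (hp2 : p ≤ 2) {z y : ι → ℝ}
    (h : InUnitBall p z) (hzy : ∀ T : Finset ι, ∑ a ∈ T, |z a * y a| ≤ (∑ a ∈ T, |z a| ^ p) ^ (1 / p))
    {μ : Measure (Cube ι)} (hμ : IsRieszMeasure y μ) :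
    ∀ᵐ ω ∂μ, Tendsto (fun n => rieszSeq p z n ω) atTop (𝓝 (rieszFun p z ω)) := by
  classical
  have := hμ.isProb
  have hp0 : 0 < p := by linarith
  set S := exhaustion (fun a => |z a| ^ p) with hS
  set T : ℕ → Finset ι := fun n => S (n + 1) \ S n with hT
  have hTs : ∀ n, ∑ a ∈ T n, |z a| ^ p ≤ (1 / 16) ^ n := fun n =>
    sum_le_of_disjoint_exhaustion h.summable n Finset.sdiff_disjoint
  set u : ℕ → Cube ι → ℂ := fun n ω => rieszFin (T n) (fun a => Complex.I * z a) ω - 1 with hu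
  have huc : ∀ n, Continuous (u n) := fun n => by simp only [hu]; fun_prop
  have hun : ∀ n, ∫ ω, ‖u n ω‖ ^ 2 ∂μ ≤ 6 * (1 / 4) ^ n := by
    intro n
    refine integral_norm_rieszFin_sub_one_sq_le hμ _ z (pow_le_one₀ (by norm_num) (by norm_num)) ?_ ?_
    · refine (Finset.sum_le_sum fun a _ => h.sq_le hp0 hp2 a).trans ((hTs n).trans ?_)
      gcongr; norm_num
    · refine (hzy _).trans ?_
      have h0 : 0 ≤ ∑ a ∈ T n, |z a| ^ p := Finset.sum_nonneg fun a _ => by positivity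
      calc (∑ a ∈ T n, |z a| ^ p) ^ (1 / p) ≤ ((1 / 16 : ℝ) ^ n) ^ (1 / p) := by
            gcongr; exact hTs n
        -- The base is at most 1 and `1 / p ≥ 1 / 2`.
        _ ≤ ((1 / 16 : ℝ) ^ n) ^ (1 / 2 : ℝ) := by
            refine Real.rpow_le_rpow_of_exponent_ge' (by positivity)
              (pow_le_one₀ (by norm_num) (by norm_num)) (by norm_num) ?_
            exact one_div_le_one_div_of_le hp0 hp2
        _ = (1 / 4) ^ n := by
            rw [← Real.sqrt_eq_rpow, Real.sqrt_eq_iff_mul_self_eq (by positivity) (by positivity),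
              ← mul_pow]
            norm_num
  have hsum : ∀ᵐ ω ∂μ, Summable fun n => 2 ^ n * ‖u n ω‖ ^ 2 := by
    have hi : ∀ n, Integrable (fun ω => 2 ^ n * ‖u n ω‖ ^ 2) μ := fun n =>
      integrable_of_continuous (by fun_prop (disch := exact huc n)) μ
    have hfin : ∑' n, ∫⁻ ω, ‖2 ^ n * ‖u n ω‖ ^ 2‖ₑ ∂μ ≠ ∞ := by
      have hb : ∀ n, ∫⁻ ω, ‖2 ^ n * ‖u n ω‖ ^ 2‖ₑ ∂μ ≤ ENNReal.ofReal (6 * (1 / 2) ^ n) := by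
        intro n
        rw [← ofReal_integral_norm_eq_lintegral_enorm (hi n)]
        refine ENNReal.ofReal_le_ofReal ?_
        have : ∀ ω, ‖(2 : ℝ) ^ n * ‖u n ω‖ ^ 2‖ = 2 ^ n * ‖u n ω‖ ^ 2 := fun ω =>
          Real.norm_of_nonneg (by positivity)
        simp only [this]
        rw [integral_const_mul]
        calc (2 : ℝ) ^ n * ∫ ω, ‖u n ω‖ ^ 2 ∂μ ≤ 2 ^ n * (6 * (1 / 4) ^ n) := by gcongr; exact hun n
          _ = 6 * (1 / 2) ^ n := by
            rw [show (1 / 2 : ℝ) = 2 * (1 / 4) by norm_num, mul_pow]; ring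
      have hs : Summable fun n : ℕ => 6 * (1 / 2 : ℝ) ^ n :=
        (summable_geometric_of_lt_one (by norm_num) (by norm_num)).mul_left 6
      refine ne_top_of_le_ne_top ?_ (ENNReal.tsum_le_tsum hb)
      rw [← ENNReal.ofReal_tsum_of_nonneg (fun n => by positivity) hs]
      exact ENNReal.ofReal_ne_top
    rw [← lintegral_tsum fun n => (hi n).1.enorm] at hfin
    have := ae_lt_top' (AEMeasurable.tsum fun n => (hi n).1.enorm) hfin
    filter_upwards [this] with ω hω
    refine Summable.of_norm ?_
    exact NNReal.summable_coe.mpr (ENNReal.tsum_coe_ne_top_iff_summable.mp hω.ne)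
  filter_upwards [hsum] with ω hω
  refine tendsto_rieszFun ?_
  have hstep : ∀ n, rieszSeq p z (n + 1) ω - rieszSeq p z n ω = rieszSeq p z n ω * u n ω := by
    intro n
    have : rieszSeq p z (n + 1) ω = rieszSeq p z n ω *
        rieszFin (T n) (fun a => Complex.I * z a) ω := by
      simp only [rieszSeq, rieszFin, hT]
      rw [mul_comm, Finset.prod_sdiff (monotone_exhaustion _ (Nat.le_succ n))]
    rw [this, hu]; ring
  have hsu : Summable fun n => ‖rieszSeq p z (n + 1) ω - rieszSeq p z n ω‖ := by
    have h2 : Summable fun n : ℕ => Real.sqrt (Real.exp 1) * (2 ^ n * ‖u n ω‖ ^ 2 + (1 / 2) ^ n) :=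
      (hω.add (summable_geometric_of_lt_one (by norm_num) (by norm_num))).mul_left _
    refine Summable.of_nonneg_of_le (fun n => norm_nonneg _) (fun n => ?_) h2
    rw [hstep, norm_mul]
    refine mul_le_mul (norm_rieszFin_I_le hp0 hp2 h _ _) ?_ (norm_nonneg _) (by positivity)
    have hab : (2 : ℝ) ^ n * (1 / 2) ^ n = 1 := by rw [← mul_pow]; norm_num
    have h1 : (0:ℝ) < 2 ^ n := by positivity
    have h3 : (0:ℝ) < (1 / 2) ^ n := by positivity
    -- Completing the square shows `|u| ≤ 2^n |u|² + 2^{-n}`, the passage from weighted square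
    -- summability to summability.
    have h4 : 2 ^ n * ‖u n ω‖ ^ 2 + (1 / 2) ^ n - ‖u n ω‖
       = 2 ^ n * (‖u n ω‖ - (1 / 2) ^ n / 2) ^ 2 + (3 / 4) * (1 / 2) ^ n := by
      linear_combination (‖u n ω‖ - (1 / 2) ^ n / 4) * hab
    have h5 : 0 ≤ 2 ^ n * (‖u n ω‖ - (1 / 2) ^ n / 2) ^ 2 := by positivity
    linarith
  have hc : CauchySeq fun n => rieszSeq p z n ω :=
    cauchySeq_of_summable_dist (by simpa [dist_eq_norm, norm_sub_rev] using hsu)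
  exact cauchySeq_tendsto_of_complete hc

end Cube

/-! ### Functionals continuous under bounded almost everywhere convergence. -/

section DominatedFunctionals

variable {X : Type*} [MeasurableSpace X]

/-- Bounded measurable complex functions. -/
def BddMeasurable (f : X → ℂ) : Prop := Measurable f ∧ ∃ C : ℝ, ∀ ω, ‖f ω‖ ≤ C

theorem BddMeasurable.add {f g : X → ℂ} (hf : BddMeasurable f) (hg : BddMeasurable g) :
    BddMeasurable fun ω => f ω + g ω := by
  obtain ⟨hf, C, hC⟩ := hf
  obtain ⟨hg, D, hD⟩ := hg
  exact ⟨hf.add hg, C + D, fun ω => (norm_add_le _ _).trans (add_le_add (hC ω) (hD ω))⟩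

theorem BddMeasurable.const_mul {f : X → ℂ} (hf : BddMeasurable f) (c : ℂ) :
    BddMeasurable fun ω => c * f ω := by
  obtain ⟨hf, C, hC⟩ := hf
  exact ⟨hf.const_mul c, ‖c‖ * C, fun ω => by
    rw [norm_mul]; exact mul_le_mul_of_nonneg_left (hC ω) (norm_nonneg _)⟩

theorem BddMeasurable.simpleFunc (g : SimpleFunc X ℂ) : BddMeasurable g :=
  ⟨g.measurable, g.exists_forall_norm_le⟩

theorem BddMeasurable.integrable {f : X → ℂ} (hf : BddMeasurable f) (μ : Measure X)
    [IsFiniteMeasure μ] : Integrable f μ := by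
  obtain ⟨hf, C, hC⟩ := hf
  exact .of_bound hf.aestronglyMeasurable C (.of_forall hC)

theorem BddMeasurable.finset_sum {κ : Type*} {f : κ → X → ℂ} (hf : ∀ k, BddMeasurable (f k))
    (s : Finset κ) : BddMeasurable fun ω => ∑ k ∈ s, f k ω := by
  classical
  induction s using Finset.induction_on with
  | empty => exact ⟨by simp, 0, by simp⟩
  | insert a s ha ih => simpa [Finset.sum_insert ha] using (hf a).add ih

/-- Additive functionals on the bounded measurable functions that are continuous with respect to
bounded convergence almost everywhere. -/
structure DominatedAdditive (M : Measure X) (L : (X → ℂ) → ℂ) : Prop where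
  add : ∀ f g, BddMeasurable f → BddMeasurable g → L (fun ω => f ω + g ω) = L f + L g
  tendsto : ∀ (f : ℕ → X → ℂ) (g : X → ℂ) (C : ℝ), (∀ n, Measurable (f n)) → (∀ n ω, ‖f n ω‖ ≤ C) →
    Measurable g → (∀ᵐ ω ∂M, Tendsto (fun n => f n ω) atTop (𝓝 (g ω))) →
    Tendsto (fun n => L (f n)) atTop (𝓝 (L g))

/-- Additivity extends the agreement to simple functions, and uniformly bounded simple
approximations extend it to bounded measurable functions. Homogeneity is not assumed, so the
indicators carry arbitrary complex constants; this allows the lemma itself to prove homogeneity. -/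
theorem DominatedAdditive.eq_of_indicator {M : Measure X} {L₁ L₂ : (X → ℂ) → ℂ}
    (h₁ : DominatedAdditive M L₁) (h₂ : DominatedAdditive M L₂)
    (h : ∀ (c : ℂ) E, MeasurableSet E → L₁ (E.indicator fun _ => c) = L₂ (E.indicator fun _ => c))
    {f : X → ℂ} (hf : BddMeasurable f) : L₁ f = L₂ f := by
  have hs : ∀ g : SimpleFunc X ℂ, L₁ g = L₂ g := by
    intro g
    induction g using SimpleFunc.induction with
    | const c hE =>
      have := h c _ hE
      simpa only [SimpleFunc.coe_piecewise, SimpleFunc.coe_const, Function.const_zero,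
        Set.piecewise_eq_indicator] using! this
    | @add f g _ hf hg =>
      have e : (⇑(f + g) : X → ℂ) = fun ω => f ω + g ω := rfl
      rw [e, h₁.add _ _ (.simpleFunc f) (.simpleFunc g), h₂.add _ _ (.simpleFunc f) (.simpleFunc g),
        hf, hg]
  obtain ⟨hfm, C, hC⟩ := hf
  -- On an empty space the bound `C` could be negative.
  rcases isEmpty_or_nonempty X with hX | ⟨⟨ω₀⟩⟩
  · have := hs 0
    rwa [show f = ⇑(0 : SimpleFunc X ℂ) from Subsingleton.elim _ _]
  have hC0 : 0 ≤ C := (norm_nonneg _).trans (hC ω₀)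
  have hsm := hfm.stronglyMeasurable
  have hb : ∀ n ω, ‖hsm.approxBounded C n ω‖ ≤ C := fun n ω => hsm.norm_approxBounded_le hC0 n ω
  have ht : ∀ ω, Tendsto (fun n => hsm.approxBounded C n ω) atTop (𝓝 (f ω)) := fun ω =>
    hsm.tendsto_approxBounded_of_norm_le (hC ω)
  have t₁ := h₁.tendsto (fun n => hsm.approxBounded C n) f C
    (fun n => SimpleFunc.measurable _) hb hfm (.of_forall ht)
  have t₂ := h₂.tendsto (fun n => hsm.approxBounded C n) f C
    (fun n => SimpleFunc.measurable _) hb hfm (.of_forall ht)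
  simp only [hs] at t₁
  exact tendsto_nhds_unique t₁ t₂

/-- Linear functionals on the bounded measurable functions that are continuous with respect to
bounded convergence almost everywhere. -/
structure DominatedLinear (M : Measure X) (L : (X → ℂ) → ℂ) : Prop
    extends DominatedAdditive M L where
  smul : ∀ (c : ℂ) f, BddMeasurable f → L (fun ω => c * f ω) = c * L f

namespace DominatedLinear

variable {M : Measure X} {L : (X → ℂ) → ℂ}

theorem finset_sum (hL : DominatedLinear M L) {κ : Type*} {f : κ → X → ℂ}
    (hf : ∀ k, BddMeasurable (f k)) (s : Finset κ) :
    L (fun ω => ∑ k ∈ s, f k ω) = ∑ k ∈ s, L (f k) := by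
  classical
  induction s using Finset.induction_on with
  | empty =>
    have := hL.smul 0 (fun _ => 0) ⟨measurable_const, 0, by simp⟩
    simpa using this
  | insert a s ha ih =>
    simp only [Finset.sum_insert ha]
    rw [hL.add _ _ (hf a) (.finset_sum hf s), ih]

theorem sub (hL : DominatedLinear M L) {f g : X → ℂ} (hf : BddMeasurable f)
    (hg : BddMeasurable g) : L (fun ω => f ω - g ω) = L f - L g := by
  have := hL.add f _ hf (hg.const_mul (-1))
  rw [hL.smul _ _ hg] at this
  simpa [sub_eq_add_neg] using this

theorem of_integral (μ : Measure X) {h : X → ℂ} (hh : Integrable h μ) :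
    DominatedLinear μ fun f => ∫ ω, f ω * h ω ∂μ where
  add f g hf hg := by
    have hi : ∀ {f : X → ℂ}, BddMeasurable f → Integrable (fun ω => f ω * h ω) μ := by
      rintro f ⟨hf, C, hC⟩
      exact hh.bdd_mul hf.aestronglyMeasurable (.of_forall hC)
    simp only [add_mul]
    exact integral_add (hi hf) (hi hg)
  tendsto f g C hf hC hg hlim := by
    refine tendsto_integral_of_dominated_convergence (fun ω => C * ‖h ω‖)
      (fun n => (hf n).aestronglyMeasurable.mul hh.1) (hh.norm.const_mul C)
      (fun n => .of_forall fun ω => ?_) ?_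
    · rw [norm_mul]; exact mul_le_mul_of_nonneg_right (hC n ω) (norm_nonneg _)
    · filter_upwards [hlim] with ω hω using hω.mul_const _
  smul c f hf := by
    simp only [mul_assoc]
    exact integral_const_mul _ _

/-- The partial sums are bounded by `(∑ ‖c n‖) C` and converge pointwise, so `L` may be applied
termwise. -/
theorem hasSum (hL : DominatedLinear M L) {f : ℕ → X → ℂ} (hf : ∀ n, Measurable (f n)) {C : ℝ}
    (hC : ∀ n ω, ‖f n ω‖ ≤ C) {c : ℕ → ℂ} (hc : Summable fun n => ‖c n‖)
    (hs : Summable fun n => ‖c n * L (f n)‖) :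
    HasSum (fun n => c n * L (f n)) (L fun ω => ∑' n, c n * f n ω) := by
  have hsum : ∀ ω, Summable fun n => c n * f n ω := fun ω =>
    .of_norm_bounded (hc.mul_right C) fun n => by
      rw [norm_mul]; exact mul_le_mul_of_nonneg_left (hC n ω) (norm_nonneg _)
  have hbm : ∀ n, BddMeasurable (f n) := fun n => ⟨hf n, C, hC n⟩
  have hm : ∀ n, Measurable fun ω => ∑ k ∈ Finset.range n, c k * f k ω := fun n =>
    Finset.measurable_fun_sum _ fun k _ => (hf k).const_mul _
  have ht : ∀ ω, Tendsto (fun n => ∑ k ∈ Finset.range n, c k * f k ω) atTop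
      (𝓝 (∑' n, c n * f n ω)) := fun ω => (hsum ω).hasSum.tendsto_sum_nat
  have := hL.tendsto (fun n ω => ∑ k ∈ Finset.range n, c k * f k ω) (fun ω => ∑' n, c n * f n ω)
    (∑' n, ‖c n‖ * C) hm (fun n ω => ?_) (measurable_of_tendsto_metrizable hm (tendsto_pi_nhds.mpr ht))
    (.of_forall ht)
  · simp only [fun n => hL.finset_sum (fun k => (hbm k).const_mul (c k)) (Finset.range n),
      fun k => hL.smul (c k) _ (hbm k)] at this
    have h2 := (Summable.of_norm hs).hasSum
    rwa [tendsto_nhds_unique h2.tendsto_sum_nat this] at h2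
  · refine (norm_sum_le _ _).trans ((Finset.sum_le_sum fun k _ => ?_).trans
      (Summable.sum_le_tsum (Finset.range n) (fun k _ => ?_) (hc.mul_right C)))
    · rw [norm_mul]; exact mul_le_mul_of_nonneg_left (hC k ω) (norm_nonneg _)
    · exact mul_nonneg (norm_nonneg _) ((norm_nonneg _).trans (hC k ω))

end DominatedLinear

theorem bddMeasurable_tsum {f : ℕ → X → ℂ} (hf : ∀ n, Measurable (f n)) {C : ℝ}
    (hC : ∀ n ω, ‖f n ω‖ ≤ C) {c : ℕ → ℂ} (hc : Summable fun n => ‖c n‖) :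
    Measurable (fun ω => ∑' n, c n * f n ω) ∧ ∀ ω, ‖∑' n, c n * f n ω‖ ≤ (∑' n, ‖c n‖) * C := by
  have hle : ∀ ω n, ‖c n * f n ω‖ ≤ ‖c n‖ * C := fun ω n => by
    rw [norm_mul]; exact mul_le_mul_of_nonneg_left (hC n ω) (norm_nonneg _)
  have hsum : ∀ ω, Summable fun n => c n * f n ω := fun ω =>
    .of_norm_bounded (hc.mul_right C) (hle ω)
  refine ⟨measurable_of_tendsto_metrizable
    (f := fun n ω => ∑ k ∈ Finset.range n, c k * f k ω)
    (fun n => Finset.measurable_fun_sum _ fun k _ => (hf k).const_mul _)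
    (tendsto_pi_nhds.mpr fun ω => (hsum ω).hasSum.tendsto_sum_nat), fun ω => ?_⟩
  rw [← tsum_mul_right]
  exact tsum_of_norm_bounded (hc.mul_right C).hasSum (hle ω)

end DominatedFunctionals

/-! ### Complex measures given as absolutely convergent sums of probability measures. -/

section ComplexMeasures

variable {X : Type*} [MeasurableSpace X]

theorem dominatedAdditive_vectorIntegral {ν : ComplexMeasure X} [IsFiniteMeasure ν.variation]
    {M : Measure X} (hM : ν.variation ≤ M) :
    DominatedAdditive M fun f => ∫ᵛ ω, f ω ∂[ContinuousLinearMap.mul ℝ ℂ; ν] where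
  add _ _ hf hg := VectorMeasure.integral_fun_add (hf.integrable _) (hg.integrable _)
  tendsto _ _ C hf hC _ hlim :=
    VectorMeasure.tendsto_integral_of_dominated_convergence (fun _ => C)
      (fun n => (hf n).aestronglyMeasurable) (integrable_const _) (fun n => .of_forall (hC n))
      (ae_mono hM hlim)

/-- The integral is formed with a real bilinear map, so homogeneity over `ℂ` is checked separately:
`f ↦ ∫ c f` and `f ↦ c ∫ f` are both dominated and additive, and they agree on indicators. -/
theorem dominatedLinear_vectorIntegral {ν : ComplexMeasure X} [IsFiniteMeasure ν.variation]
    {M : Measure X} (hM : ν.variation ≤ M) :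
    DominatedLinear M fun f => ∫ᵛ ω, f ω ∂[ContinuousLinearMap.mul ℝ ℂ; ν] where
  toDominatedAdditive := dominatedAdditive_vectorIntegral hM
  smul c f hf := by
    have h := dominatedAdditive_vectorIntegral hM
    refine DominatedAdditive.eq_of_indicator (M := M)
      (L₁ := fun f => ∫ᵛ ω, c * f ω ∂[ContinuousLinearMap.mul ℝ ℂ; ν])
      (L₂ := fun f => c * ∫ᵛ ω, f ω ∂[ContinuousLinearMap.mul ℝ ℂ; ν]) ⟨?_, ?_⟩ ⟨?_, ?_⟩ ?_ hf
    · intro f g hf hg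
      simp only [mul_add]
      exact h.add _ _ (hf.const_mul c) (hg.const_mul c)
    · intro f g C hf hC hg hlim
      refine h.tendsto (fun n ω => c * f n ω) (fun ω => c * g ω) (‖c‖ * C)
        (fun n => (hf n).const_mul c) (fun n ω => ?_) (hg.const_mul c) ?_
      · rw [norm_mul]; exact mul_le_mul_of_nonneg_left (hC n ω) (norm_nonneg _)
      · filter_upwards [hlim] with ω hω using hω.const_mul _
    · intro f g hf hg
      have := h.add _ _ hf hg
      simp only at this ⊢
      rw [this, mul_add]
    · intro f g C hf hC hg hlim
      exact (h.tendsto f g C hf hC hg hlim).const_mul c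
    · intro d E hE
      have : (fun ω => c * E.indicator (fun _ => d) ω) = E.indicator fun _ => c * d := by
        ext ω; by_cases hω : ω ∈ E <;> simp [hω]
      simp only [this]
      rw [VectorMeasure.integral_indicator_const _ hE, VectorMeasure.integral_indicator_const _ hE]
      simp [mul_assoc]

/-- The measure `∑_k |β k| μ_k`. -/
def dominatingMeasure {κ : Type*} (β : κ → ℂ) (μ : κ → Measure X) : Measure X :=
  Measure.sum fun k => ‖β k‖ₑ • μ k

variable {κ : Type*} {β : κ → ℂ} {μ : κ → Measure X}

theorem dominatingMeasure_univ [∀ k, IsProbabilityMeasure (μ k)] (hβ : Summable fun k => ‖β k‖) :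
    dominatingMeasure β μ Set.univ = ENNReal.ofReal (∑' k, ‖β k‖) := by
  rw [dominatingMeasure, Measure.sum_apply _ MeasurableSet.univ,
    ENNReal.ofReal_tsum_of_nonneg (fun _ => norm_nonneg _) hβ]
  simp

theorem isFiniteMeasure_dominatingMeasure [∀ k, IsProbabilityMeasure (μ k)]
    (hβ : Summable fun k => ‖β k‖) : IsFiniteMeasure (dominatingMeasure β μ) :=
  ⟨by rw [dominatingMeasure_univ hβ]; exact ENNReal.ofReal_lt_top⟩

theorem ae_of_ae_dominatingMeasure [Countable κ] {p : X → Prop}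
    (h : ∀ᵐ ω ∂(dominatingMeasure β μ), p ω) {k : κ} (hk : β k ≠ 0) : ∀ᵐ ω ∂(μ k), p ω := by
  rw [dominatingMeasure, Measure.ae_sum_iff] at h
  have := h k
  rwa [Measure.ae_ennreal_smul_measure_iff (by simpa using hk)] at this

theorem ae_dominatingMeasure [Countable κ] {p : X → Prop}
    (h : ∀ k, ∀ᵐ ω ∂(μ k), p ω) : ∀ᵐ ω ∂(dominatingMeasure β μ), p ω := by
  rw [dominatingMeasure, Measure.ae_sum_iff]
  exact fun k => Measure.ae_smul_measure (h k) _

/-- Countable additivity is an interchange of sums, legitimate since `∑_k ∑_i |β k| μ_k(f i) ≤ ∑ |β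
k|`. The bound `|ν E| ≤ ∑ |β k| μ_k(E)` on sets passes to the variation, the least measure
dominating `ν`. -/
theorem exists_complexMeasure_sum [∀ k, IsProbabilityMeasure (μ k)]
    (hβ : Summable fun k => ‖β k‖) :
    ∃ ν : ComplexMeasure X, (∀ E, MeasurableSet E → ν E = ∑' k, β k * (μ k).real E) ∧
      ν.variation ≤ dominatingMeasure β μ := by
  classical
  have hle : ∀ E k, ‖β k * ((μ k).real E : ℂ)‖ ≤ ‖β k‖ := fun E k => by
    rw [norm_mul, Complex.norm_real, Real.norm_of_nonneg measureReal_nonneg]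
    exact mul_le_of_le_one_right (norm_nonneg _) measureReal_le_one
  let ν : ComplexMeasure X :=
    { measureOf' := fun E => if MeasurableSet E then ∑' k, β k * (μ k).real E else 0
      empty' := by simp
      not_measurable' := fun E hE => by simp [hE]
      m_iUnion' := by
        intro f hf hd
        have hm : ∀ k, HasSum (fun i => (μ k).real (f i)) ((μ k).real (⋃ i, f i)) := by
          intro k
          have := (measure_iUnion (μ := μ k) hd hf)
          simp only [Measure.real, this]
          rw [ENNReal.tsum_toReal_eq fun i => measure_ne_top _ _]
          exact ENNReal.hasSum_toReal (by rw [← this]; exact measure_ne_top _ _)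
        have hmc : ∀ k, HasSum (fun i => β k * ((μ k).real (f i) : ℂ))
            (β k * ((μ k).real (⋃ i, f i) : ℂ)) := fun k =>
          (Complex.hasSum_ofReal.mpr (hm k)).mul_left _
        have hprod : Summable fun q : κ × ℕ => β q.1 * ((μ q.1).real (f q.2) : ℂ) := by
          refine Summable.of_norm ?_
          rw [summable_prod_of_nonneg (fun _ => norm_nonneg _)]
          have hk : ∀ k, HasSum (fun i => ‖β k * ((μ k).real (f i) : ℂ)‖)
              (‖β k‖ * (μ k).real (⋃ i, f i)) := by
            intro k
            have := (hm k).mul_left ‖β k‖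
            refine this.congr_fun ?_ 
            intro i
            rw [norm_mul, Complex.norm_real, Real.norm_of_nonneg measureReal_nonneg]
          refine ⟨fun k => (hk k).summable, ?_⟩
          simp only [fun k => (hk k).tsum_eq]
          exact .of_nonneg_of_le (fun k => by positivity)
            (fun k => mul_le_of_le_one_right (norm_nonneg _) measureReal_le_one) hβ
        simp only [hf, if_true, MeasurableSet.iUnion hf]
        have h1 := hprod.prod_symm.prod.hasSum
        have h2 : ∑' i, ∑' k, β k * ((μ k).real (f i) : ℂ) = ∑' k, ∑' i, β k * ((μ k).real (f i) : ℂ) :=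
          hprod.tsum_comm
        simp only [Prod.swap_prod_mk] at h1
        rw [h2] at h1
        simpa only [fun k => (hmc k).tsum_eq] using h1 }
  have hν : ∀ E, MeasurableSet E → ν E = ∑' k, β k * (μ k).real E := fun E hE => if_pos hE
  refine ⟨ν, hν, VectorMeasure.variation_le_of_forall_enorm_le fun E hE => ?_⟩
  rw [hν E hE, dominatingMeasure, Measure.sum_apply _ hE]
  refine (enorm_tsum_le_tsum_enorm).trans (ENNReal.tsum_le_tsum fun k => ?_)
  rw [enorm_mul, Measure.smul_apply, smul_eq_mul]
  gcongr
  rw [Measure.real, ← ofReal_norm, Complex.norm_real, Real.norm_of_nonneg ENNReal.toReal_nonneg,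
    ENNReal.ofReal_toReal (measure_ne_top _ _)]

theorem vectorIntegral_eq_tsum [Countable κ] [∀ k, IsProbabilityMeasure (μ k)]
    (hβ : Summable fun k => ‖β k‖) {ν : ComplexMeasure X}
    (hν : ∀ E, MeasurableSet E → ν E = ∑' k, β k * (μ k).real E)
    (hvar : ν.variation ≤ dominatingMeasure β μ) {f : X → ℂ} (hf : BddMeasurable f) :
    ∫ᵛ ω, f ω ∂[ContinuousLinearMap.mul ℝ ℂ; ν] = ∑' k, β k * ∫ ω, f ω ∂(μ k) := by
  have := isFiniteMeasure_dominatingMeasure (μ := μ) hβ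
  have : IsFiniteMeasure ν.variation := isFiniteMeasure_of_le _ hvar
  have hle : ∀ {f : X → ℂ} {C : ℝ}, (∀ ω, ‖f ω‖ ≤ C) → ∀ k, ‖β k * ∫ ω, f ω ∂(μ k)‖ ≤ ‖β k‖ * C := by
    intro f C hC k
    rw [norm_mul]
    refine mul_le_mul_of_nonneg_left ?_ (norm_nonneg _)
    simpa using norm_integral_le_of_norm_le_const (μ := μ k) (.of_forall hC)
  refine (dominatedAdditive_vectorIntegral hvar).eq_of_indicator
    (L₂ := fun f => ∑' k, β k * ∫ ω, f ω ∂(μ k)) ⟨fun f g hf hg => ?_, ?_⟩ ?_ hf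
  · obtain ⟨C, hC⟩ := hf.2
    obtain ⟨D, hD⟩ := hg.2
    rw [← Summable.tsum_add (.of_norm_bounded (hβ.mul_right C) (hle hC))
      (.of_norm_bounded (hβ.mul_right D) (hle hD))]
    refine tsum_congr fun k => ?_
    rw [integral_add (hf.integrable _) (hg.integrable _), mul_add]
  · intro f g C hf hC hg hlim
    refine tendsto_tsum_of_dominated_convergence (hβ.mul_right C) (fun k => ?_)
      (.of_forall fun n k => hle (hC n) k)
    -- Convergence a.e. for the dominating measure says nothing about `μ k` when its weight is zero,
    -- but that term vanishes.
    by_cases hk : β k = 0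
    · simp [hk]
    · refine Tendsto.const_mul _ ?_
      exact tendsto_integral_of_dominated_convergence (fun _ => C)
        (fun n => (hf n).aestronglyMeasurable) (integrable_const _) (fun n => .of_forall (hC n))
        (ae_of_ae_dominatingMeasure hlim hk)
  · intro c E hE
    rw [VectorMeasure.integral_indicator_const _ hE, hν E hE]
    simp only [ContinuousLinearMap.mul_apply']
    rw [← tsum_mul_left]
    refine tsum_congr fun k => ?_
    rw [integral_indicator_const _ hE, Complex.real_smul]
    ring

/-- A compact `K ⊆ A` with `M (A \ K)` small has `v (A \ K)` small. This makes the variation of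
`Φ(y)` regular although it is only known through an upper bound. -/
theorem regular_of_le [TopologicalSpace X] [T2Space X] [BorelSpace X] {v M : Measure X}
    [IsFiniteMeasure M] [M.InnerRegular] (h : v ≤ M) : v.Regular := by
  have : IsFiniteMeasure v := isFiniteMeasure_of_le _ h
  have : v.InnerRegularCompactLTTop := by
    refine ⟨fun A hA r hr => ?_⟩
    obtain ⟨ε, hε, hrε⟩ : ∃ ε, ε ≠ 0 ∧ r + ε < v A := by
      obtain ⟨q, hq1, hq2⟩ := exists_between hr
      exact ⟨q - r, (tsub_pos_of_lt hq1).ne', by rwa [add_tsub_cancel_of_le hq1.le]⟩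
    obtain ⟨K, hKA, hK, hMK⟩ := hA.1.exists_isCompact_sdiff_lt (measure_ne_top M A) hε
    refine ⟨K, hKA, hK, ?_⟩
    have h1 : v A ≤ v K + ε := by
      calc v A ≤ v K + v (A \ K) := by
            rw [← Set.union_sdiff_cancel hKA]
            refine (measure_union_le _ _).trans_eq ?_
            simp [Set.union_sdiff_cancel hKA]
        _ ≤ v K + ε := by gcongr; exact (h _).trans hMK.le
    have h2 : r + ε < v K + ε := hrε.trans_le h1
    exact lt_of_add_lt_add_right h2
  infer_instance

theorem innerRegular_dominatingMeasure [TopologicalSpace X] [BorelSpace X]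
    [∀ k, IsProbabilityMeasure (μ k)] [∀ k, (μ k).Regular] :
    (dominatingMeasure β μ).InnerRegular := by
  unfold dominatingMeasure
  infer_instance

end ComplexMeasures

/-! ### Sums of products over finite subsets. -/

section SubsetSums

variable {ι : Type*}

/-- `∑_{w ⊆ S} q(#w) ∏_{a ∈ w} t(a)`. -/
def subsetSum (q : ℕ → ℝ) (t : ι → ℝ) (S : Finset ι) : ℝ :=
  ∑ w ∈ S.powerset, q w.card * ∏ a ∈ w, t a

theorem subsetSum_empty (q : ℕ → ℝ) (t : ι → ℝ) : subsetSum q t ∅ = q 0 := by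
  simp [subsetSum]

theorem subsetSum_insert [DecidableEq ι] (q : ℕ → ℝ) (t : ι → ℝ) {S : Finset ι} {a : ι}
    (ha : a ∉ S) :
    subsetSum q t (insert a S) = subsetSum q t S + t a * subsetSum (fun k => q (k + 1)) t S := by
  rw [subsetSum, Finset.sum_powerset_insert ha, subsetSum, subsetSum, Finset.mul_sum]
  congr 1
  refine Finset.sum_congr rfl fun w hw => ?_
  have haw : a ∉ w := fun h => ha (Finset.mem_powerset.mp hw h)
  rw [Finset.card_insert_of_notMem haw, Finset.prod_insert haw]
  ring

/-- The indicator of the odd numbers. -/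
def oddInd (k : ℕ) : ℝ := if Odd k then 1 else 0
/-- The indicator of the even numbers. -/
def evenInd (k : ℕ) : ℝ := if Even k then 1 else 0
/-- The indicator of the odd numbers other than `1`. -/
def oddIndNeOne (k : ℕ) : ℝ := if Odd k ∧ k ≠ 1 then 1 else 0
/-- The indicator of the even numbers other than `0`. -/
def evenIndNeZero (k : ℕ) : ℝ := if Even k ∧ k ≠ 0 then 1 else 0

theorem oddInd_succ : (fun k => oddInd (k + 1)) = evenInd := by
  ext k; simp [oddInd, evenInd, Nat.odd_add_one]

theorem evenInd_succ : (fun k => evenInd (k + 1)) = oddInd := by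
  ext k; simp [oddInd, evenInd, Nat.even_add_one]

theorem oddIndNeOne_succ : (fun k => oddIndNeOne (k + 1)) = evenIndNeZero := by
  ext k; simp [oddIndNeOne, evenIndNeZero, Nat.odd_add_one]

theorem evenIndNeZero_succ : (fun k => evenIndNeZero (k + 1)) = oddInd := by
  ext k; simp [oddInd, evenIndNeZero, Nat.even_add_one]

/-- Adding a point to `S` mirrors the addition formulas for `sinh` and `cosh`, with `1 ≤ cosh t` and
`t ≤ sinh t`. It shifts the order by one and so exchanges the parities, whence the simultaneous
induction. -/
theorem subsetSum_parity_le {t : ι → ℝ} (ht : ∀ a, 0 ≤ t a) (S : Finset ι) :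
    subsetSum oddInd t S ≤ Real.sinh (∑ a ∈ S, t a) ∧
    subsetSum evenInd t S ≤ Real.cosh (∑ a ∈ S, t a) ∧
    subsetSum oddIndNeOne t S ≤ Real.sinh (∑ a ∈ S, t a) - ∑ a ∈ S, t a ∧
    subsetSum evenIndNeZero t S ≤ Real.cosh (∑ a ∈ S, t a) - 1 := by
  classical
  induction S using Finset.induction_on with
  | empty => simp [subsetSum_empty, oddInd, evenInd, oddIndNeOne, evenIndNeZero]
  | insert a S ha ih =>
    obtain ⟨h1, h2, h3, h4⟩ := ih
    simp only [subsetSum_insert _ _ ha, oddInd_succ, evenInd_succ, oddIndNeOne_succ,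
      evenIndNeZero_succ, Finset.sum_insert ha]
    set T := ∑ a ∈ S, t a
    have hT : 0 ≤ T := Finset.sum_nonneg fun a _ => ht a
    have hc := Real.one_le_cosh (t a)
    have hs := Real.self_le_sinh_iff.mpr (ht a)
    have hsT : 0 ≤ Real.sinh T := Real.sinh_nonneg_iff.mpr hT
    have hcT := Real.one_le_cosh T
    rw [add_comm (t a) T, Real.sinh_add, Real.cosh_add]
    have ha := ht a
    have e1 := mul_le_mul_of_nonneg_left h1 ha
    have e2 := mul_le_mul_of_nonneg_left h2 ha
    have e4 := mul_le_mul_of_nonneg_left h4 ha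
    have f1 : Real.sinh T ≤ Real.sinh T * Real.cosh (t a) := le_mul_of_one_le_right hsT hc
    have f2 : Real.cosh T * t a ≤ Real.cosh T * Real.sinh (t a) :=
      mul_le_mul_of_nonneg_left hs (by linarith)
    have f3 : Real.cosh T ≤ Real.cosh T * Real.cosh (t a) :=
      le_mul_of_one_le_right (by linarith) hc
    have f4 : Real.sinh T * t a ≤ Real.sinh T * Real.sinh (t a) := mul_le_mul_of_nonneg_left hs hsT
    refine ⟨?_, ?_, ?_, ?_⟩ <;> linarith

theorem sum_le_subsetSum {q : ℕ → ℝ} (hq : ∀ k, 0 ≤ q k) {t : ι → ℝ} (ht : ∀ a, 0 ≤ t a)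
    (F : Finset (Finset ι)) : ∃ S : Finset ι, ∑ w ∈ F, q w.card * ∏ a ∈ w, t a ≤ subsetSum q t S := by
  classical
  refine ⟨F.biUnion id, Finset.sum_le_sum_of_subset_of_nonneg (fun w hw => ?_) fun w _ _ =>
    mul_nonneg (hq _) (Finset.prod_nonneg fun a _ => ht a)⟩
  exact Finset.mem_powerset.mpr (Finset.subset_biUnion_of_mem id hw)

theorem subsetSum_one_le {t : ι → ℝ} (ht : ∀ a, 0 ≤ t a) (S : Finset ι) :
    subsetSum (fun _ => 1) t S ≤ Real.exp (∑ a ∈ S, t a) := by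
  simp only [subsetSum, one_mul, ← Finset.prod_one_add, Real.exp_sum]
  exact Finset.prod_le_prod (fun a _ => by linarith [ht a]) fun a _ => by
    rw [add_comm]; exact Real.add_one_le_exp _

/-- The left side is the derivative of `∏ (1 + τ)` in the direction `d`, that is `∑_c d c ∏_{a ≠ c}
(1 + τ a)`; inserting the missing factors `1 + τ c ≥ 1` only increases it. -/
theorem sum_powerset_sum_erase_le [DecidableEq ι] {d τ : ι → ℝ} (hd : ∀ a, 0 ≤ d a)
    (hτ : ∀ a, 0 ≤ τ a) (S : Finset ι) :
    ∑ w ∈ S.powerset, ∑ c ∈ w, d c * ∏ a ∈ w.erase c, τ a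
      ≤ (∑ a ∈ S, d a) * ∏ a ∈ S, (1 + τ a) := by
  induction S using Finset.induction_on with
  | empty => simp
  | insert b S hb ih =>
    rw [Finset.sum_powerset_insert hb, Finset.sum_insert hb, Finset.prod_insert hb]
    have h1 : ∑ w ∈ S.powerset, ∑ c ∈ insert b w, d c * ∏ a ∈ (insert b w).erase c, τ a
        = d b * ∏ a ∈ S, (1 + τ a)
          + τ b * ∑ w ∈ S.powerset, ∑ c ∈ w, d c * ∏ a ∈ w.erase c, τ a := by
      rw [Finset.prod_one_add, Finset.mul_sum, Finset.mul_sum, ← Finset.sum_add_distrib]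
      refine Finset.sum_congr rfl fun w hw => ?_
      have hbw : b ∉ w := fun h => hb (Finset.mem_powerset.mp hw h)
      rw [Finset.sum_insert hbw, Finset.erase_insert hbw, Finset.mul_sum]
      congr 1
      refine Finset.sum_congr rfl fun c hc => ?_
      have hbc : b ≠ c := fun h => hbw (h ▸ hc)
      rw [Finset.erase_insert_of_ne hbc, Finset.prod_insert (fun h => hbw (Finset.mem_of_mem_erase h))]
      ring
    rw [h1]
    have hP : 0 ≤ ∏ a ∈ S, (1 + τ a) := Finset.prod_nonneg fun a _ => by linarith [hτ a]
    have h2 := mul_le_mul_of_nonneg_left ih (hτ b)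
    have h3 : 0 ≤ τ b * (d b * ∏ a ∈ S, (1 + τ a)) := mul_nonneg (hτ b) (mul_nonneg (hd b) hP)
    linarith

/-- Replace the factors `x a` by `y a` one at a time. -/
theorem abs_prod_sub_prod_le [DecidableEq ι] {x y m : ι → ℝ} (hx : ∀ a, |x a| ≤ m a)
    (hy : ∀ a, |y a| ≤ m a) (w : Finset ι) :
    |∏ a ∈ w, x a - ∏ a ∈ w, y a| ≤ ∑ c ∈ w, |x c - y c| * ∏ a ∈ w.erase c, m a := by
  induction w using Finset.induction_on with
  | empty => simp
  | insert b w hb ih =>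
    rw [Finset.prod_insert hb, Finset.prod_insert hb, Finset.sum_insert hb, Finset.erase_insert hb]
    have h1 : ∑ c ∈ w, |x c - y c| * ∏ a ∈ (insert b w).erase c, m a
        = m b * ∑ c ∈ w, |x c - y c| * ∏ a ∈ w.erase c, m a := by
      rw [Finset.mul_sum]
      refine Finset.sum_congr rfl fun c hc => ?_
      have hbc : b ≠ c := fun h => hb (h ▸ hc)
      rw [Finset.erase_insert_of_ne hbc, Finset.prod_insert (fun h => hb (Finset.mem_of_mem_erase h))]
      ring
    rw [h1]
    have h2 : |∏ a ∈ w, x a| ≤ ∏ a ∈ w, m a := by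
      rw [Finset.abs_prod]
      exact Finset.prod_le_prod (fun a _ => abs_nonneg _) fun a _ => hx a
    calc |x b * ∏ a ∈ w, x a - y b * ∏ a ∈ w, y a|
        = |(x b - y b) * ∏ a ∈ w, x a + y b * (∏ a ∈ w, x a - ∏ a ∈ w, y a)| := by ring_nf
      _ ≤ |x b - y b| * |∏ a ∈ w, x a| + |y b| * |∏ a ∈ w, x a - ∏ a ∈ w, y a| := by
          rw [← abs_mul, ← abs_mul]; exact abs_add_le _ _
      _ ≤ _ := by
          refine add_le_add (mul_le_mul_of_nonneg_left h2 (abs_nonneg _)) ?_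
          exact mul_le_mul (hy b) ih (abs_nonneg _) ((abs_nonneg _).trans (hy b))

/-- The power mean inequality costs `#w ^ (p - 1)`. Since `#w ≤ 2 ^ (#w - 1)`, the cost is absorbed
as one factor `2 ^ (p - 1)` for each of the remaining `#w - 1` letters, which keeps the product
structure. -/
theorem rpow_abs_prod_sub_prod_le [DecidableEq ι] {p : ℝ} (hp : 1 ≤ p) {x y m : ι → ℝ}
    (hx : ∀ a, |x a| ≤ m a) (hy : ∀ a, |y a| ≤ m a) (w : Finset ι) :
    |∏ a ∈ w, x a - ∏ a ∈ w, y a| ^ p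
      ≤ ∑ c ∈ w, |x c - y c| ^ p * ∏ a ∈ w.erase c, (2 ^ (p - 1) * m a ^ p) := by
  have hm : ∀ a, 0 ≤ m a := fun a => (abs_nonneg _).trans (hx a)
  have h0 : ∀ c, 0 ≤ |x c - y c| * ∏ a ∈ w.erase c, m a := fun c =>
    mul_nonneg (abs_nonneg _) (Finset.prod_nonneg fun a _ => hm a)
  calc |∏ a ∈ w, x a - ∏ a ∈ w, y a| ^ p
      ≤ (∑ c ∈ w, |(|x c - y c| * ∏ a ∈ w.erase c, m a)|) ^ p := by
        refine Real.rpow_le_rpow (abs_nonneg _) ((abs_prod_sub_prod_le hx hy w).trans_eq ?_)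
          (by linarith)
        exact Finset.sum_congr rfl fun c _ => (abs_of_nonneg (h0 c)).symm
    _ ≤ (w.card : ℝ) ^ (p - 1) * ∑ c ∈ w, |(|x c - y c| * ∏ a ∈ w.erase c, m a)| ^ p :=
        Real.rpow_sum_le_const_mul_sum_rpow w _ hp
    _ ≤ _ := by
        rw [Finset.mul_sum]
        refine Finset.sum_le_sum fun c hc => ?_
        rw [abs_of_nonneg (h0 c), Real.mul_rpow (abs_nonneg _) (Finset.prod_nonneg fun a _ => hm a),
          Finset.prod_mul_distrib, Finset.prod_const, Finset.card_erase_of_mem hc,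
          ← Real.finsetProd_rpow _ _ (fun a _ => hm a)]
        have h1 : (w.card : ℝ) ^ (p - 1) ≤ ((2 : ℝ) ^ (p - 1)) ^ (w.card - 1) := by
          rw [← Real.rpow_natCast, ← Real.rpow_mul (by norm_num), mul_comm,
            Real.rpow_mul (by norm_num), Real.rpow_natCast]
          refine Real.rpow_le_rpow (by positivity) ?_ (by linarith)
          have : 0 < w.card := Finset.card_pos.mpr ⟨c, hc⟩
          have h2 := Nat.lt_two_pow_self (n := w.card - 1)
          have : w.card ≤ 2 ^ (w.card - 1) := by omega
          exact_mod_cast this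
        have h2 : 0 ≤ |x c - y c| ^ p * ∏ a ∈ w.erase c, m a ^ p :=
          mul_nonneg (by positivity) (Finset.prod_nonneg fun a _ => Real.rpow_nonneg (hm a) _)
        calc (w.card : ℝ) ^ (p - 1) * (|x c - y c| ^ p * ∏ a ∈ w.erase c, m a ^ p)
            ≤ ((2 : ℝ) ^ (p - 1)) ^ (w.card - 1) * (|x c - y c| ^ p * ∏ a ∈ w.erase c, m a ^ p) :=
              mul_le_mul_of_nonneg_right h1 h2
          _ = _ := by ring

end SubsetSums

/-! ### A common form for the coefficients of `Q` and `P`. -/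

section BlockSign

/-- The factor depending on the order of the character in the coefficients of `Q^{(s)}` (`s ≤ 2`)
and `P^{(s)}` (`s > 2`). -/
def blockSign (s : ℝ≥0∞) (k : ℕ) : ℝ :=
  if s ≤ 2 then (Complex.I ^ k).im else (1 / 2) ^ k * (1 - (-1) ^ k)

/-- The factor `ε` for which the Riesz products in `Q^{(s)}` and `P^{(s)}` are taken at `ε x / ‖x‖_s`. -/
def blockScale (s : ℝ≥0∞) : ℝ := if s ≤ 2 then 1 else 1 / 2

theorem blockScale_pos (s : ℝ≥0∞) : 0 < blockScale s := by
  unfold blockScale; split_ifs <;> norm_num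

theorem blockScale_le_one (s : ℝ≥0∞) : blockScale s ≤ 1 := by
  unfold blockScale; split_ifs <;> norm_num

theorem blockSign_even (s : ℝ≥0∞) {k : ℕ} (hk : Even k) : blockSign s k = 0 := by
  unfold blockSign
  split_ifs
  · obtain ⟨j, rfl⟩ := hk
    rw [← two_mul, pow_mul, Complex.I_sq]
    rcases neg_one_pow_eq_or ℂ j with h | h <;> simp [h]
  · simp [hk.neg_one_pow]

theorem blockSign_one (s : ℝ≥0∞) : blockSign s 1 = 1 := by
  unfold blockSign
  split_ifs <;> norm_num

/-- Even orders vanish. At odd order `|Im i^k| ≤ 1` for `Q`, and for `P` the factor is `2 · 2^{-k}`,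
which is `ρ⁻¹ ρ^k` at `ρ = 1/2`. -/
theorem abs_blockSign_le (s : ℝ≥0∞) (k : ℕ) :
    |blockSign s k| ≤ oddInd k * ((blockScale s)⁻¹ * blockScale s ^ k) := by
  rcases Nat.even_or_odd k with hk | hk
  · simp [blockSign_even s hk, oddInd, Nat.not_odd_iff_even.mpr hk]
  · simp only [oddInd, hk, if_true, one_mul, blockSign, blockScale]
    split_ifs
    · refine (Complex.abs_im_le_norm _).trans ?_
      simp
    · rw [hk.neg_one_pow, abs_of_nonneg (by positivity)]
      norm_num
      linarith

theorem abs_blockSign_le_one (s : ℝ≥0∞) (k : ℕ) : |blockSign s k| ≤ 1 := by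
  rcases Nat.even_or_odd k with hk | hk
  · simp [blockSign_even s hk]
  · refine (abs_blockSign_le s k).trans ?_
    obtain ⟨j, rfl⟩ := hk
    have h := blockScale_pos s
    have : blockScale s ^ (2 * j) ≤ 1 := pow_le_one₀ h.le (blockScale_le_one s)
    simp only [oddInd, odd_two_mul_add_one, if_true, one_mul, pow_succ]
    field_simp
    exact this

/-- The decay `2^{1-k}` beats the factor `k` lost when two products of `k` letters are compared;
this gives the Lipschitz bound at `s = ∞`. -/
theorem abs_blockSign_mul_le_one {s : ℝ≥0∞} (hs : 2 < s) (k : ℕ) :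
    |blockSign s k| * k ≤ 1 := by
  rcases Nat.even_or_odd k with hk | ⟨j, rfl⟩
  · simp [blockSign_even s hk]
  · have h := abs_blockSign_le s (2 * j + 1)
    simp only [oddInd, odd_two_mul_add_one, if_true, one_mul, blockScale, if_neg hs.not_ge] at h
    have h1 : ((1 / 2 : ℝ))⁻¹ * (1 / 2) ^ (2 * j + 1) = (1 / 2) ^ (2 * j) := by
      rw [pow_succ]; ring
    rw [h1] at h
    have h2 : ((2 * j + 1 : ℕ) : ℝ) ≤ 2 ^ (2 * j) := by
      have := Nat.lt_two_pow_self (n := 2 * j)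
      exact_mod_cast this
    calc |blockSign s (2 * j + 1)| * ((2 * j + 1 : ℕ) : ℝ) ≤ (1 / 2) ^ (2 * j) * 2 ^ (2 * j) :=
          mul_le_mul h h2 (by positivity) (by positivity)
      _ = 1 := by rw [← mul_pow]; norm_num

theorem blockCoeff_eq {ι : Type*} (s : ℝ≥0∞) (x : ι → ℝ) (w : Finset ι) :
    blockCoeff s x w = lNorm s x * (blockSign s w.card * ∏ a ∈ w, sphNormalize s x a) := by
  unfold blockCoeff blockSign qCoeff pCoeff rieszCoeff
  split_ifs with h
  · have : ∏ a ∈ w, (Complex.I * ((1 : ℝ) : ℂ) * (sphNormalize s x a : ℂ))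
        = Complex.I ^ w.card * ((∏ a ∈ w, sphNormalize s x a : ℝ) : ℂ) := by
      push_cast
      rw [← Finset.prod_const, ← Finset.prod_mul_distrib]
      simp
    rw [this, Complex.im_mul_ofReal]
    ring
  · have h1 : ∏ a ∈ w, (1 * sphNormalize s x a / 2) = (1 / 2) ^ w.card * ∏ a ∈ w, sphNormalize s x a := by
      rw [← Finset.prod_const, ← Finset.prod_mul_distrib]
      exact Finset.prod_congr rfl fun a _ => by ring
    have h2 : ∏ a ∈ w, -(1 * sphNormalize s x a / 2)
        = (-1) ^ w.card * ((1 / 2) ^ w.card * ∏ a ∈ w, sphNormalize s x a) := by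
      rw [← h1, ← Finset.prod_const, ← Finset.prod_mul_distrib]
      exact Finset.prod_congr rfl fun a _ => by ring
    rw [h1, h2]
    ring

end BlockSign

open Cube

/-! ### Comparison of `l^s` norms along injections. -/

section LpMaps

variable {ι κ : Type*} {E F : Type*} [NormedAddCommGroup E] [NormedAddCommGroup F]

theorem one_le_toReal_of_fact {s : ℝ≥0∞} (h1 : 1 ≤ s) (hs : s ≠ ∞) : 1 ≤ s.toReal := by
  simpa using ENNReal.toReal_mono hs h1

/-- A family dominated by an element of `l^s` along an injective partial reindexing is in `l^s`. -/
theorem memlp_and_norm_le_of_dominated {s : ℝ≥0∞} (h1 : 1 ≤ s) (f : lp (fun _ : ι => E) s)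
    {g : κ → F} {e : ι → κ} (he : Function.Injective e) (h0 : ∀ k, k ∉ Set.range e → g k = 0)
    (hle : ∀ i, ‖g (e i)‖ ≤ ‖f i‖) :
    ∃ hg : Memℓp g s, ‖(⟨g, hg⟩ : lp (fun _ : κ => F) s)‖ ≤ ‖f‖ := by
  have := Fact.mk h1
  rcases eq_or_ne s ∞ with rfl | hs
  · have hb : ∀ k, ‖g k‖ ≤ ‖f‖ := by
      intro k
      by_cases hk : k ∈ Set.range e
      · obtain ⟨i, rfl⟩ := hk
        exact (hle i).trans (lp.norm_apply_le_norm (by simp) f i)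
      · rw [h0 k hk, norm_zero]; exact norm_nonneg f
    refine ⟨memℓp_infty ⟨‖f‖, ?_⟩, lp.norm_le_of_forall_le (norm_nonneg f) hb⟩
    rintro _ ⟨k, rfl⟩
    exact hb k
  · have hp := one_le_toReal_of_fact h1 hs
    have hp0 : 0 < s.toReal := by linarith
    have hb : ∀ S : Finset κ, ∑ k ∈ S, ‖g k‖ ^ s.toReal ≤ ‖f‖ ^ s.toReal := by
      intro S
      rw [← Finset.sum_preimage e S he.injOn (fun k => ‖g k‖ ^ s.toReal)
        (fun k _ hk => by rw [h0 k hk, norm_zero, Real.zero_rpow hp0.ne'])]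
      refine le_trans (Finset.sum_le_sum fun i _ => ?_) (lp.sum_rpow_le_norm_rpow hp0 f _)
      exact Real.rpow_le_rpow (norm_nonneg _) (hle i) hp0.le
    exact ⟨memℓp_gen' hb, lp.norm_le_of_forall_sum_le hp0 (norm_nonneg f) hb⟩

theorem memlp_and_norm_le_of_injective {s : ℝ≥0∞} (h1 : 1 ≤ s) (f : lp (fun _ : ι => E) s)
    {g : κ → F} {e : κ → ι} (he : Function.Injective e) (hle : ∀ k, ‖g k‖ ≤ ‖f (e k)‖) :
    ∃ hg : Memℓp g s, ‖(⟨g, hg⟩ : lp (fun _ : κ => F) s)‖ ≤ ‖f‖ := by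
  have := Fact.mk h1
  rcases eq_or_ne s ∞ with rfl | hs
  · have hb : ∀ k, ‖g k‖ ≤ ‖f‖ := fun k => (hle k).trans (lp.norm_apply_le_norm (by simp) f _)
    refine ⟨memℓp_infty ⟨‖f‖, ?_⟩, lp.norm_le_of_forall_le (norm_nonneg f) hb⟩
    rintro _ ⟨k, rfl⟩
    exact hb k
  · have hp := one_le_toReal_of_fact h1 hs
    have hp0 : 0 < s.toReal := by linarith
    have hb : ∀ S : Finset κ, ∑ k ∈ S, ‖g k‖ ^ s.toReal ≤ ‖f‖ ^ s.toReal := by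
      intro S
      refine le_trans (Finset.sum_le_sum fun k _ =>
        Real.rpow_le_rpow (norm_nonneg _) (hle k) hp0.le) ?_
      have h := lp.sum_rpow_le_norm_rpow hp0 f (S.map ⟨e, he⟩)
      rwa [Finset.sum_map] at h
    exact ⟨memℓp_gen' hb, lp.norm_le_of_forall_sum_le hp0 (norm_nonneg f) hb⟩

theorem lp_norm_le_of_injective {s : ℝ≥0∞} (h1 : 1 ≤ s) (f : lp (fun _ : ι => E) s)
    (g : lp (fun _ : κ => F) s) {e : κ → ι} (he : Function.Injective e)
    (hle : ∀ k, ‖g k‖ ≤ ‖f (e k)‖) : ‖g‖ ≤ ‖f‖ :=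
  (memlp_and_norm_le_of_injective h1 f he hle).2

theorem lp_norm_le_of_dominated {s : ℝ≥0∞} (h1 : 1 ≤ s) (f : lp (fun _ : ι => E) s)
    (g : lp (fun _ : κ => F) s) {e : ι → κ} (he : Function.Injective e)
    (h0 : ∀ k, k ∉ Set.range e → g k = 0) (hle : ∀ i, ‖g (e i)‖ ≤ ‖f i‖) : ‖g‖ ≤ ‖f‖ :=
  (memlp_and_norm_le_of_dominated h1 f he h0 hle).2

end LpMaps

/-! ### Norm bounds for a single block and the constant `δ_s`. -/

section Block

variable {ι : Type*} {s : ℝ≥0∞}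

theorem rpow_abs_blockSign_mul_prod_le {p : ℝ} (hp : 0 < p) (s : ℝ≥0∞) (z : ι → ℝ) (w : Finset ι) :
    |blockSign s w.card * ∏ a ∈ w, z a| ^ p
      ≤ (blockScale s ^ p)⁻¹ * (oddInd w.card * ∏ a ∈ w, (blockScale s * |z a|) ^ p) := by
  have hρ := blockScale_pos s
  have hodd : oddInd w.card ^ p = oddInd w.card := by
    unfold oddInd; split_ifs
    · simp
    · exact Real.zero_rpow hp.ne'
  have h0 : 0 ≤ oddInd w.card := by unfold oddInd; split_ifs <;> norm_num
  have hprod : 0 ≤ ∏ a ∈ w, |z a| := Finset.prod_nonneg fun a _ => abs_nonneg _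
  calc |blockSign s w.card * ∏ a ∈ w, z a| ^ p
      ≤ (oddInd w.card * ((blockScale s)⁻¹ * blockScale s ^ w.card) * ∏ a ∈ w, |z a|) ^ p := by
        rw [abs_mul, Finset.abs_prod]
        exact Real.rpow_le_rpow (by positivity)
          (mul_le_mul_of_nonneg_right (abs_blockSign_le s _) hprod) hp.le
    _ = (oddInd w.card * (blockScale s)⁻¹ * ∏ a ∈ w, (blockScale s * |z a|)) ^ p := by
        rw [Finset.prod_mul_distrib, Finset.prod_const]; ring_nf
    _ = _ := by
        rw [Real.mul_rpow (by positivity) (Finset.prod_nonneg fun a _ => by positivity),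
          Real.mul_rpow h0 (by positivity), hodd, Real.inv_rpow hρ.le,
          Real.finsetProd_rpow _ _ (fun a _ => by positivity)]
        ring

theorem sum_scaled_le {p : ℝ} (s : ℝ≥0∞) {z : ι → ℝ} (hz : InUnitBall p z) (S : Finset ι) :
    ∑ a ∈ S, (blockScale s * |z a|) ^ p ≤ blockScale s ^ p := by
  simp only [Real.mul_rpow (blockScale_pos s).le (abs_nonneg _), ← Finset.mul_sum]
  exact mul_le_of_le_one_right (Real.rpow_nonneg (blockScale_pos s).le _) (hz S)

/-- The `p`-th powers are again multiplicative in the letters, so this is an odd subset sum of `(ρ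
|z|)^p`, whose total mass is at most `ρ^p`. -/
theorem sum_rpow_block_le {p : ℝ} (hp : 0 < p) (s : ℝ≥0∞) {z : ι → ℝ} (hz : InUnitBall p z)
    (F : Finset (Finset ι)) :
    ∑ w ∈ F, |blockSign s w.card * ∏ a ∈ w, z a| ^ p
      ≤ (blockScale s ^ p)⁻¹ * Real.sinh (blockScale s ^ p) := by
  have hρ := blockScale_pos s
  have ht : ∀ a, 0 ≤ (blockScale s * |z a|) ^ p := fun a => by positivity
  refine (Finset.sum_le_sum fun w _ => rpow_abs_blockSign_mul_prod_le hp s z w).trans ?_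
  rw [← Finset.mul_sum]
  obtain ⟨S, hS⟩ := sum_le_subsetSum (q := oddInd) (fun k => by unfold oddInd; split_ifs <;> norm_num)
    ht F
  refine mul_le_mul_of_nonneg_left (hS.trans ((subsetSum_parity_le ht S).1.trans ?_)) (by positivity)
  exact Real.sinh_le_sinh.mpr (sum_scaled_le s hz S)

/-- Discarding the Rademacher characters replaces `sinh T` by the still increasing `sinh T - T`. At
`p = s < ∞` this is the source of `δ_s`. -/
theorem sum_rpow_block_ne_one_le {p : ℝ} (hp : 0 < p) (s : ℝ≥0∞) {z : ι → ℝ}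
    (hz : InUnitBall p z) (F : Finset (Finset ι)) (hF : ∀ w ∈ F, w.card ≠ 1) :
    ∑ w ∈ F, |blockSign s w.card * ∏ a ∈ w, z a| ^ p
      ≤ (blockScale s ^ p)⁻¹ * (Real.sinh (blockScale s ^ p) - blockScale s ^ p) := by
  have hρ := blockScale_pos s
  have ht : ∀ a, 0 ≤ (blockScale s * |z a|) ^ p := fun a => by positivity
  have h1 : ∀ w ∈ F, |blockSign s w.card * ∏ a ∈ w, z a| ^ p
      ≤ (blockScale s ^ p)⁻¹ * (oddIndNeOne w.card * ∏ a ∈ w, (blockScale s * |z a|) ^ p) := by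
    intro w hw
    refine (rpow_abs_blockSign_mul_prod_le hp s z w).trans_eq ?_
    simp [oddInd, oddIndNeOne, hF w hw]
  refine (Finset.sum_le_sum h1).trans ?_
  rw [← Finset.mul_sum]
  obtain ⟨S, hS⟩ := sum_le_subsetSum (q := oddIndNeOne)
    (fun k => by unfold oddIndNeOne; split_ifs <;> norm_num) ht F
  refine mul_le_mul_of_nonneg_left (hS.trans ((subsetSum_parity_le ht S).2.2.1.trans ?_))
    (by positivity)
  exact Real.sinh_sub_id_strictMono.monotone (sum_scaled_le s hz S)

theorem sinh_one_lt : Real.sinh 1 < 1.2 := by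
  rw [Real.sinh_eq]
  have h1 := Real.exp_one_lt_d9
  have h2 := Real.exp_neg_one_gt_d9
  linarith

/-- The second-order bounds for `exp t` and `exp (-t)` give `sinh t - t ≤ t² ≤ t / 4`. -/
theorem sinh_le_of_le_quarter {t : ℝ} (h0 : 0 ≤ t) (h1 : t ≤ 1 / 4) :
    Real.sinh t - t ≤ t / 4 := by
  have a := (abs_le.mp (Real.abs_exp_sub_one_sub_id_le (x := t) (by rw [abs_of_nonneg h0]; linarith))).2
  have b := (abs_le.mp (Real.abs_exp_sub_one_sub_id_le (x := -t)
    (by rw [abs_neg, abs_of_nonneg h0]; linarith))).1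
  rw [Real.sinh_eq]
  nlinarith

theorem blockScale_rpow_le (hs2 : 2 < s) (hs : s ≠ ∞) : blockScale s ^ s.toReal ≤ 1 / 4 := by
  have h2 : (2 : ℝ) ≤ s.toReal := by
    simpa using ENNReal.toReal_mono hs hs2.le
  rw [blockScale, if_neg hs2.not_ge]
  calc (1 / 2 : ℝ) ^ s.toReal ≤ (1 / 2 : ℝ) ^ (2 : ℝ) :=
        Real.rpow_le_rpow_of_exponent_ge (by norm_num) (by norm_num) h2
    _ = 1 / 4 := by norm_num

theorem sinh_scale_sub_nonneg (s : ℝ≥0∞) :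
    0 ≤ Real.sinh (blockScale s ^ s.toReal) - blockScale s ^ s.toReal :=
  sub_nonneg.mpr (Real.self_le_sinh_iff.mpr (Real.rpow_nonneg (blockScale_pos s).le _))

theorem deltaConst_nonneg (s : ℝ≥0∞) : 0 ≤ deltaConst s := by
  unfold deltaConst
  split_ifs
  · exact Real.rpow_nonneg (sub_nonneg.mpr (Real.self_le_sinh_iff.mpr zero_le_one)) _
  · norm_num
  · exact mul_nonneg zero_le_two (Real.rpow_nonneg (sub_nonneg.mpr
      (Real.self_le_sinh_iff.mpr (by positivity))) _)

theorem deltaConst_rpow (h1 : 1 ≤ s) (hs : s ≠ ∞) :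
    deltaConst s ^ s.toReal = (blockScale s ^ s.toReal)⁻¹ *
      (Real.sinh (blockScale s ^ s.toReal) - blockScale s ^ s.toReal) := by
  have hp : 0 < s.toReal := by linarith [one_le_toReal_of_fact h1 hs]
  have h0 := sinh_scale_sub_nonneg s
  unfold deltaConst blockScale at *
  split_ifs at * with h2
  · simp only [Real.one_rpow, inv_one, one_mul] at *
    rw [← Real.rpow_mul h0, one_div, inv_mul_cancel₀ hp.ne', Real.rpow_one]
  · have e : (1 / 2 : ℝ) ^ s.toReal = 2 ^ (-s.toReal) := by
      rw [one_div, Real.inv_rpow zero_le_two, Real.rpow_neg zero_le_two]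
    rw [e] at h0 ⊢
    rw [Real.mul_rpow zero_le_two (Real.rpow_nonneg h0 _), ← Real.rpow_mul h0, one_div,
      inv_mul_cancel₀ hp.ne', Real.rpow_one, Real.rpow_neg zero_le_two, inv_inv]

/-- Its `s`-th power is `sinh 1 - 1 < 0.2` for `s ≤ 2`, and at most `1/4` for `2 < s < ∞` because
`2^{-s} ≤ 1/4`. -/
theorem deltaConst_lt_one (h1 : 1 ≤ s) : deltaConst s < 1 := by
  rcases eq_or_ne s ∞ with rfl | hs
  · simp [deltaConst]; norm_num
  have hp : 0 < s.toReal := by linarith [one_le_toReal_of_fact h1 hs]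
  have h : deltaConst s ^ s.toReal < 1 := by
    rw [deltaConst_rpow h1 hs]
    by_cases h2 : s ≤ 2
    · simp only [blockScale, h2, if_true, Real.one_rpow, inv_one, one_mul]
      linarith [sinh_one_lt]
    · have hρ : 0 < blockScale s ^ s.toReal := Real.rpow_pos_of_pos (blockScale_pos s) _
      have := sinh_le_of_le_quarter hρ.le (blockScale_rpow_le (not_le.mp h2) hs)
      rw [inv_mul_lt_iff₀ hρ]
      linarith
  by_contra! hc
  linarith [Real.one_le_rpow hc hp.le]

/-- The constant in the bounds for a single block. -/
def blockConst (s : ℝ≥0∞) : ℝ := if s ≤ 2 then Real.sqrt (Real.exp 1) else 2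

theorem one_le_blockConst (s : ℝ≥0∞) : 1 ≤ blockConst s := by
  unfold blockConst
  split_ifs
  · exact Real.one_le_sqrt.mpr (Real.one_le_exp zero_le_one)
  · norm_num

theorem sinh_scale_le_blockConst (h1 : 1 ≤ s) (hs : s ≠ ∞) :
    (blockScale s ^ s.toReal)⁻¹ * Real.sinh (blockScale s ^ s.toReal) ≤ blockConst s ^ s.toReal := by
  have hp := one_le_toReal_of_fact h1 hs
  have hbc : blockConst s ≤ blockConst s ^ s.toReal := by
    conv_lhs => rw [← Real.rpow_one (blockConst s)]
    exact Real.rpow_le_rpow_of_exponent_le (one_le_blockConst s) hp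
  refine le_trans ?_ hbc
  by_cases h2 : s ≤ 2
  · simp only [blockScale, blockConst, h2, if_true, Real.one_rpow, inv_one, one_mul]
    refine Real.le_sqrt_of_sq_le ?_
    have := sinh_one_lt
    have h0 : 0 ≤ Real.sinh 1 := Real.sinh_nonneg_iff.mpr zero_le_one
    nlinarith [Real.exp_one_gt_d9]
  · have hρ : 0 < blockScale s ^ s.toReal := Real.rpow_pos_of_pos (blockScale_pos s) _
    have := sinh_le_of_le_quarter hρ.le (blockScale_rpow_le (not_le.mp h2) hs)
    rw [inv_mul_le_iff₀ hρ, blockConst, if_neg h2]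
    linarith

theorem blockCoeff_even (s : ℝ≥0∞) (x : ι → ℝ) {w : Finset ι} (hw : Even w.card) : blockCoeff s x w = 0 := by
  rw [blockCoeff_eq, blockSign_even s hw]; ring

variable [hs1 : Fact (1 ≤ s)]

theorem inUnitBall_sphNormalize (hs : s ≠ ∞) (x : lp (fun _ : ι => ℝ) s) :
    InUnitBall s.toReal (sphNormalize s x) := by
  have hp : 0 < s.toReal := by linarith [one_le_toReal_of_fact hs1.out hs]
  intro S
  have h := lp.sum_rpow_le_norm_rpow hp x S
  simp only [sphNormalize, lNorm_coe, abs_div, abs_norm]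
  -- For `x = 0` division by zero makes the normalized vector 0, which is in the ball.
  rcases eq_or_ne ‖x‖ 0 with h0 | h0
  · simp [h0, Real.zero_rpow hp.ne']
  · have h0' : 0 < ‖x‖ := lt_of_le_of_ne (norm_nonneg x) h0.symm
    simp only [Real.div_rpow (abs_nonneg _) h0'.le, ← Finset.sum_div]
    rw [div_le_one (Real.rpow_pos_of_pos h0' _)]
    simpa using h

theorem abs_sphNormalize_le_one (x : lp (fun _ : ι => ℝ) s) (a : ι) : |sphNormalize s x a| ≤ 1 := by
  simp only [sphNormalize, lNorm_coe, abs_div, abs_norm]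
  refine div_le_one_of_le₀ ?_ (norm_nonneg x)
  exact lp.norm_apply_le_norm (lt_of_lt_of_le zero_lt_one hs1.out).ne' x a

theorem abs_blockCoeff_le (x : lp (fun _ : ι => ℝ) s) (w : Finset ι) : |blockCoeff s x w| ≤ ‖x‖ := by
  rw [blockCoeff_eq, abs_mul, lNorm_coe, abs_norm, abs_mul, Finset.abs_prod]
  refine mul_le_of_le_one_right (norm_nonneg x) (mul_le_one₀ (abs_blockSign_le_one s _)
    (Finset.prod_nonneg fun a _ => abs_nonneg _)
    (Finset.prod_le_one (fun a _ => abs_nonneg _) fun a _ => abs_sphNormalize_le_one x a))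

theorem sum_rpow_blockCoeff_le (hs : s ≠ ∞) (x : lp (fun _ : ι => ℝ) s) (F : Finset (Finset ι)) :
    ∑ w ∈ F, ‖blockCoeff s x w‖ ^ s.toReal ≤ (blockConst s * ‖x‖) ^ s.toReal := by
  have hp : 0 < s.toReal := by linarith [one_le_toReal_of_fact hs1.out hs]
  have h : ∀ w, ‖blockCoeff s x w‖ ^ s.toReal = ‖x‖ ^ s.toReal *
      |blockSign s w.card * ∏ a ∈ w, sphNormalize s x a| ^ s.toReal := fun w => by
    rw [blockCoeff_eq, norm_mul, lNorm_coe, norm_norm,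
      Real.mul_rpow (norm_nonneg x) (norm_nonneg _), Real.norm_eq_abs]
  simp only [h, ← Finset.mul_sum]
  rw [mul_comm (blockConst s), Real.mul_rpow (norm_nonneg x) (by linarith [one_le_blockConst s])]
  exact mul_le_mul_of_nonneg_left ((sum_rpow_block_le hp s (inUnitBall_sphNormalize hs x) F).trans
    (sinh_scale_le_blockConst hs1.out hs)) (by positivity)

theorem memlp_blockCoeff (x : lp (fun _ : ι => ℝ) s) : Memℓp (blockCoeff s x) s := by
  rcases eq_or_ne s ∞ with rfl | hs
  · refine memℓp_infty ⟨‖x‖, ?_⟩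
    rintro _ ⟨w, rfl⟩
    exact abs_blockCoeff_le x w
  · exact memℓp_gen' (sum_rpow_blockCoeff_le hs x)

/-- The coefficients of `Q^{(s)}(x)` or `P^{(s)}(x)`, as an element of `l^s`. -/
def blockLp (x : lp (fun _ : ι => ℝ) s) : lp (fun _ : Finset ι => ℝ) s :=
  ⟨blockCoeff s x, memlp_blockCoeff x⟩

theorem norm_blockLp_le (x : lp (fun _ : ι => ℝ) s) : ‖blockLp x‖ ≤ blockConst s * ‖x‖ := by
  have hC := one_le_blockConst s
  rcases eq_or_ne s ∞ with rfl | hs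
  · refine lp.norm_le_of_forall_le (by positivity) fun w => ?_
    exact (abs_blockCoeff_le x w).trans (le_mul_of_one_le_left (norm_nonneg x) hC)
  · have hp : 0 < s.toReal := by linarith [one_le_toReal_of_fact hs1.out hs]
    exact lp.norm_le_of_forall_sum_le hp (by positivity) (sum_rpow_blockCoeff_le hs x)

theorem blockCoeff_singleton (x : lp (fun _ : ι => ℝ) s) (a : ι) : blockCoeff s x {a} = x a := by
  rw [blockCoeff_eq, lNorm_coe, Finset.card_singleton, blockSign_one, one_mul,
    Finset.prod_singleton, sphNormalize, lNorm_coe]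
  rcases eq_or_ne ‖x‖ 0 with h0 | h0
  · have : x = 0 := (lp.norm_eq_zero_iff).mp h0
    subst this
    simp
  · field_simp

theorem blockCoeff_zero (w : Finset ι) : blockCoeff s ((0 : lp (fun _ : ι => ℝ) s) : ι → ℝ) w = 0 := by
  rw [blockCoeff_eq, lNorm_coe, norm_zero, zero_mul]

/-- Only odd orders occur, and an odd power of the sign `c / |c|` is the sign itself; together with
`‖c x‖ = |c| ‖x‖` this gives the factor `c`. -/
theorem blockCoeff_smul (c : ℝ) (x : lp (fun _ : ι => ℝ) s) (w : Finset ι) :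
    blockCoeff s ((c • x : lp (fun _ : ι => ℝ) s) : ι → ℝ) w = c * blockCoeff s x w := by
  rcases Nat.even_or_odd w.card with hw | hw
  · rw [blockCoeff_even s _ hw, blockCoeff_even s _ hw, mul_zero]
  rcases eq_or_ne c 0 with rfl | hc
  · rw [zero_smul, blockCoeff_zero, zero_mul]
  have hn : lNorm s ((c • x : lp (fun _ : ι => ℝ) s) : ι → ℝ) = |c| * ‖x‖ := by
    rw [lNorm_coe, norm_smul, Real.norm_eq_abs]
  have h1 : ∀ a, sphNormalize s ((c • x : lp (fun _ : ι => ℝ) s) : ι → ℝ) a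
      = (c / |c|) * sphNormalize s x a := by
    intro a
    have : (c • x : lp (fun _ : ι => ℝ) s) a = c * x a := rfl
    rw [sphNormalize, hn, this, sphNormalize, lNorm_coe, mul_div_mul_comm]
  have h2 : (c / |c|) ^ w.card = c / |c| := by
    obtain ⟨j, hj⟩ := hw
    have : (c / |c|) ^ 2 = 1 := by
      rw [div_pow, sq_abs, div_self (pow_ne_zero 2 hc)]
    rw [hj, pow_succ, pow_mul, this, one_pow, one_mul]
  rw [blockCoeff_eq, blockCoeff_eq, hn, lNorm_coe]
  simp only [h1, Finset.prod_mul_distrib, Finset.prod_const, h2]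
  have h3 : |c| ≠ 0 := abs_ne_zero.mpr hc
  field_simp

end Block

/-! ### Lipschitz continuity of the block maps. -/

section BlockLipschitz

variable {ι : Type*} {s : ℝ≥0∞}

/-- Compare letter by letter under the majorant `m = max |z| |y|`. Since `∑ m^p ≤ 2`, the weights `τ
= 2^{p-1} m^p` have sum at most `2^p`, so the accompanying product is at most `exp (2^p)`. -/
theorem sum_rpow_block_sub_le {p : ℝ} (hp : 1 ≤ p) (s : ℝ≥0∞) {z y : ι → ℝ}
    (hz : InUnitBall p z) (hy : InUnitBall p y) {D : ℝ}
    (hD : ∀ S : Finset ι, ∑ a ∈ S, |z a - y a| ^ p ≤ D) (F : Finset (Finset ι)) :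
    ∑ w ∈ F, |blockSign s w.card * ∏ a ∈ w, z a - blockSign s w.card * ∏ a ∈ w, y a| ^ p
      ≤ D * Real.exp (2 ^ p) := by
  classical
  have hp0 : 0 < p := by linarith
  have hD0 : 0 ≤ D := by simpa using hD ∅
  set m : ι → ℝ := fun a => max |z a| |y a| with hm
  set τ : ι → ℝ := fun a => 2 ^ (p - 1) * m a ^ p with hτ
  have hm0 : ∀ a, 0 ≤ m a := fun a => (abs_nonneg _).trans (le_max_left _ _)
  have hτ0 : ∀ a, 0 ≤ τ a := fun a => mul_nonneg (by positivity) (Real.rpow_nonneg (hm0 a) _)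
  have hd0 : ∀ a, 0 ≤ |z a - y a| ^ p := fun a => by positivity
  have h1 : ∀ w : Finset ι,
      |blockSign s w.card * ∏ a ∈ w, z a - blockSign s w.card * ∏ a ∈ w, y a| ^ p
        ≤ ∑ c ∈ w, |z c - y c| ^ p * ∏ a ∈ w.erase c, τ a := by
    intro w
    rw [← mul_sub, abs_mul]
    refine le_trans ?_ (rpow_abs_prod_sub_prod_le hp (m := m) (fun a => le_max_left _ _)
      (fun a => le_max_right _ _) w)
    exact Real.rpow_le_rpow (by positivity)
      (mul_le_of_le_one_left (abs_nonneg _) (abs_blockSign_le_one s _)) hp0.le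
  set S : Finset ι := F.biUnion id
  have hFS : F ⊆ S.powerset := fun w hw =>
    Finset.mem_powerset.mpr (Finset.subset_biUnion_of_mem id hw)
  have hτS : ∑ a ∈ S, τ a ≤ 2 ^ p := by
    have hmp : ∀ a, m a ^ p ≤ |z a| ^ p + |y a| ^ p := by
      intro a
      have e1 : 0 ≤ |z a| ^ p := by positivity
      have e2 : 0 ≤ |y a| ^ p := by positivity
      rcases max_choice |z a| |y a| with h | h <;> simp only [hm, h] <;> linarith
    calc ∑ a ∈ S, τ a = 2 ^ (p - 1) * ∑ a ∈ S, m a ^ p := by rw [Finset.mul_sum]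
      _ ≤ 2 ^ (p - 1) * (∑ a ∈ S, |z a| ^ p + ∑ a ∈ S, |y a| ^ p) := by
          rw [← Finset.sum_add_distrib]
          exact mul_le_mul_of_nonneg_left (Finset.sum_le_sum fun a _ => hmp a) (by positivity)
      _ ≤ 2 ^ (p - 1) * 2 := by
          refine mul_le_mul_of_nonneg_left ?_ (by positivity)
          linarith [hz S, hy S]
      _ = 2 ^ p := by
          rw [Real.rpow_sub_one two_ne_zero]; field_simp
  calc ∑ w ∈ F, |blockSign s w.card * ∏ a ∈ w, z a - blockSign s w.card * ∏ a ∈ w, y a| ^ p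
      ≤ ∑ w ∈ F, ∑ c ∈ w, |z c - y c| ^ p * ∏ a ∈ w.erase c, τ a := Finset.sum_le_sum fun w _ => h1 w
    _ ≤ ∑ w ∈ S.powerset, ∑ c ∈ w, |z c - y c| ^ p * ∏ a ∈ w.erase c, τ a :=
        Finset.sum_le_sum_of_subset_of_nonneg hFS fun w _ _ => Finset.sum_nonneg fun c _ =>
          mul_nonneg (hd0 c) (Finset.prod_nonneg fun a _ => hτ0 a)
    _ ≤ (∑ a ∈ S, |z a - y a| ^ p) * ∏ a ∈ S, (1 + τ a) := sum_powerset_sum_erase_le hd0 hτ0 S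
    _ ≤ D * Real.exp (2 ^ p) := by
        refine mul_le_mul (hD S) ?_ (Finset.prod_nonneg fun a _ => by linarith [hτ0 a]) hD0
        rw [Finset.prod_one_add]
        have := subsetSum_one_le hτ0 S
        simp only [subsetSum, one_mul] at this
        exact this.trans (Real.exp_le_exp.mpr hτS)

theorem abs_block_sub_le (hs : 2 < s) {z y : ι → ℝ} (hz : ∀ a, |z a| ≤ 1) (hy : ∀ a, |y a| ≤ 1)
    {D : ℝ} (hD : ∀ a, |z a - y a| ≤ D) (hD0 : 0 ≤ D) (w : Finset ι) :
    |blockSign s w.card * ∏ a ∈ w, z a - blockSign s w.card * ∏ a ∈ w, y a| ≤ D := by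
  classical
  rw [← mul_sub, abs_mul]
  have h := abs_prod_sub_prod_le (m := fun _ => 1) hz hy w
  have h2 : ∑ c ∈ w, |z c - y c| * ∏ a ∈ w.erase c, (1 : ℝ) ≤ w.card * D := by
    simp only [Finset.prod_const_one, mul_one]
    rw [← nsmul_eq_mul]
    exact Finset.sum_le_card_nsmul _ _ _ fun a _ => hD a
  calc |blockSign s w.card| * |∏ a ∈ w, z a - ∏ a ∈ w, y a| ≤ |blockSign s w.card| * (w.card * D) :=
        mul_le_mul_of_nonneg_left (h.trans h2) (abs_nonneg _)
    _ = (|blockSign s w.card| * w.card) * D := by ring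
    _ ≤ D := mul_le_of_le_one_left hD0 (abs_blockSign_mul_le_one hs _)

theorem sphNormalize_eq_smul (x : lp (fun _ : ι => ℝ) s) (a : ι) :
    sphNormalize s x a = (‖x‖⁻¹ • x : lp (fun _ : ι => ℝ) s) a := by
  have : (‖x‖⁻¹ • x : lp (fun _ : ι => ℝ) s) a = ‖x‖⁻¹ * x a := rfl
  rw [this, sphNormalize, lNorm_coe]
  ring

variable [hs1 : Fact (1 ≤ s)]

theorem inv_smul_blockLp_apply {x : lp (fun _ : ι => ℝ) s} (hx : x ≠ 0) (w : Finset ι) :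
    (‖x‖⁻¹ • blockLp x : lp (fun _ : Finset ι => ℝ) s) w
      = blockSign s w.card * ∏ a ∈ w, sphNormalize s x a := by
  have : (‖x‖⁻¹ • blockLp x : lp (fun _ : Finset ι => ℝ) s) w = ‖x‖⁻¹ * blockCoeff s x w := rfl
  rw [this, blockCoeff_eq, lNorm_coe, inv_mul_cancel_left₀ (norm_ne_zero_iff.mpr hx)]

theorem exists_norm_normalized_blockLp_sub_le :
    ∃ C : ℝ, 0 ≤ C ∧ ∀ x y : lp (fun _ : ι => ℝ) s, x ≠ 0 → y ≠ 0 →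
      ‖‖x‖⁻¹ • blockLp x - ‖y‖⁻¹ • blockLp y‖ ≤ C * ‖‖x‖⁻¹ • x - ‖y‖⁻¹ • y‖ := by
  rcases eq_or_ne s ∞ with rfl | hs
  · refine ⟨1, zero_le_one, fun x y hx hy => ?_⟩
    rw [one_mul]
    refine lp.norm_le_of_forall_le (norm_nonneg _) fun w => ?_
    rw [lp.coeFn_sub, Pi.sub_apply, inv_smul_blockLp_apply hx, inv_smul_blockLp_apply hy]
    refine abs_block_sub_le (by simp) (abs_sphNormalize_le_one x) (abs_sphNormalize_le_one y)
      (fun a => ?_) (norm_nonneg _) w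
    rw [sphNormalize_eq_smul, sphNormalize_eq_smul]
    exact lp.norm_apply_le_norm (by simp) (‖x‖⁻¹ • x - ‖y‖⁻¹ • y) a
  · have hp := one_le_toReal_of_fact hs1.out hs
    have hp0 : 0 < s.toReal := by linarith
    refine ⟨Real.exp (2 ^ s.toReal) ^ (1 / s.toReal), by positivity, fun x y hx hy => ?_⟩
    refine lp.norm_le_of_forall_sum_le hp0 (by positivity) fun F => ?_
    have h := sum_rpow_block_sub_le hp s (inUnitBall_sphNormalize hs x)
      (inUnitBall_sphNormalize hs y) (D := ‖‖x‖⁻¹ • x - ‖y‖⁻¹ • y‖ ^ s.toReal) (fun S => ?_) F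
    · rw [Real.mul_rpow (by positivity) (norm_nonneg _), ← Real.rpow_mul (Real.exp_pos _).le,
        one_div, inv_mul_cancel₀ hp0.ne', Real.rpow_one, mul_comm]
      refine le_trans (le_of_eq ?_) h
      refine Finset.sum_congr rfl fun w _ => ?_
      rw [lp.coeFn_sub, Pi.sub_apply, inv_smul_blockLp_apply hx, inv_smul_blockLp_apply hy,
        Real.norm_eq_abs]
    · refine le_trans (le_of_eq ?_) (lp.sum_rpow_le_norm_rpow hp0 (‖x‖⁻¹ • x - ‖y‖⁻¹ • y) S)
      refine Finset.sum_congr rfl fun a _ => ?_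
      rw [sphNormalize_eq_smul, sphNormalize_eq_smul, lp.coeFn_sub, Pi.sub_apply, Real.norm_eq_abs]

theorem norm_normalize_sub_le {V : Type*} [NormedAddCommGroup V] [NormedSpace ℝ V] {x y : V}
    (hx : x ≠ 0) (hy : y ≠ 0) : ‖‖x‖⁻¹ • x - ‖y‖⁻¹ • y‖ ≤ 2 * ‖x - y‖ / ‖x‖ := by
  have hx' := norm_pos_iff.mpr hx
  have hy' := norm_pos_iff.mpr hy
  have e : ‖x‖⁻¹ • x - ‖y‖⁻¹ • y = ‖x‖⁻¹ • (x - y) + (‖x‖⁻¹ - ‖y‖⁻¹) • y := by module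
  rw [e]
  refine (norm_add_le _ _).trans ?_
  rw [norm_smul, norm_smul, norm_inv, norm_norm]
  have h1 : ‖‖x‖⁻¹ - ‖y‖⁻¹‖ * ‖y‖ = |‖y‖ - ‖x‖| / ‖x‖ := by
    rw [Real.norm_eq_abs, inv_sub_inv hx'.ne' hy'.ne', abs_div, abs_mul, abs_norm, abs_norm]
    field_simp
  rw [h1, div_eq_mul_inv, div_eq_mul_inv]
  have h2 : |‖y‖ - ‖x‖| ≤ ‖x - y‖ := by
    rw [norm_sub_rev]; exact abs_norm_sub_norm_le y x
  have h3 := mul_le_mul_of_nonneg_right h2 (inv_nonneg.mpr hx'.le)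
  linarith

theorem blockLp_zero : blockLp (0 : lp (fun _ : ι => ℝ) s) = 0 := by
  ext w
  exact blockCoeff_zero w

theorem blockLp_smul (c : ℝ) (x : lp (fun _ : ι => ℝ) s) : blockLp (c • x) = c • blockLp x := by
  ext w
  exact blockCoeff_smul c x w

/-- The block map is positively homogeneous and Lipschitz on the unit sphere. Write the difference
as a difference of normalized blocks scaled by `‖x‖`, plus a multiple of the block of `y` by `(‖x‖ -
‖y‖) / ‖y‖`; the factor `‖x‖` cancels the one lost in normalizing. -/
theorem exists_norm_blockLp_sub_le :
    ∃ C : ℝ, 0 ≤ C ∧ ∀ x y : lp (fun _ : ι => ℝ) s, ‖blockLp x - blockLp y‖ ≤ C * ‖x - y‖ := by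
  obtain ⟨C, hC0, hC⟩ := exists_norm_normalized_blockLp_sub_le (ι := ι) (s := s)
  have hb := one_le_blockConst s
  refine ⟨2 * C + blockConst s, by positivity, fun x y => ?_⟩
  have hle : blockConst s * ‖x - y‖ ≤ (2 * C + blockConst s) * ‖x - y‖ :=
    mul_le_mul_of_nonneg_right (by linarith) (norm_nonneg _)
  rcases eq_or_ne x 0 with rfl | hx
  · rw [blockLp_zero, zero_sub, norm_neg]
    refine (norm_blockLp_le y).trans (le_trans (le_of_eq ?_) hle)
    rw [zero_sub, norm_neg]
  rcases eq_or_ne y 0 with rfl | hy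
  · rw [blockLp_zero, sub_zero]
    refine (norm_blockLp_le x).trans (le_trans (le_of_eq ?_) hle)
    rw [sub_zero]
  have hx' := norm_pos_iff.mpr hx
  have hy' := norm_pos_iff.mpr hy
  have e : blockLp x - blockLp y = ‖x‖ • (‖x‖⁻¹ • blockLp x - ‖y‖⁻¹ • blockLp y)
      + ((‖x‖ - ‖y‖) * ‖y‖⁻¹) • blockLp y := by
    rw [smul_sub, smul_smul, smul_smul, mul_inv_cancel₀ hx'.ne', one_smul, sub_mul,
      mul_inv_cancel₀ hy'.ne', sub_smul, one_smul]
    abel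
  rw [e]
  refine (norm_add_le _ _).trans ?_
  rw [norm_smul, norm_smul, norm_norm, norm_mul, norm_inv, norm_norm, Real.norm_eq_abs]
  have h1 : ‖x‖ * ‖‖x‖⁻¹ • blockLp x - ‖y‖⁻¹ • blockLp y‖ ≤ 2 * C * ‖x - y‖ := by
    calc ‖x‖ * ‖‖x‖⁻¹ • blockLp x - ‖y‖⁻¹ • blockLp y‖
        ≤ ‖x‖ * (C * (2 * ‖x - y‖ / ‖x‖)) := by
          gcongr
          exact (hC x y hx hy).trans (mul_le_mul_of_nonneg_left (norm_normalize_sub_le hx hy) hC0)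
      _ = 2 * C * ‖x - y‖ := by field_simp
  have h2 : |‖x‖ - ‖y‖| * ‖y‖⁻¹ * ‖blockLp y‖ ≤ blockConst s * ‖x - y‖ := by
    calc |‖x‖ - ‖y‖| * ‖y‖⁻¹ * ‖blockLp y‖ ≤ ‖x - y‖ * ‖y‖⁻¹ * (blockConst s * ‖y‖) := by
          gcongr
          · exact abs_norm_sub_norm_le x y
          · exact norm_blockLp_le y
      _ = blockConst s * ‖x - y‖ := by field_simp
  linarith

end BlockLipschitz

/-! ### The vector cascade and its Walsh series. -/

section CascadeVectors

variable {A : Type*} {s : ℝ≥0∞} [hs1 : Fact (1 ≤ s)]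

/-- Restriction of a Walsh series to the next set of the cascade. -/
def restrLp {n : ℕ} (f : lp (fun _ : Finset (cascade A n) => ℝ) s) :
    lp (fun _ : cascade A (n + 1) => ℝ) s :=
  ⟨fun w => f w.1, (memlp_and_norm_le_of_injective hs1.out f Subtype.val_injective
    fun _ => le_rfl).1⟩

theorem norm_restrLp_le {n : ℕ} (f : lp (fun _ : Finset (cascade A n) => ℝ) s) :
    ‖restrLp f‖ ≤ ‖f‖ :=
  lp_norm_le_of_injective hs1.out f _ Subtype.val_injective fun _ => le_rfl

/-- The next set of the cascade omits the Rademacher characters, so one step shrinks the norm by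
`δ_s`. No such bound is needed at `s = ∞`, where the cascade is stopped. -/
theorem norm_restrLp_blockLp_le (hs : s ≠ ∞) {n : ℕ} (x : lp (fun _ : cascade A n => ℝ) s) :
    ‖restrLp (blockLp x)‖ ≤ deltaConst s * ‖x‖ := by
  have hp : 0 < s.toReal := by linarith [one_le_toReal_of_fact hs1.out hs]
  have hδ := deltaConst_nonneg s
  refine lp.norm_le_of_forall_sum_le hp (by positivity) fun F => ?_
  have h : ∀ w : Finset (cascade A n), ‖blockCoeff s x w‖ ^ s.toReal = ‖x‖ ^ s.toReal *
      |blockSign s w.card * ∏ a ∈ w, sphNormalize s x a| ^ s.toReal := fun w => by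
    rw [blockCoeff_eq, norm_mul, lNorm_coe, norm_norm,
      Real.mul_rpow (norm_nonneg x) (norm_nonneg _), Real.norm_eq_abs]
  have h2 := sum_rpow_block_ne_one_le hp s (inUnitBall_sphNormalize hs x)
    (F.map (⟨fun w => w.1, Subtype.val_injective⟩ : cascade A (n + 1) ↪ Finset (cascade A n)))
    (fun w hw => by
      obtain ⟨v, -, rfl⟩ := Finset.mem_map.mp hw
      exact v.2.2)
  rw [Finset.sum_map, ← deltaConst_rpow hs1.out hs] at h2
  rw [Real.mul_rpow hδ (norm_nonneg x), mul_comm]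
  refine le_trans (le_of_eq ?_) (mul_le_mul_of_nonneg_left h2 (by positivity))
  rw [Finset.mul_sum]
  exact Finset.sum_congr rfl fun w _ => h w.1

/-- The vector cascade in `l^s`, continued by `0` if `s = ∞`. -/
def cVec (x : lp (fun _ : A => ℝ) s) : (n : ℕ) → lp (fun _ : cascade A n => ℝ) s
  | 0 => x
  | n + 1 => open Classical in if s = ∞ then 0 else restrLp (blockLp (cVec x n))

theorem cVec_succ (hs : s ≠ ∞) (x : lp (fun _ : A => ℝ) s) (n : ℕ) :
    cVec x (n + 1) = restrLp (blockLp (cVec x n)) := by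
  rw [cVec, if_neg hs]

theorem cVec_succ_top (hs : s = ∞) (x : lp (fun _ : A => ℝ) s) (n : ℕ) :
    cVec x (n + 1) = 0 := by
  rw [cVec, if_pos hs]

theorem cVec_eq_vecCascade (hs : s ≠ ∞) (x : lp (fun _ : A => ℝ) s) (n : ℕ) :
    (cVec x n : cascade A n → ℝ) = vecCascade s x n := by
  induction n with
  | zero => rfl
  | succ n ih =>
    rw [cVec_succ hs]
    funext w
    change blockCoeff s (cVec x n) w.1 = blockCoeff s (vecCascade s x n) w.1
    rw [ih]

theorem norm_cVec_le (x : lp (fun _ : A => ℝ) s) (n : ℕ) :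
    ‖cVec x n‖ ≤ deltaConst s ^ n * ‖x‖ := by
  have hδ := deltaConst_nonneg s
  induction n with
  | zero => rw [pow_zero, one_mul]; exact le_rfl
  | succ n ih =>
    by_cases hs : s = ∞
    · rw [cVec_succ_top hs, norm_zero]; positivity
    · rw [cVec_succ hs, pow_succ', mul_assoc]
      exact (norm_restrLp_blockLp_le hs _).trans (mul_le_mul_of_nonneg_left ih hδ)

theorem cVec_smul (c : ℝ) (x : lp (fun _ : A => ℝ) s) (n : ℕ) :
    cVec (c • x) n = c • cVec x n := by
  induction n with
  | zero => rfl
  | succ n ih =>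
    by_cases hs : s = ∞
    · rw [cVec_succ_top hs, cVec_succ_top hs, smul_zero]
    · rw [cVec_succ hs, cVec_succ hs, ih, blockLp_smul]
      rfl

theorem exists_norm_cVec_sub_le (n : ℕ) :
    ∃ C : ℝ, 0 ≤ C ∧ ∀ x y : lp (fun _ : A => ℝ) s, ‖cVec x n - cVec y n‖ ≤ C * ‖x - y‖ := by
  induction n with
  | zero => exact ⟨1, zero_le_one, fun x y => by rw [one_mul]; exact le_rfl⟩
  | succ n ih =>
    by_cases hs : s = ∞
    · exact ⟨0, le_rfl, fun x y => by rw [cVec_succ_top hs, cVec_succ_top hs, sub_zero]; simp⟩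
    · obtain ⟨C, hC0, hC⟩ := ih
      obtain ⟨K, hK0, hK⟩ := exists_norm_blockLp_sub_le (ι := cascade A n) (s := s)
      refine ⟨K * C, by positivity, fun x y => ?_⟩
      rw [cVec_succ hs, cVec_succ hs]
      calc ‖restrLp (blockLp (cVec x n)) - restrLp (blockLp (cVec y n))‖
          = ‖restrLp (blockLp (cVec x n) - blockLp (cVec y n))‖ := rfl
        _ ≤ K * ‖cVec x n - cVec y n‖ := (norm_restrLp_le _).trans (hK _ _)
        _ ≤ K * C * ‖x - y‖ := by
            rw [mul_assoc]; exact mul_le_mul_of_nonneg_left (hC x y) hK0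

/-- The characters on `Cube A_n`, as characters on `Cube A'`. -/
def wordMap (n : ℕ) (v : Finset (cascade A n)) : Finset (CascadeUnion A) :=
  v.map ⟨fun b => (⟨n, b⟩ : CascadeUnion A), sigma_mk_injective⟩

theorem wordMap_injective (n : ℕ) : Function.Injective (wordMap (A := A) n) :=
  Finset.map_injective _

theorem mem_wordMap {n : ℕ} {v : Finset (cascade A n)} {b : CascadeUnion A} :
    b ∈ wordMap n v ↔ ∃ c ∈ v, (⟨n, c⟩ : CascadeUnion A) = b :=
  Finset.mem_map

theorem liftCoeff_wordMap (n : ℕ) (c : Finset (cascade A n) → ℝ) (v : Finset (cascade A n)) :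
    liftCoeff n c (wordMap n v) = c v := by
  rw [liftCoeff, if_pos]
  · congr 1
    ext b
    refine Finset.mem_preimage.trans (mem_wordMap.trans ?_)
    constructor
    · rintro ⟨d, hd, h⟩
      exact sigma_mk_injective h ▸ hd
    · exact fun hb => ⟨b, hb, rfl⟩
  · intro b hb
    obtain ⟨d, -, rfl⟩ := mem_wordMap.mp hb
    rfl

theorem mem_range_wordMap {n : ℕ} {w : Finset (CascadeUnion A)} (h : ∀ b ∈ w, b.1 = n) :
    w ∈ Set.range (wordMap (A := A) n) := by
  refine ⟨w.preimage (Sigma.mk n) sigma_mk_injective.injOn, ?_⟩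
  ext ⟨m, b⟩
  refine mem_wordMap.trans ?_
  constructor
  · rintro ⟨d, hd, h'⟩
    rw [← h']
    exact Finset.mem_preimage.mp hd
  · intro hb
    obtain rfl : m = n := h _ hb
    exact ⟨b, Finset.mem_preimage.mpr hb, rfl⟩

theorem liftCoeff_of_notMem_range {n : ℕ} (c : Finset (cascade A n) → ℝ)
    {w : Finset (CascadeUnion A)} (hw : w ∉ Set.range (wordMap (A := A) n)) :
    liftCoeff n c w = 0 := by
  rw [liftCoeff, if_neg]
  exact fun h => hw (mem_range_wordMap h)

/-- The empty word comes from every level, so it is excluded here; the blocks vanish on it anyway.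
-/
theorem liftCoeff_wordMap_of_ne {m n : ℕ} (hmn : m ≠ n) (c : Finset (cascade A m) → ℝ)
    {v : Finset (cascade A n)} (hv : v ≠ ∅) : liftCoeff m c (wordMap n v) = 0 := by
  rw [liftCoeff, if_neg]
  intro h
  obtain ⟨b, hb⟩ := Finset.nonempty_iff_ne_empty.mpr hv
  exact hmn (h ⟨n, b⟩ (mem_wordMap.mpr ⟨b, hb, rfl⟩)).symm

theorem memlp_and_norm_lift_le (n : ℕ) (f : lp (fun _ : Finset (cascade A n) => ℝ) s) :
    ∃ hg : Memℓp (fun w => (liftCoeff n f w : ℂ)) s,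
      ‖(⟨_, hg⟩ : lp (fun _ : Finset (CascadeUnion A) => ℂ) s)‖ ≤ ‖f‖ := by
  refine memlp_and_norm_le_of_dominated hs1.out f (wordMap_injective n) (fun w hw => ?_) fun v => ?_
  · rw [liftCoeff_of_notMem_range _ hw, Complex.ofReal_zero]
  · rw [liftCoeff_wordMap, Complex.norm_real]

/-- A Walsh series on `Cube A_n` as a Walsh series on `Cube A'`. -/
def liftLp (n : ℕ) (f : lp (fun _ : Finset (cascade A n) => ℝ) s) :
    lp (fun _ : Finset (CascadeUnion A) => ℂ) s :=
  ⟨fun w => (liftCoeff n f w : ℂ), (memlp_and_norm_lift_le n f).1⟩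

theorem liftLp_apply (n : ℕ) (f : lp (fun _ : Finset (cascade A n) => ℝ) s)
    (w : Finset (CascadeUnion A)) : liftLp n f w = (liftCoeff n f w : ℂ) := rfl

theorem norm_liftLp_le (n : ℕ) (f : lp (fun _ : Finset (cascade A n) => ℝ) s) :
    ‖liftLp n f‖ ≤ ‖f‖ := (memlp_and_norm_lift_le n f).2

theorem liftLp_sub (n : ℕ) (f g : lp (fun _ : Finset (cascade A n) => ℝ) s) :
    liftLp n f - liftLp n g = liftLp n (f - g) := by
  ext w
  rw [lp.coeFn_sub, Pi.sub_apply, liftLp_apply, liftLp_apply, liftLp_apply, ← Complex.ofReal_sub]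
  congr 1
  unfold liftCoeff
  split_ifs
  · rfl
  · simp

/-- The `n`-th term of the series defining `Φ^{(s)}`. -/
def phiTerm (x : lp (fun _ : A => ℝ) s) (n : ℕ) : lp (fun _ : Finset (CascadeUnion A) => ℂ) s :=
  Complex.I ^ n • liftLp n (blockLp (cVec x n))

theorem norm_phiTerm_le (x : lp (fun _ : A => ℝ) s) (n : ℕ) :
    ‖phiTerm x n‖ ≤ blockConst s * ‖x‖ * deltaConst s ^ n := by
  have hb := one_le_blockConst s
  rw [phiTerm, norm_smul, norm_pow, Complex.norm_I, one_pow, one_mul]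
  calc ‖liftLp n (blockLp (cVec x n))‖ ≤ blockConst s * ‖cVec x n‖ :=
        (norm_liftLp_le _ _).trans (norm_blockLp_le _)
    _ ≤ blockConst s * (deltaConst s ^ n * ‖x‖) :=
        mul_le_mul_of_nonneg_left (norm_cVec_le x n) (by linarith)
    _ = _ := by ring

theorem hasSum_geometric_deltaConst (c : ℝ) (s : ℝ≥0∞) (h1 : 1 ≤ s) :
    HasSum (fun n : ℕ => c * deltaConst s ^ n) (c / (1 - deltaConst s)) :=
  (hasSum_geometric_of_lt_one (deltaConst_nonneg s) (deltaConst_lt_one h1)).mul_left c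

theorem summable_phiTerm (x : lp (fun _ : A => ℝ) s) : Summable (phiTerm x) :=
  .of_norm_bounded (hasSum_geometric_deltaConst _ s hs1.out).summable (norm_phiTerm_le x)

/-- The Walsh transform of `Φ^{(s)}(x)` for real `x` and `s ≠ 1`. -/
def phiRealLp (x : lp (fun _ : A => ℝ) s) : lp (fun _ : Finset (CascadeUnion A) => ℂ) s :=
  ∑' n, phiTerm x n

theorem norm_phiRealLp_le (x : lp (fun _ : A => ℝ) s) :
    ‖phiRealLp x‖ ≤ blockConst s * ‖x‖ / (1 - deltaConst s) :=
  tsum_of_norm_bounded (hasSum_geometric_deltaConst _ s hs1.out) (norm_phiTerm_le x)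

theorem continuous_phiTerm (n : ℕ) :
    Continuous fun x : lp (fun _ : A => ℝ) s => phiTerm x n := by
  obtain ⟨C, hC0, hC⟩ := exists_norm_cVec_sub_le (A := A) (s := s) n
  obtain ⟨K, hK0, hK⟩ := exists_norm_blockLp_sub_le (ι := cascade A n) (s := s)
  suffices h : Continuous fun x : lp (fun _ : A => ℝ) s => liftLp n (blockLp (cVec x n)) from
    (continuous_const_smul (Complex.I ^ n)).comp h
  refine (LipschitzWith.of_dist_le_mul (K := ⟨K * C, by positivity⟩) fun x y => ?_).continuous
  rw [dist_eq_norm, dist_eq_norm, liftLp_sub]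
  calc ‖liftLp n (blockLp (cVec x n) - blockLp (cVec y n))‖
      ≤ K * ‖cVec x n - cVec y n‖ := (norm_liftLp_le _ _).trans (hK _ _)
    _ ≤ K * C * ‖x - y‖ := by
        rw [mul_assoc]; exact mul_le_mul_of_nonneg_left (hC x y) hK0

/-- Every term is Lipschitz, with a constant depending on the level, and on each ball the series has
a geometric majorant, so the Weierstrass test applies. -/
theorem continuous_phiRealLp :
    Continuous (phiRealLp : lp (fun _ : A => ℝ) s → lp (fun _ : Finset (CascadeUnion A) => ℂ) s) := by
  have hb := one_le_blockConst s
  have hδ := deltaConst_nonneg s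
  rw [continuous_iff_continuousAt]
  intro x
  have hball : Metric.ball (0 : lp (fun _ : A => ℝ) s) (‖x‖ + 1) ∈ 𝓝 x :=
    Metric.isOpen_ball.mem_nhds (by simp)
  refine ContinuousOn.continuousAt (s := Metric.ball 0 (‖x‖ + 1)) ?_ hball
  refine continuousOn_tsum (u := fun n => blockConst s * (‖x‖ + 1) * deltaConst s ^ n)
    (fun n => (continuous_phiTerm n).continuousOn)
    (hasSum_geometric_deltaConst _ s hs1.out).summable fun n y hy => ?_
  refine (norm_phiTerm_le y n).trans ?_
  have : ‖y‖ ≤ ‖x‖ + 1 := by simpa using (mem_ball_zero_iff.mp hy).le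
  gcongr

theorem hasSum_phiRealLp_apply (x : lp (fun _ : A => ℝ) s) (w : Finset (CascadeUnion A)) :
    HasSum (fun n => Complex.I ^ n * (liftCoeff n (blockCoeff s (cVec x n)) w : ℂ))
      (phiRealLp x w) :=
  (summable_phiTerm x).hasSum.mapL (lp.evalCLM ℂ (fun _ : Finset (CascadeUnion A) => ℂ) s w)

theorem phiRealLp_apply (hs : s ≠ 1) (x : lp (fun _ : A => ℝ) s) (w : Finset (CascadeUnion A)) :
    phiRealLp x w = phiReal s x w := by
  rw [← (hasSum_phiRealLp_apply x w).tsum_eq, phiReal, if_neg hs]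
  split_ifs with h
  · subst h
    -- At `s = ∞` the vectors `cVec` vanish from level 1 on, so only the first block is left.
    rw [tsum_eq_single 0]
    · have : blockCoeff ∞ (cVec x 0) = pCoeff ∞ 1 (x : A → ℝ) := by
        funext w
        have : ¬ (∞ : ℝ≥0∞) ≤ 2 := by simp
        rw [blockCoeff, if_neg this]
        rfl
      rw [this]
      simp only [pow_zero, one_mul]
      rfl
    · intro n hn
      obtain ⟨m, rfl⟩ := Nat.exists_eq_succ_of_ne_zero hn
      have : blockCoeff ∞ (cVec x (m + 1)) = 0 := by
        rw [cVec_succ_top rfl]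
        funext w
        exact blockCoeff_zero w
      rw [this]
      simp [liftCoeff]
  · refine tsum_congr fun n => ?_
    rw [cVec_eq_vecCascade h]

theorem phiRealLp_wordMap (x : lp (fun _ : A => ℝ) s) (n : ℕ) (v : Finset (cascade A n)) :
    v ≠ ∅ → phiRealLp x (wordMap n v) = Complex.I ^ n * (blockCoeff s (cVec x n) v : ℂ) := by
  intro hv
  rw [← (hasSum_phiRealLp_apply x _).tsum_eq, tsum_eq_single n]
  · rw [liftCoeff_wordMap]
  · intro m hm
    rw [liftCoeff_wordMap_of_ne hm _ hv, Complex.ofReal_zero, mul_zero]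

theorem phiRealLp_incl (x : lp (fun _ : A => ℝ) s) (a : A) : phiRealLp x {incl a} = x a := by
  let b : cascade A 0 := a
  have h := phiRealLp_wordMap x 0 {b} (Finset.singleton_ne_empty b)
  rw [pow_zero, one_mul, blockCoeff_singleton] at h
  exact h

end CascadeVectors

/-! ### The pairing of conjugate sequence spaces. -/

section Pairing

variable {ι : Type*} {s t : ℝ≥0∞}

theorem summable_norm_mul_lp {E : Type*} [NormedRing E] (hst : s.toReal.HolderConjugate t.toReal)
    (f : lp (fun _ : ι => E) s) (g : lp (fun _ : ι => E) t) : Summable fun i => ‖f i * g i‖ :=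
  (lp.summable_mul hst f g).of_nonneg_of_le (fun _ => norm_nonneg _) fun _ => norm_mul_le _ _

theorem norm_tsum_mul_lp_le {E : Type*} [NormedRing E] (hst : s.toReal.HolderConjugate t.toReal)
    (f : lp (fun _ : ι => E) s) (g : lp (fun _ : ι => E) t) : ‖∑' i, f i * g i‖ ≤ ‖f‖ * ‖g‖ := by
  have h := lp.tsum_mul_le_mul_norm hst f g
  refine (norm_tsum_le_tsum_norm (summable_norm_mul_lp hst f g)).trans (le_trans ?_ h.2)
  exact (summable_norm_mul_lp hst f g).tsum_le_tsum (fun _ => norm_mul_le _ _) h.1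

/-- The pairing of `l^s` with an element of `l^t`, for conjugate exponents. -/
def lpPairing [Fact (1 ≤ s)] (hst : s.toReal.HolderConjugate t.toReal)
    (g : lp (fun _ : ι => ℂ) t) : lp (fun _ : ι => ℂ) s →L[ℂ] ℂ :=
  LinearMap.mkContinuous
    { toFun := fun f => ∑' i, f i * g i
      map_add' := fun f₁ f₂ => by
        rw [← ((summable_norm_mul_lp hst f₁ g).of_norm).tsum_add
          ((summable_norm_mul_lp hst f₂ g).of_norm)]
        exact tsum_congr fun i => by rw [lp.coeFn_add, Pi.add_apply, add_mul]
      map_smul' := fun c f => by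
        rw [RingHom.id_apply, smul_eq_mul, ← tsum_mul_left]
        exact tsum_congr fun i => by rw [lp.coeFn_smul, Pi.smul_apply, smul_eq_mul, mul_assoc] }
    ‖g‖ fun f => by
      rw [mul_comm]
      exact norm_tsum_mul_lp_le hst f g

theorem lpPairing_apply [Fact (1 ≤ s)] (hst : s.toReal.HolderConjugate t.toReal)
    (g : lp (fun _ : ι => ℂ) t) (f : lp (fun _ : ι => ℂ) s) :
    lpPairing hst g f = ∑' i, f i * g i := rfl

end Pairing

/-! ### The telescoping Parseval formula for real vectors. -/

section Parseval

variable {A : Type*} {s t : ℝ≥0∞}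

theorem ne_top_of_holderConjugate (hst : s.toReal.HolderConjugate t.toReal) : s ≠ ∞ := by
  rintro rfl
  have := hst.lt
  simp at this
  linarith

theorem ne_one_of_holderConjugate (hst : s.toReal.HolderConjugate t.toReal) : s ≠ 1 := by
  rintro rfl
  have := hst.lt
  simp at this

theorem hasSum_singletons_add_rest {ι : Type*} {f : Finset ι → ℝ} {a b : ℝ}
    (hf : ∀ w : Finset ι, Even w.card → f w = 0) (ha : HasSum (fun i => f {i}) a)
    (hb : HasSum (fun w : {w : Finset ι // Odd w.card ∧ w.card ≠ 1} => f w.1) b) :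
    HasSum f (a + b) := by
  classical
  have h1 : HasSum (fun w : Finset ι => if w.card = 1 then f w else 0) a := by
    refine ((Finset.singleton_injective (α := ι)).hasSum_iff fun w hw => ?_).mp ?_
    · refine if_neg fun h => hw ?_
      obtain ⟨i, rfl⟩ := Finset.card_eq_one.mp h
      exact ⟨i, rfl⟩
    · simpa [Function.comp_def] using ha
  have h2 : HasSum (fun w : Finset ι => if w.card = 1 then 0 else f w) b := by
    refine ((Subtype.val_injective (p := fun w : Finset ι => Odd w.card ∧ w.card ≠ 1)).hasSum_iff
      fun w hw => ?_).mp ?_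
    · split_ifs with h
      · rfl
      · rcases Nat.even_or_odd w.card with he | ho
        · exact hf w he
        · exact absurd ⟨⟨w, ho, h⟩, rfl⟩ hw
    · convert hb using 2 with w
      exact if_neg w.2.2
  convert h1.add h2 using 2 with w
  split_ifs <;> simp

variable [hs1 : Fact (1 ≤ s)] [ht1 : Fact (1 ≤ t)]

theorem cVec_succ_apply (hs : s ≠ ∞) (x : lp (fun _ : A => ℝ) s) (n : ℕ)
    (w : {w : Finset (cascade A n) // Odd w.card ∧ w.card ≠ 1}) :
    cVec x (n + 1) w = blockCoeff s (cVec x n) w.1 := by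
  rw [cVec_succ hs]
  rfl

/-- The pairing of the `n`-th vectors of the cascades. -/
def cascadePairing (x : lp (fun _ : A => ℝ) s) (y : lp (fun _ : A => ℝ) t) (n : ℕ) : ℝ :=
  ∑' b, cVec x n b * cVec y n b

/-- The Rademacher coefficients of the blocks are the current vectors, the other odd ones are the
next vectors, and even orders vanish. -/
theorem hasSum_blockCoeff_mul (hst : s.toReal.HolderConjugate t.toReal)
    (x : lp (fun _ : A => ℝ) s) (y : lp (fun _ : A => ℝ) t) (n : ℕ) :
    HasSum (fun v => blockCoeff s (cVec x n) v * blockCoeff t (cVec y n) v)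
      (cascadePairing x y n + cascadePairing x y (n + 1)) := by
  have hs := ne_top_of_holderConjugate hst
  have ht := ne_top_of_holderConjugate hst.symm
  refine hasSum_singletons_add_rest (fun w hw => ?_) ?_ ?_
  · rw [blockCoeff_even s _ hw, zero_mul]
  · simp only [blockCoeff_singleton]
    exact (summable_norm_mul_lp hst (cVec x n) (cVec y n)).of_norm.hasSum
  · have h := (summable_norm_mul_lp hst (cVec x (n + 1)) (cVec y (n + 1))).of_norm.hasSum
    simp only [← cVec_succ_apply hs, ← cVec_succ_apply ht]
    exact h

theorem tendsto_cascadePairing (hst : s.toReal.HolderConjugate t.toReal)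
    (x : lp (fun _ : A => ℝ) s) (y : lp (fun _ : A => ℝ) t) :
    Tendsto (cascadePairing x y) atTop (𝓝 0) := by
  have h1 : Tendsto (fun n => deltaConst s ^ n * ‖x‖) atTop (𝓝 (0 * ‖x‖)) :=
    (tendsto_pow_atTop_nhds_zero_of_lt_one (deltaConst_nonneg s)
      (deltaConst_lt_one hs1.out)).mul_const _
  have h2 : Tendsto (fun n => deltaConst t ^ n * ‖y‖) atTop (𝓝 (0 * ‖y‖)) :=
    (tendsto_pow_atTop_nhds_zero_of_lt_one (deltaConst_nonneg t)
      (deltaConst_lt_one ht1.out)).mul_const _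
  have h3 := h1.mul h2
  rw [zero_mul, zero_mul] at h3
  refine squeeze_zero_norm (fun n => ?_) h3
  exact (norm_tsum_mul_lp_le hst _ _).trans (mul_le_mul (norm_cVec_le x n) (norm_cVec_le y n)
    (norm_nonneg _) (mul_nonneg (pow_nonneg (deltaConst_nonneg s) n) (norm_nonneg x)))

theorem sum_range_alternating (T : ℕ → ℝ) (N : ℕ) :
    ∑ n ∈ Finset.range N, (-1) ^ n * (T n + T (n + 1)) = T 0 - (-1) ^ N * T N := by
  induction N with
  | zero => simp
  | succ N ih => rw [Finset.sum_range_succ, ih, pow_succ]; ring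

theorem phiRealLp_eq_zero (x : lp (fun _ : A => ℝ) s) {w : Finset (CascadeUnion A)}
    (hw : ∀ n v, v ≠ ∅ → wordMap (A := A) n v ≠ w) : phiRealLp x w = 0 := by
  rw [← (hasSum_phiRealLp_apply x w).tsum_eq]
  refine (tsum_congr fun n => ?_).trans tsum_zero
  by_cases h : w ∈ Set.range (wordMap (A := A) n)
  · obtain ⟨v, rfl⟩ := h
    have hv : v = ∅ := by_contra fun hv => hw n v hv rfl
    rw [liftCoeff_wordMap, hv, blockCoeff_even s _ (by simp), Complex.ofReal_zero, mul_zero]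
  · rw [liftCoeff_of_notMem_range _ h, Complex.ofReal_zero, mul_zero]

theorem wordMap_sigma_injective : Function.Injective
    fun p : Σ n : ℕ, {v : Finset (cascade A n) // v ≠ ∅} => wordMap p.1 p.2.1 := by
  rintro ⟨n, v, hv⟩ ⟨m, u, hu⟩ h
  obtain ⟨b, hb⟩ := Finset.nonempty_iff_ne_empty.mpr hv
  have h' : (⟨n, b⟩ : CascadeUnion A) ∈ wordMap m u := by
    have h0 : (⟨n, b⟩ : CascadeUnion A) ∈ wordMap n v := mem_wordMap.mpr ⟨b, hb, rfl⟩
    have h1 : wordMap n v = wordMap m u := h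
    rwa [h1] at h0
  obtain ⟨c, -, hc⟩ := mem_wordMap.mp h'
  obtain rfl : m = n := congrArg Sigma.fst hc
  obtain rfl : v = u := wordMap_injective _ h
  rfl

/-- Group the nonempty words by level. Level `n` contributes `i^n i^n = (-1)^n` times the sum of two
consecutive cascade pairings; the alternating sum telescopes, with a last term tending to 0. -/
theorem tsum_phiRealLp_mul_phiRealLp (hst : s.toReal.HolderConjugate t.toReal)
    (x : lp (fun _ : A => ℝ) s) (y : lp (fun _ : A => ℝ) t) :
    ∑' w, phiRealLp x w * phiRealLp y w = ((∑' a, x a * y a : ℝ) : ℂ) := by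
  have hsum := (summable_norm_mul_lp hst (phiRealLp x) (phiRealLp y)).of_norm.hasSum
  have h1 := (wordMap_sigma_injective.hasSum_iff (fun w hw => by
    rw [phiRealLp_eq_zero x fun n v hv h => hw ⟨⟨n, v, hv⟩, h⟩, zero_mul])).mpr hsum
  have h2 : ∀ n : ℕ, HasSum (fun v : {v : Finset (cascade A n) // v ≠ ∅} =>
      phiRealLp x (wordMap n v.1) * phiRealLp y (wordMap n v.1))
      (((-1) ^ n * (cascadePairing x y n + cascadePairing x y (n + 1)) : ℝ) : ℂ) := by
    intro n
    have h := (hasSum_blockCoeff_mul hst x y n).mul_left ((-1) ^ n)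
    rw [← (Subtype.val_injective (p := fun v : Finset (cascade A n) => v ≠ ∅)).hasSum_iff] at h
    · convert Complex.hasSum_ofReal.mpr h using 2 with v
      rw [phiRealLp_wordMap _ _ _ v.2, phiRealLp_wordMap _ _ _ v.2]
      simp only [Function.comp_apply]
      push_cast
      rw [← Complex.I_mul_I, mul_pow]
      ring
    · intro v hv
      have hv : v = ∅ := by_contra fun h' => hv ⟨⟨v, h'⟩, rfl⟩
      rw [hv, blockCoeff_even s _ (by simp), zero_mul, mul_zero]
  have h3 := (h1.sigma h2).tendsto_sum_nat
  refine tendsto_nhds_unique h3 ?_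
  simp only [← Complex.ofReal_sum, sum_range_alternating]
  refine (Complex.continuous_ofReal.tendsto _).comp ?_
  have h4 : Tendsto (fun N => (-1) ^ N * cascadePairing x y N) atTop (𝓝 0) := by
    have h := (tendsto_cascadePairing hst x y).norm
    rw [norm_zero] at h
    refine squeeze_zero_norm (fun N => ?_) h
    rw [norm_mul, norm_pow, norm_neg, norm_one, one_pow, one_mul]
  have h5 := (tendsto_const_nhds (x := cascadePairing x y 0)).sub h4
  rw [sub_zero] at h5
  exact h5

end Parseval

/-! ### Functionals evaluated on infinite Riesz products. -/

section RieszFunctional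

variable {ι : Type*} {s t : ℝ≥0∞}

theorem norm_rieszCoeff_I_mul (z : ι → ℝ) (w : Finset ι) :
    ‖rieszCoeff (fun a => Complex.I * (z a : ℂ)) w‖ = ∏ a ∈ w, |z a| := by
  rw [rieszCoeff, norm_prod]
  exact Finset.prod_congr rfl fun a _ => by
    rw [norm_mul, Complex.norm_I, one_mul, Complex.norm_real, Real.norm_eq_abs]

theorem memlp_rieszCoeff_I_mul {z : ι → ℝ}
    (hz : InUnitBall s.toReal z) : Memℓp (rieszCoeff fun a => Complex.I * (z a : ℂ)) s := by
  classical
  have h0 : ∀ a, 0 ≤ |z a| ^ s.toReal := fun a => by positivity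
  refine memℓp_gen' (C := Real.exp 1) fun F => ?_
  set S : Finset ι := F.biUnion id
  have hFS : F ⊆ S.powerset := fun w hw =>
    Finset.mem_powerset.mpr (Finset.subset_biUnion_of_mem id hw)
  calc ∑ w ∈ F, ‖rieszCoeff (fun a => Complex.I * (z a : ℂ)) w‖ ^ s.toReal
      = ∑ w ∈ F, ∏ a ∈ w, |z a| ^ s.toReal := by
        refine Finset.sum_congr rfl fun w _ => ?_
        rw [norm_rieszCoeff_I_mul, Real.finsetProd_rpow _ _ fun a _ => abs_nonneg _]
    _ ≤ ∑ w ∈ S.powerset, ∏ a ∈ w, |z a| ^ s.toReal :=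
        Finset.sum_le_sum_of_subset_of_nonneg hFS fun w _ _ => Finset.prod_nonneg fun a _ => h0 a
    _ ≤ Real.exp (∑ a ∈ S, |z a| ^ s.toReal) := by
        have := subsetSum_one_le h0 S
        simpa only [subsetSum, one_mul] using this
    _ ≤ Real.exp 1 := Real.exp_le_exp.mpr (hz S)

/-- Almost everywhere convergence with respect to `M` of the Riesz products `∏ (1 + i z(a) r_a)` with
`z` in the unit ball of `l^p`. -/
def RieszConvergent (p : ℝ) (M : Measure (Cube ι)) : Prop :=
  ∀ z : ι → ℝ, InUnitBall p z →
    ∀ᵐ ω ∂M, Tendsto (fun n => rieszSeq p z n ω) atTop (𝓝 (rieszFun p z ω))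

/-- The identity is plain for finite Riesz products, which are polynomials in characters. Along the
exhaustion the functional side converges by bounded a.e. convergence, the coefficient side by Hölder
summability. -/
theorem hasSum_rieszCoeff_mul (hst : s.toReal.HolderConjugate t.toReal) (hs2 : s.toReal ≤ 2)
    {M : Measure (Cube ι)} (hM : RieszConvergent s.toReal M) {L : (Cube ι → ℂ) → ℂ}
    (hL : DominatedLinear M L) (g : lp (fun _ : Finset ι => ℂ) t) (hg : ∀ w, L (walsh w) = g w)
    {z : ι → ℝ} (hz : InUnitBall s.toReal z) :
    HasSum (fun w => rieszCoeff (fun a => Complex.I * (z a : ℂ)) w * g w)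
      (L (rieszFun s.toReal z)) := by
  have hp := hst.lt
  have hp0 : 0 < s.toReal := by linarith
  have hsum : Summable fun w => ‖rieszCoeff (fun a => Complex.I * (z a : ℂ)) w * g w‖ :=
    summable_norm_mul_lp hst (⟨_, memlp_rieszCoeff_I_mul hz⟩ : lp (fun _ : Finset ι => ℂ) s) g
  have h1 := hL.tendsto (rieszSeq s.toReal z) (rieszFun s.toReal z) (Real.sqrt (Real.exp 1))
    (measurable_rieszSeq _ _) (fun n ω => norm_rieszFin_I_le hp0 hs2 hz _ ω)
    (measurable_rieszFun _ _) (hM z hz)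
  have hbw : ∀ w : Finset ι, BddMeasurable (walsh w) := fun w =>
    ⟨measurable_walsh w, 1, fun ω => (norm_walsh w ω).le⟩
  have h2 : ∀ n, L (rieszSeq s.toReal z n) =
      ∑ w ∈ (exhaustion (fun a => |z a| ^ s.toReal) n).powerset,
        rieszCoeff (fun a => Complex.I * (z a : ℂ)) w * g w := by
    intro n
    have : rieszSeq s.toReal z n = fun ω =>
        ∑ w ∈ (exhaustion (fun a => |z a| ^ s.toReal) n).powerset,
          rieszCoeff (fun a => Complex.I * (z a : ℂ)) w * walsh w ω :=
      funext fun ω => rieszFin_eq_sum _ _ ω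
    rw [this, hL.finset_sum (fun w => (hbw w).const_mul _)]
    exact Finset.sum_congr rfl fun w _ => by rw [hL.smul _ _ (hbw w), hg]
  have h3 := tendsto_sum_of_exhausts hsum
    (W := fun n => (exhaustion (fun a => |z a| ^ s.toReal) n).powerset)
    -- A word with nonzero coefficient uses only letters where `z ≠ 0`, and the exhaustion
    -- eventually contains these.
    (fun m n hmn => Finset.powerset_mono.mpr (monotone_exhaustion _ hmn)) fun w hw => by
      have hz0 : ∀ a ∈ w, z a ≠ 0 := by
        intro a ha h0
        refine hw ?_
        rw [rieszCoeff, Finset.prod_eq_zero ha (by rw [h0, Complex.ofReal_zero, mul_zero]), zero_mul]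
      have hev : ∀ a ∈ w, ∀ᶠ n in atTop, a ∈ exhaustion (fun a => |z a| ^ s.toReal) n := by
        intro a ha
        obtain ⟨n, hn⟩ := exists_mem_exhaustion hz.summable (a := a)
          (Real.rpow_pos_of_pos (abs_pos.mpr (hz0 a ha)) _)
        exact eventually_atTop.mpr ⟨n, fun m hm => monotone_exhaustion _ hm hn⟩
      obtain ⟨n, hn⟩ := ((Filter.eventually_all_finset w).mpr hev).exists
      exact ⟨n, Finset.mem_powerset.mpr hn⟩
  simp only [h2] at h1
  rw [tendsto_nhds_unique h1 h3]
  exact hsum.of_norm.hasSum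

/-- The function `Im ∏_a (1 + i z(a) r_a)`. -/
def oddRieszFun (p : ℝ) (z : ι → ℝ) (ω : Cube ι) : ℂ :=
  (2 * Complex.I)⁻¹ * (rieszFun p z ω - rieszFun p (-z) ω)

theorem oddRieszFun_neg (p : ℝ) (z : ι → ℝ) (ω : Cube ι) :
    oddRieszFun p (-z) ω = -oddRieszFun p z ω := by
  rw [oddRieszFun, oddRieszFun, neg_neg]
  ring

theorem measurable_oddRieszFun (p : ℝ) (z : ι → ℝ) : Measurable (oddRieszFun p z) :=
  ((measurable_rieszFun p z).sub (measurable_rieszFun p (-z))).const_mul _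

theorem norm_oddRieszFun_le {p : ℝ} (hp : 0 < p) (hp2 : p ≤ 2) {z : ι → ℝ} (h : InUnitBall p z)
    (ω : Cube ι) : ‖oddRieszFun p z ω‖ ≤ Real.sqrt (Real.exp 1) := by
  have h1 := norm_rieszFun_le hp hp2 h ω
  have h2 := norm_rieszFun_le hp hp2 h.neg ω
  have h3 := norm_sub_le (rieszFun p z ω) (rieszFun p (-z) ω)
  rw [oddRieszFun, norm_mul, norm_inv, norm_mul, Complex.norm_I, mul_one, Complex.norm_ofNat]
  linarith

/-- Changing the sign of `z` replaces `i^k` by its conjugate, so the difference isolates `Im i^k`.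
-/
theorem rieszCoeff_sub_rieszCoeff_neg (hs2 : s ≤ 2) (z : ι → ℝ) (w : Finset ι) :
    (2 * Complex.I)⁻¹ * (rieszCoeff (fun a => Complex.I * (z a : ℂ)) w -
      rieszCoeff (fun a => Complex.I * ((-z) a : ℂ)) w)
      = ((blockSign s w.card * ∏ a ∈ w, z a : ℝ) : ℂ) := by
  have h1 : rieszCoeff (fun a => Complex.I * (z a : ℂ)) w
      = Complex.I ^ w.card * ((∏ a ∈ w, z a : ℝ) : ℂ) := by
    rw [rieszCoeff, Finset.prod_mul_distrib, Finset.prod_const, Complex.ofReal_prod]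
  have h2 : rieszCoeff (fun a => Complex.I * ((-z) a : ℂ)) w
      = (starRingEnd ℂ Complex.I) ^ w.card * ((∏ a ∈ w, z a : ℝ) : ℂ) := by
    rw [rieszCoeff, Complex.ofReal_prod, ← Finset.prod_const, ← Finset.prod_mul_distrib]
    exact Finset.prod_congr rfl fun a _ => by simp
  rw [h1, h2, ← map_pow, ← sub_mul, Complex.sub_conj, blockSign, if_pos hs2]
  push_cast
  field_simp

theorem hasSum_oddRieszFun (hst : s.toReal.HolderConjugate t.toReal) (hs2 : s ≤ 2)
    {M : Measure (Cube ι)} (hM : RieszConvergent s.toReal M) {L : (Cube ι → ℂ) → ℂ}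
    (hL : DominatedLinear M L) (g : lp (fun _ : Finset ι => ℂ) t) (hg : ∀ w, L (walsh w) = g w)
    {z : ι → ℝ} (hz : InUnitBall s.toReal z) :
    HasSum (fun w => ((blockSign s w.card * ∏ a ∈ w, z a : ℝ) : ℂ) * g w)
      (L (oddRieszFun s.toReal z)) := by
  have hp0 : 0 < s.toReal := by linarith [hst.lt]
  have hs2' : s.toReal ≤ 2 := ENNReal.toReal_le_of_le_ofReal zero_le_two (by simpa using hs2)
  have hb : ∀ {z : ι → ℝ}, InUnitBall s.toReal z → BddMeasurable (rieszFun s.toReal z) :=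
    fun h => ⟨measurable_rieszFun _ _, _, norm_rieszFun_le hp0 hs2' h⟩
  have h := ((hasSum_rieszCoeff_mul hst hs2' hM hL g hg hz).sub
    (hasSum_rieszCoeff_mul hst hs2' hM hL g hg hz.neg)).mul_left (2 * Complex.I)⁻¹
  have hLz : L (oddRieszFun s.toReal z) = (2 * Complex.I)⁻¹ *
      (L (rieszFun s.toReal z) - L (rieszFun s.toReal (-z))) := by
    rw [← hL.sub (hb hz) (hb hz.neg)]
    refine hL.smul _ _ ?_
    have := (hb hz).add ((hb hz.neg).const_mul (-1))
    simpa only [neg_one_mul, ← sub_eq_add_neg] using this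
  rw [hLz]
  refine (congrArg (HasSum · _) (funext fun w => ?_)).mp h
  rw [← rieszCoeff_sub_rieszCoeff_neg hs2]
  ring

end RieszFunctional

/-! ### Extension of vectors by zero to `A'`. -/

section Extension

variable {A : Type*} {s : ℝ≥0∞}

/-- Extension by zero of a vector on `A_n` to `A'`. -/
def extVec (n : ℕ) (z : cascade A n → ℝ) : CascadeUnion A → ℝ :=
  Function.extend (fun b => (⟨n, b⟩ : CascadeUnion A)) z 0

theorem extVec_apply (n : ℕ) (z : cascade A n → ℝ) (b : cascade A n) : extVec n z ⟨n, b⟩ = z b :=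
  sigma_mk_injective.extend_apply z 0 b

theorem extVec_of_ne {n : ℕ} (z : cascade A n → ℝ) {b : CascadeUnion A} (hb : b.1 ≠ n) :
    extVec n z b = 0 :=
  Function.extend_apply' _ _ _ fun ⟨c, hc⟩ => hb (by rw [← hc])

theorem extVec_smul (n : ℕ) (c : ℝ) (z : cascade A n → ℝ) : extVec n (c • z) = c • extVec n z := by
  funext b
  by_cases hb : b.1 = n
  · obtain ⟨m, b⟩ := b
    obtain rfl : m = n := hb
    exact (extVec_apply m (c • z) b).trans (congrArg (c * ·) (extVec_apply m z b).symm)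
  · rw [Pi.smul_apply, extVec_of_ne _ hb, extVec_of_ne _ hb, smul_zero]

theorem abs_extVec_le {n : ℕ} {z : cascade A n → ℝ} {C : ℝ} (hC : 0 ≤ C) (hz : ∀ b, |z b| ≤ C)
    (b : CascadeUnion A) : |extVec n z b| ≤ C := by
  by_cases hb : b.1 = n
  · obtain ⟨m, b⟩ := b
    obtain rfl : m = n := hb
    rw [extVec_apply]
    exact hz b
  · rwa [extVec_of_ne _ hb, abs_zero]

theorem inUnitBall_extVec {p : ℝ} (hp : 0 < p) {n : ℕ} {z : cascade A n → ℝ}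
    (hz : InUnitBall p z) : InUnitBall p (extVec n z) := by
  classical
  intro S
  have hinj : Function.Injective fun b : cascade A n => (⟨n, b⟩ : CascadeUnion A) :=
    sigma_mk_injective
  rw [← Finset.sum_preimage _ S hinj.injOn]
  · simp only [extVec_apply]
    exact hz _
  · intro b _ hb
    have : b.1 ≠ n := by
      obtain ⟨m, b⟩ := b
      rintro h
      obtain rfl : m = n := h
      exact hb ⟨b, rfl⟩
    rw [extVec_of_ne _ this, abs_zero, Real.zero_rpow hp.ne']

/-- A word with a letter from another level gets a zero factor. Thus a lifted Riesz product is again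
a Riesz product on the large cube, and all levels can be handled there. -/
theorem liftCoeff_prod (n : ℕ) (q : ℕ → ℝ) (z : cascade A n → ℝ)
    (w : Finset (CascadeUnion A)) :
    liftCoeff n (fun v => q v.card * ∏ b ∈ v, z b) w = q w.card * ∏ b ∈ w, extVec n z b := by
  by_cases h : w ∈ Set.range (wordMap (A := A) n)
  · obtain ⟨v, rfl⟩ := h
    rw [liftCoeff_wordMap, wordMap, Finset.card_map, Finset.prod_map]
    congr 1
    exact Finset.prod_congr rfl fun b _ => (extVec_apply n z b).symm
  · rw [liftCoeff_of_notMem_range _ h]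
    have : ∃ b ∈ w, b.1 ≠ n := by
      by_contra! hb
      exact h (mem_range_wordMap hb)
    obtain ⟨b, hbw, hb⟩ := this
    rw [Finset.prod_eq_zero hbw (extVec_of_ne z hb), mul_zero]

end Extension

/-! ### The bounded function of a real vector. -/

section Levels

variable {A : Type*} {s t : ℝ≥0∞}

/-- The normalized vector `x_n / ‖x_n‖` of the cascade, on `A'`. -/
def unitVec {n : ℕ} (v : lp (fun _ : cascade A n => ℝ) s) : CascadeUnion A → ℝ :=
  extVec n (sphNormalize s v)

theorem unitVec_smul {n : ℕ} (c : ℝ) (v : lp (fun _ : cascade A n => ℝ) s)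
    [Fact (1 ≤ s)] : unitVec (c • v) = (c / |c|) • unitVec v := by
  rw [unitVec, unitVec, ← extVec_smul]
  congr 1
  funext b
  have h : ‖c • v‖ = |c| * ‖v‖ := by rw [norm_smul, Real.norm_eq_abs]
  rw [Pi.smul_apply, sphNormalize, sphNormalize, lNorm_coe, lNorm_coe, h, smul_eq_mul,
    div_mul_div_comm]
  rfl

theorem liftCoeff_blockCoeff {n : ℕ} (v : lp (fun _ : cascade A n => ℝ) s)
    (w : Finset (CascadeUnion A)) : liftCoeff n (blockCoeff s v) w
      = ‖v‖ * (blockSign s w.card * ∏ b ∈ w, unitVec v b) := by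
  have h : blockCoeff s v = fun u => (‖v‖ * blockSign s u.card) * ∏ b ∈ u, sphNormalize s v b := by
    funext u
    rw [blockCoeff_eq, lNorm_coe, mul_assoc]
  rw [h, liftCoeff_prod n (fun k => ‖v‖ * blockSign s k), mul_assoc, unitVec]

variable [hs1 : Fact (1 ≤ s)]

theorem inUnitBall_unitVec (hs : s ≠ ∞) {n : ℕ} (v : lp (fun _ : cascade A n => ℝ) s) :
    InUnitBall s.toReal (unitVec v) :=
  inUnitBall_extVec (by linarith [one_le_toReal_of_fact hs1.out hs]) (inUnitBall_sphNormalize hs v)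

theorem abs_unitVec_le_one {n : ℕ} (v : lp (fun _ : cascade A n => ℝ) s) (b : CascadeUnion A) :
    |unitVec v b| ≤ 1 :=
  abs_extVec_le zero_le_one (abs_sphNormalize_le_one v) b

/-- An odd positively homogeneous quantity is homogeneous. -/
theorem norm_mul_unitVec_smul {V : Type*} [AddCommGroup V] [Module ℂ V]
    {h : (CascadeUnion A → ℝ) → V} (hodd : ∀ z, h (-z) = -h z) {n : ℕ} (c : ℝ)
    (v : lp (fun _ : cascade A n => ℝ) s) :
    (‖c • v‖ : ℂ) • h (unitVec (c • v)) = (c : ℂ) • (‖v‖ : ℂ) • h (unitVec v) := by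
  rcases eq_or_ne c 0 with rfl | hc
  · simp
  rw [unitVec_smul, norm_smul, Real.norm_eq_abs, Complex.ofReal_mul, smul_smul]
  rcases hc.lt_or_gt with h' | h'
  · rw [abs_of_neg h', div_neg, div_self hc, neg_smul, one_smul, hodd, smul_neg, ← neg_smul]
    congr 1
    push_cast
    ring
  · rw [abs_of_pos h', div_self hc, one_smul]

theorem summable_norm_cVec (x : lp (fun _ : A => ℝ) s) : Summable fun n => ‖cVec x n‖ :=
  .of_nonneg_of_le (fun _ => norm_nonneg _) (norm_cVec_le x)
    ((summable_geometric_of_lt_one (deltaConst_nonneg s) (deltaConst_lt_one hs1.out)).mul_right _)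

theorem tsum_norm_cVec_le (x : lp (fun _ : A => ℝ) s) :
    ∑' n, ‖cVec x n‖ ≤ ‖x‖ / (1 - deltaConst s) := by
  have h := hasSum_geometric_deltaConst ‖x‖ s hs1.out
  refine ((summable_norm_cVec x).tsum_le_tsum (fun n => ?_) h.summable).trans h.tsum_eq.le
  rw [mul_comm]
  exact norm_cVec_le x n

theorem norm_I_pow_mul_norm {V : Type*} [SeminormedAddCommGroup V] (n : ℕ) (v : V) :
    ‖Complex.I ^ n * (‖v‖ : ℂ)‖ = ‖v‖ := by
  rw [norm_mul, norm_pow, Complex.norm_I, one_pow, one_mul, Complex.norm_real, norm_norm]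

/-- The function with the Walsh series `Φ^{(s)}(x)`, for real `x` and `1 < s ≤ 2`. -/
def phiFunReal (x : lp (fun _ : A => ℝ) s) (ω : Cube (CascadeUnion A)) : ℂ :=
  ∑' n, (Complex.I ^ n * (‖cVec x n‖ : ℂ)) * oddRieszFun s.toReal (unitVec (cVec x n)) ω

theorem phiFunReal_smul (c : ℝ) (x : lp (fun _ : A => ℝ) s) (ω : Cube (CascadeUnion A)) :
    phiFunReal (c • x) ω = c * phiFunReal x ω := by
  rw [phiFunReal, phiFunReal, ← tsum_mul_left]
  refine tsum_congr fun n => ?_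
  have h := norm_mul_unitVec_smul (h := fun z => oddRieszFun s.toReal z ω)
    (fun z => oddRieszFun_neg _ z ω) c (cVec x n)
  rw [← cVec_smul] at h
  simp only [smul_eq_mul] at h
  rw [mul_assoc, h]
  ring

theorem norm_oddRieszFun_unitVec_le (hs2 : s ≤ 2) {n : ℕ} (v : lp (fun _ : cascade A n => ℝ) s)
    (ω : Cube (CascadeUnion A)) :
    ‖oddRieszFun s.toReal (unitVec v) ω‖ ≤ Real.sqrt (Real.exp 1) := by
  have hs : s ≠ ∞ := ne_top_of_le_ne_top (by simp) hs2
  exact norm_oddRieszFun_le (by linarith [one_le_toReal_of_fact hs1.out hs])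
    (ENNReal.toReal_le_of_le_ofReal zero_le_two (by simpa using hs2)) (inUnitBall_unitVec hs v) ω

theorem measurable_phiFunReal (hs2 : s ≤ 2) (x : lp (fun _ : A => ℝ) s) :
    Measurable (phiFunReal x) :=
  (bddMeasurable_tsum (c := fun n => Complex.I ^ n * (‖cVec x n‖ : ℂ))
    (fun n => measurable_oddRieszFun _ _)
    (fun n ω => norm_oddRieszFun_unitVec_le hs2 (cVec x n) ω)
    (by simpa only [norm_I_pow_mul_norm] using summable_norm_cVec x)).1

theorem norm_phiFunReal_le (hs2 : s ≤ 2) (x : lp (fun _ : A => ℝ) s) (ω : Cube (CascadeUnion A)) :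
    ‖phiFunReal x ω‖ ≤ Real.sqrt (Real.exp 1) / (1 - deltaConst s) * ‖x‖ := by
  have h := (bddMeasurable_tsum (c := fun n => Complex.I ^ n * (‖cVec x n‖ : ℂ))
    (fun n => measurable_oddRieszFun _ _)
    (fun n ω => norm_oddRieszFun_unitVec_le hs2 (cVec x n) ω)
    (by simpa only [norm_I_pow_mul_norm] using summable_norm_cVec x)).2 ω
  simp only [norm_I_pow_mul_norm] at h
  refine h.trans ?_
  calc (∑' n, ‖cVec x n‖) * Real.sqrt (Real.exp 1)
      ≤ ‖x‖ / (1 - deltaConst s) * Real.sqrt (Real.exp 1) :=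
        mul_le_mul_of_nonneg_right (tsum_norm_cVec_le x) (Real.sqrt_nonneg _)
    _ = _ := by ring

/-- Each level is one odd Riesz product, where the formula is known. The levels are summed by
termwise application of `L` on one side and by continuity of the pairing on `l^s` on the other. -/
theorem apply_phiFunReal (hst : s.toReal.HolderConjugate t.toReal) (hs2 : s ≤ 2)
    {M : Measure (Cube (CascadeUnion A))} (hM : RieszConvergent s.toReal M)
    {L : (Cube (CascadeUnion A) → ℂ) → ℂ} (hL : DominatedLinear M L)
    (g : lp (fun _ : Finset (CascadeUnion A) => ℂ) t) (hg : ∀ w, L (walsh w) = g w)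
    (x : lp (fun _ : A => ℝ) s) : L (phiFunReal x) = lpPairing hst g (phiRealLp x) := by
  have hs : s ≠ ∞ := ne_top_of_le_ne_top (by simp) hs2
  have h1 : ∀ n, (Complex.I ^ n * (‖cVec x n‖ : ℂ)) * L (oddRieszFun s.toReal (unitVec (cVec x n)))
      = lpPairing hst g (phiTerm x n) := by
    intro n
    rw [← (hasSum_oddRieszFun hst hs2 hM hL g hg (inUnitBall_unitVec hs (cVec x n))).tsum_eq,
      ← tsum_mul_left, lpPairing_apply]
    refine tsum_congr fun w => ?_
    have : phiTerm x n w = Complex.I ^ n * (liftCoeff n (blockCoeff s (cVec x n)) w : ℂ) := rfl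
    rw [this, liftCoeff_blockCoeff]
    push_cast
    ring
  have h2 : HasSum (fun n => lpPairing hst g (phiTerm x n)) (lpPairing hst g (phiRealLp x)) :=
    (summable_phiTerm x).hasSum.mapL (lpPairing hst g)
  have h3 : Summable fun n => ‖lpPairing hst g (phiTerm x n)‖ := by
    refine .of_nonneg_of_le (fun _ => norm_nonneg _) (fun n => ?_)
      ((hasSum_geometric_deltaConst (blockConst s * ‖x‖) s hs1.out).summable.mul_left
        ‖lpPairing hst g‖)
    exact ((lpPairing hst g).le_opNorm _).trans
      (mul_le_mul_of_nonneg_left (norm_phiTerm_le x n) (norm_nonneg _))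
  have h4 := hL.hasSum (c := fun n => Complex.I ^ n * (‖cVec x n‖ : ℂ))
    (fun n => measurable_oddRieszFun _ _)
    (fun n ω => norm_oddRieszFun_unitVec_le hs2 (cVec x n) ω)
    (by simpa only [norm_I_pow_mul_norm] using summable_norm_cVec x)
    (by simpa only [h1] using h3)
  simp only [h1] at h4
  exact h4.unique h2

end Levels

/-! ### Real and imaginary parts in `l^s`. -/

section ComplexVectors

variable {ι : Type*} {s : ℝ≥0∞}

/-- The real part of an element of `l^s`. -/
def reLp (x : lp (fun _ : ι => ℂ) s) : lp (fun _ : ι => ℝ) s :=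
  ⟨fun a => (x a).re, Memℓp.mono' (lp.memℓp x) fun _ => Complex.abs_re_le_norm _⟩

/-- The imaginary part of an element of `l^s`. -/
def imLp (x : lp (fun _ : ι => ℂ) s) : lp (fun _ : ι => ℝ) s :=
  ⟨fun a => (x a).im, Memℓp.mono' (lp.memℓp x) fun _ => Complex.abs_im_le_norm _⟩

theorem reLp_apply (x : lp (fun _ : ι => ℂ) s) (a : ι) : reLp x a = (x a).re := rfl

theorem imLp_apply (x : lp (fun _ : ι => ℂ) s) (a : ι) : imLp x a = (x a).im := rfl

theorem apply_eq_reLp_add_imLp (x : lp (fun _ : ι => ℂ) s) (a : ι) :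
    x a = reLp x a + Complex.I * imLp x a := by
  rw [mul_comm, reLp_apply, imLp_apply, Complex.re_add_im]

theorem reLp_smul (c : ℝ) (x : lp (fun _ : ι => ℂ) s) : reLp ((c : ℂ) • x) = c • reLp x := by
  ext a
  exact Complex.re_ofReal_mul c (x a)

theorem imLp_smul (c : ℝ) (x : lp (fun _ : ι => ℂ) s) : imLp ((c : ℂ) • x) = c • imLp x := by
  ext a
  exact Complex.im_ofReal_mul c (x a)

variable [hs1 : Fact (1 ≤ s)]

theorem norm_reLp_le (x : lp (fun _ : ι => ℂ) s) : ‖reLp x‖ ≤ ‖x‖ :=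
  lp_norm_le_of_injective hs1.out x (reLp x) Function.injective_id
    fun _ => Complex.abs_re_le_norm _

theorem norm_imLp_le (x : lp (fun _ : ι => ℂ) s) : ‖imLp x‖ ≤ ‖x‖ :=
  lp_norm_le_of_injective hs1.out x (imLp x) Function.injective_id
    fun _ => Complex.abs_im_le_norm _

theorem continuous_reLp : Continuous (reLp : lp (fun _ : ι => ℂ) s → lp (fun _ : ι => ℝ) s) := by
  refine (LipschitzWith.mk_one fun x y => ?_).continuous
  have h : reLp x - reLp y = reLp (x - y) := by
    ext a
    exact (Complex.sub_re (x a) (y a)).symm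
  rw [dist_eq_norm, dist_eq_norm, h]
  exact norm_reLp_le _

theorem continuous_imLp : Continuous (imLp : lp (fun _ : ι => ℂ) s → lp (fun _ : ι => ℝ) s) := by
  refine (LipschitzWith.mk_one fun x y => ?_).continuous
  have h : imLp x - imLp y = imLp (x - y) := by
    ext a
    exact (Complex.sub_im (x a) (y a)).symm
  rw [dist_eq_norm, dist_eq_norm, h]
  exact norm_imLp_le _

end ComplexVectors

/-! ### The Walsh series of complex vectors. -/

section Transform

variable {A : Type*} {s t : ℝ≥0∞}

theorem incl_injective : Function.Injective (incl : A → CascadeUnion A) :=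
  sigma_mk_injective (β := cascade A) (i := 0)

theorem singleton_incl_injective :
    Function.Injective fun a : A => ({incl a} : Finset (CascadeUnion A)) :=
  Finset.singleton_injective.comp incl_injective

theorem phiSeries_one_incl (x : A → ℂ) (a : A) : phiSeries 1 x {incl a} = x a := by
  have h : ∀ u : A → ℝ, phiReal 1 u {incl a} = u a := by
    intro u
    let b : cascade A 0 := a
    have h1 : liftCoeff 0 (uCoeff u) (wordMap 0 {b}) = u b := by
      rw [liftCoeff_wordMap]
      exact (if_pos (Finset.card_singleton b)).trans (Finset.prod_singleton u b)
    rw [phiReal, if_pos rfl]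
    exact congrArg _ h1
  rw [phiSeries, h, h, mul_comm, Complex.re_add_im]

theorem phiSeries_one_eq_zero (x : A → ℂ) {w : Finset (CascadeUnion A)}
    (hw : w ∉ Set.range fun a : A => ({incl a} : Finset (CascadeUnion A))) :
    phiSeries 1 x w = 0 := by
  have h : ∀ u : A → ℝ, phiReal 1 u w = 0 := by
    intro u
    rw [phiReal, if_pos rfl]
    by_cases h : w ∈ Set.range (wordMap (A := A) 0)
    · obtain ⟨v, rfl⟩ := h
      rw [liftCoeff_wordMap]
      refine Complex.ofReal_eq_zero.mpr (if_neg fun hv => ?_)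
      obtain ⟨a, rfl⟩ := Finset.card_eq_one.mp hv
      exact hw ⟨a, rfl⟩
    · rw [liftCoeff_of_notMem_range _ h, Complex.ofReal_zero]
  rw [phiSeries, h, h, mul_zero, add_zero]

theorem phiSeries_eq [Fact (1 ≤ s)] (hs : s ≠ 1) (x : lp (fun _ : A => ℂ) s)
    (w : Finset (CascadeUnion A)) :
    phiSeries s x w = (phiRealLp (reLp x) + Complex.I • phiRealLp (imLp x)) w := by
  rw [lp.coeFn_add, Pi.add_apply, lp.coeFn_smul, Pi.smul_apply, smul_eq_mul, phiRealLp_apply hs,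
    phiRealLp_apply hs]
  rfl

theorem memlp_phiSeries [hs1 : Fact (1 ≤ s)] (x : lp (fun _ : A => ℂ) s) :
    Memℓp (phiSeries s x) s := by
  rcases eq_or_ne s 1 with rfl | hs
  · exact (memlp_and_norm_le_of_dominated le_rfl x singleton_incl_injective
      (fun w hw => phiSeries_one_eq_zero x hw) fun a => by rw [phiSeries_one_incl]).1
  · have : phiSeries s x = (phiRealLp (reLp x) + Complex.I • phiRealLp (imLp x) :
        lp (fun _ : Finset (CascadeUnion A) => ℂ) s) := funext (phiSeries_eq hs x)
    rw [this]
    exact lp.memℓp _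

theorem tsum_add_I_mul_mul {κ : Type*} (hst : s.toReal.HolderConjugate t.toReal)
    (f₁ f₂ : lp (fun _ : κ => ℂ) s) (g₁ g₂ : lp (fun _ : κ => ℂ) t) :
    ∑' w, (f₁ w + Complex.I * f₂ w) * (g₁ w + Complex.I * g₂ w) =
      (∑' w, f₁ w * g₁ w - ∑' w, f₂ w * g₂ w) +
        Complex.I * (∑' w, f₁ w * g₂ w + ∑' w, f₂ w * g₁ w) := by
  have h := fun (f : lp (fun _ : κ => ℂ) s) (g : lp (fun _ : κ => ℂ) t) =>
    (summable_norm_mul_lp hst f g).of_norm.hasSum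
  refine HasSum.tsum_eq ?_
  refine (congrArg (HasSum · _) (funext fun w => ?_)).mp
    (((h f₁ g₁).sub (h f₂ g₂)).add (((h f₁ g₂).add (h f₂ g₁)).mul_left Complex.I))
  linear_combination (-(f₂ w * g₂ w)) * Complex.I_mul_I

variable [hs1 : Fact (1 ≤ s)] [ht1 : Fact (1 ≤ t)]

/-- The Walsh series `Φ^{(s)}(x)`, as an element of `l^s`. -/
def phiLp (x : lp (fun _ : A => ℂ) s) : lp (fun _ : Finset (CascadeUnion A) => ℂ) s :=
  ⟨phiSeries s x, memlp_phiSeries x⟩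

theorem phiLp_apply (x : lp (fun _ : A => ℂ) s) (w : Finset (CascadeUnion A)) :
    phiLp x w = phiSeries s x w := rfl

theorem phiLp_eq (hs : s ≠ 1) (x : lp (fun _ : A => ℂ) s) :
    phiLp x = phiRealLp (reLp x) + Complex.I • phiRealLp (imLp x) := by
  ext w
  exact phiSeries_eq hs x w

theorem phiLp_incl (x : lp (fun _ : A => ℂ) s) (a : A) : phiLp x {incl a} = x a := by
  rcases eq_or_ne s 1 with rfl | hs
  · exact phiSeries_one_incl x a
  · rw [phiLp_eq hs, lp.coeFn_add, Pi.add_apply, lp.coeFn_smul, Pi.smul_apply, smul_eq_mul,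
      phiRealLp_incl, phiRealLp_incl, ← apply_eq_reLp_add_imLp]

theorem norm_le_norm_phiLp (x : lp (fun _ : A => ℂ) s) : ‖x‖ ≤ ‖phiLp x‖ :=
  lp_norm_le_of_injective hs1.out (phiLp x) x singleton_incl_injective
    fun a => by rw [phiLp_incl]

theorem norm_phiLp_le (hs : s ≠ 1) (x : lp (fun _ : A => ℂ) s) :
    ‖phiLp x‖ ≤ 2 * blockConst s / (1 - deltaConst s) * ‖x‖ := by
  have h0 : 0 < 1 - deltaConst s := sub_pos.mpr (deltaConst_lt_one hs1.out)
  have hb := one_le_blockConst s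
  rw [phiLp_eq hs]
  refine (norm_add_le _ _).trans ?_
  rw [norm_smul, Complex.norm_I, one_mul]
  calc ‖phiRealLp (reLp x)‖ + ‖phiRealLp (imLp x)‖
      ≤ blockConst s * ‖x‖ / (1 - deltaConst s) + blockConst s * ‖x‖ / (1 - deltaConst s) := by
        refine add_le_add ((norm_phiRealLp_le _).trans ?_) ((norm_phiRealLp_le _).trans ?_)
        · gcongr; exact norm_reLp_le x
        · gcongr; exact norm_imLp_le x
    _ = _ := by ring

theorem continuous_phiLp :
    Continuous (phiLp : lp (fun _ : A => ℂ) s → lp (fun _ : Finset (CascadeUnion A) => ℂ) s) := by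
  rcases eq_or_ne s 1 with rfl | hs
  · refine (LipschitzWith.mk_one fun x y => ?_).continuous
    rw [dist_eq_norm, dist_eq_norm]
    refine lp_norm_le_of_dominated le_rfl (x - y) (phiLp x - phiLp y) singleton_incl_injective
      (fun w hw => ?_) fun a => ?_
    · rw [lp.coeFn_sub, Pi.sub_apply, phiLp_apply, phiLp_apply, phiSeries_one_eq_zero _ hw,
        phiSeries_one_eq_zero _ hw, sub_zero]
    · rw [lp.coeFn_sub, Pi.sub_apply, phiLp_incl, phiLp_incl, lp.coeFn_sub, Pi.sub_apply]
  · have : (phiLp : lp (fun _ : A => ℂ) s → lp (fun _ : Finset (CascadeUnion A) => ℂ) s)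
        = fun x => phiRealLp (reLp x) + Complex.I • phiRealLp (imLp x) := funext (phiLp_eq hs)
    rw [this]
    exact (continuous_phiRealLp.comp continuous_reLp).add
      ((continuous_phiRealLp.comp continuous_imLp).const_smul Complex.I)

/-- For `s = 1` the series lives on the Rademacher characters of `A`, so it sees only those
coefficients of `g`; no cancellation is needed. -/
theorem phiLp_mul_hasSum_one {x : lp (fun _ : A => ℂ) 1}
    (g : lp (fun _ : Finset (CascadeUnion A) => ℂ) ∞) :
    Summable (fun w => ‖phiLp x w * g w‖) ∧
      HasSum (fun a => x a * g {incl a}) (∑' w, phiLp x w * g w) := by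
  have hx : Summable fun a => ‖x a‖ := by simpa using (lp.memℓp x).summable (by simp)
  have hs : Summable fun a => ‖x a * g {incl a}‖ :=
    .of_nonneg_of_le (fun _ => norm_nonneg _) (fun a => by
      rw [norm_mul]
      exact mul_le_mul_of_nonneg_left (lp.norm_apply_le_norm (by simp) g _) (norm_nonneg _))
      (hx.mul_right ‖g‖)
  have h0 : ∀ w, w ∉ Set.range (fun a : A => ({incl a} : Finset (CascadeUnion A))) →
      phiLp x w * g w = 0 := fun w hw => by
    rw [phiLp_apply, phiSeries_one_eq_zero _ hw, zero_mul]
  have h1 : ∀ a, phiLp x {incl a} * g {incl a} = x a * g {incl a} := fun a => by rw [phiLp_incl]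
  constructor
  · refine (singleton_incl_injective.summable_iff fun w hw => ?_).mp ?_
    · rw [h0 w hw, norm_zero]
    · simpa only [Function.comp_def, h1] using hs
  · rw [← singleton_incl_injective.tsum_eq (f := fun w => phiLp x w * g w)]
    · simp only [h1]
      exact hs.of_norm.hasSum
    · intro w hw
      by_contra h
      exact hw (h0 w h)

theorem tsum_phiLp_mul_phiLp (hst : s.toReal.HolderConjugate t.toReal)
    (x : lp (fun _ : A => ℂ) s) (y : lp (fun _ : A => ℂ) t) :
    ∑' w, phiLp x w * phiLp y w = ∑' a, x a * y a := by
  have e2 : ∀ w, phiLp x w = phiRealLp (reLp x) w + Complex.I * phiRealLp (imLp x) w := fun w =>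
    phiSeries_eq (ne_one_of_holderConjugate hst) x w
  have e3 : ∀ w, phiLp y w = phiRealLp (reLp y) w + Complex.I * phiRealLp (imLp y) w := fun w =>
    phiSeries_eq (ne_one_of_holderConjugate hst.symm) y w
  simp only [e2, e3, tsum_add_I_mul_mul hst, tsum_phiRealLp_mul_phiRealLp hst]
  have h := fun (f : lp (fun _ : A => ℝ) s) (g : lp (fun _ : A => ℝ) t) =>
    Complex.hasSum_ofReal.mpr (summable_norm_mul_lp hst f g).of_norm.hasSum
  symm
  refine HasSum.tsum_eq ?_
  refine (congrArg (HasSum · _) (funext fun a => ?_)).mp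
    (((h (reLp x) (reLp y)).sub (h (imLp x) (imLp y))).add
      (((h (reLp x) (imLp y)).add (h (imLp x) (reLp y))).mul_left Complex.I))
  rw [apply_eq_reLp_add_imLp x, apply_eq_reLp_add_imLp y]
  push_cast
  linear_combination (-((imLp x a : ℂ) * (imLp y a))) * Complex.I_mul_I

theorem hasSum_mul_tsum_phiLp (hst : s.toReal.HolderConjugate t.toReal)
    (x : lp (fun _ : A => ℂ) s) (y : lp (fun _ : A => ℂ) t) :
    HasSum (fun a => x a * y a) (∑' w, phiLp x w * phiLp y w) := by
  rw [tsum_phiLp_mul_phiLp hst]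
  exact (summable_norm_mul_lp hst x y).of_norm.hasSum

end Transform

/-! ### The bounded functions for exponents at most 2. -/

section PhiFunctions

variable {A : Type*} {s t : ℝ≥0∞}

theorem rieszConvergent_prob {ι : Type*} {p : ℝ} (hp : 1 ≤ p) (hp2 : p ≤ 2) :
    RieszConvergent p (prob ι) := fun z hz =>
  ae_tendsto_rieszFun hp hp2 hz (fun T => by
    simp only [Pi.zero_apply, mul_zero, abs_zero, Finset.sum_const_zero]
    exact Real.rpow_nonneg (Finset.sum_nonneg fun a _ => by positivity) _) isRieszMeasure_prob

theorem toReal_le_two (hs2 : s ≤ 2) : s.toReal ≤ 2 :=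
  ENNReal.toReal_le_of_le_ofReal zero_le_two (by simpa using hs2)

theorem summable_norm_lp_one {ι : Type*} (x : lp (fun _ : ι => ℂ) 1) :
    Summable fun a => ‖x a‖ := by
  simpa using (lp.memℓp x).summable (by simp)

theorem norm_lp_one {ι : Type*} (x : lp (fun _ : ι => ℂ) 1) : ‖x‖ = ∑' a, ‖x a‖ := by
  simpa using lp.norm_eq_tsum_rpow (by simp) x

theorem norm_mul_walsh {ι : Type*} (c : ℂ) (w : Finset ι) (ω : Cube ι) :
    ‖c * walsh w ω‖ = ‖c‖ := by
  rw [norm_mul, norm_walsh, mul_one]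

theorem exists_holderConjugate (hs : 1 < s) (hs2 : s ≤ 2) :
    ∃ t : ℝ≥0∞, s.toReal.HolderConjugate t.toReal := by
  have hs' : s ≠ ∞ := ne_top_of_le_ne_top (by simp) hs2
  have h1 : 1 < s.toReal := by simpa using (ENNReal.toReal_lt_toReal (by simp) hs').mpr hs
  have h := Real.HolderConjugate.conjExponent h1
  refine ⟨ENNReal.ofReal (s.toReal.conjExponent), ?_⟩
  rwa [ENNReal.toReal_ofReal h.symm.nonneg]

variable [hs1 : Fact (1 ≤ s)]

/-- The function with the Walsh series `Φ^{(s)}(x)`, for `1 ≤ s ≤ 2`. -/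
def phiFun (x : lp (fun _ : A => ℂ) s) (ω : Cube (CascadeUnion A)) : ℂ :=
  open Classical in
  if s = 1 then ∑' a, x a * walsh {incl a} ω
  else phiFunReal (reLp x) ω + Complex.I * phiFunReal (imLp x) ω

theorem phiFun_one (x : lp (fun _ : A => ℂ) 1) (ω : Cube (CascadeUnion A)) :
    phiFun x ω = ∑' a, x a * walsh {incl a} ω := if_pos rfl

theorem phiFun_of_ne (hs : s ≠ 1) (x : lp (fun _ : A => ℂ) s) :
    phiFun x = fun ω => phiFunReal (reLp x) ω + Complex.I * phiFunReal (imLp x) ω :=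
  funext fun _ => if_neg hs

theorem phiFun_smul (c : ℝ) (x : lp (fun _ : A => ℂ) s) (ω : Cube (CascadeUnion A)) :
    phiFun ((c : ℂ) • x) ω = c * phiFun x ω := by
  rcases eq_or_ne s 1 with rfl | hs
  · rw [phiFun_one, phiFun_one, ← tsum_mul_left]
    exact tsum_congr fun a => by rw [lp.coeFn_smul, Pi.smul_apply, smul_eq_mul, mul_assoc]
  · simp only [phiFun_of_ne hs, reLp_smul, imLp_smul, phiFunReal_smul]
    ring

theorem continuous_phiFun_one (x : lp (fun _ : A => ℂ) 1) :
    Continuous (phiFun x : Cube (CascadeUnion A) → ℂ) := by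
  have : (phiFun x : Cube (CascadeUnion A) → ℂ) = fun ω => ∑' a, x a * walsh {incl a} ω :=
    funext (phiFun_one x)
  rw [this]
  exact continuous_tsum (fun a => (continuous_walsh _).const_mul _) (summable_norm_lp_one x)
    fun a ω => (norm_mul_walsh _ _ _).le

theorem norm_phiFun_one_le (x : lp (fun _ : A => ℂ) 1) (ω : Cube (CascadeUnion A)) :
    ‖phiFun x ω‖ ≤ ‖x‖ := by
  rw [phiFun_one, norm_lp_one]
  exact tsum_of_norm_bounded (summable_norm_lp_one x).hasSum fun a => (norm_mul_walsh _ _ _).le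

theorem norm_phiFun_le (hs : s ≠ 1) (hs2 : s ≤ 2) (x : lp (fun _ : A => ℂ) s)
    (ω : Cube (CascadeUnion A)) :
    ‖phiFun x ω‖ ≤ 2 * Real.sqrt (Real.exp 1) / (1 - deltaConst s) * ‖x‖ := by
  have h0 : 0 < 1 - deltaConst s := sub_pos.mpr (deltaConst_lt_one hs1.out)
  rw [phiFun_of_ne hs]
  refine (norm_add_le _ _).trans ?_
  rw [norm_mul, Complex.norm_I, one_mul]
  calc ‖phiFunReal (reLp x) ω‖ + ‖phiFunReal (imLp x) ω‖
      ≤ Real.sqrt (Real.exp 1) / (1 - deltaConst s) * ‖x‖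
        + Real.sqrt (Real.exp 1) / (1 - deltaConst s) * ‖x‖ := by
        refine add_le_add ((norm_phiFunReal_le hs2 _ ω).trans ?_)
          ((norm_phiFunReal_le hs2 _ ω).trans ?_)
        · gcongr; exact norm_reLp_le x
        · gcongr; exact norm_imLp_le x
    _ = _ := by ring

theorem bddMeasurable_phiFunReal (hs2 : s ≤ 2) (x : lp (fun _ : A => ℝ) s) :
    BddMeasurable (phiFunReal x) :=
  ⟨measurable_phiFunReal hs2 x, _, norm_phiFunReal_le hs2 x⟩

theorem bddMeasurable_phiFun (hs2 : s ≤ 2) (x : lp (fun _ : A => ℂ) s) :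
    BddMeasurable (phiFun x) := by
  rcases eq_or_ne s 1 with rfl | hs
  · exact ⟨(continuous_phiFun_one x).measurable, _, norm_phiFun_one_le x⟩
  · rw [phiFun_of_ne hs]
    exact (bddMeasurable_phiFunReal hs2 _).add ((bddMeasurable_phiFunReal hs2 _).const_mul _)

/-- `A` may be uncountable, while `L` is only continuous along sequences; the exhaustion of `|x|`
gives sequential partial sums. -/
theorem apply_phiFun_one {M : Measure (Cube (CascadeUnion A))}
    {L : (Cube (CascadeUnion A) → ℂ) → ℂ} (hL : DominatedLinear M L)
    (g : lp (fun _ : Finset (CascadeUnion A) => ℂ) ∞) (hg : ∀ w, L (walsh w) = g w)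
    (x : lp (fun _ : A => ℂ) 1) : L (phiFun x) = ∑' w, phiLp x w * g w := by
  have hx := summable_norm_lp_one x
  rw [← (phiLp_mul_hasSum_one g).2.tsum_eq]
  set S := exhaustion fun a => ‖x a‖ with hS
  have hsupp : ∀ a, x a ≠ 0 → ∃ n, a ∈ S n := fun a ha =>
    exists_mem_exhaustion hx (norm_pos_iff.mpr ha)
  have hbw : ∀ a : A, BddMeasurable (walsh {incl a} : Cube (CascadeUnion A) → ℂ) := fun a =>
    ⟨measurable_walsh _, 1, fun ω => (norm_walsh _ ω).le⟩
  have h1 := hL.tendsto (fun n ω => ∑ a ∈ S n, x a * walsh {incl a} ω) (phiFun x) ‖x‖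
    (fun n => Finset.measurable_sum _ fun a _ => (measurable_walsh _).const_mul _)
    (fun n ω => by
      refine (norm_sum_le _ _).trans ?_
      simp only [norm_mul_walsh]
      rw [norm_lp_one]
      exact hx.sum_le_tsum _ fun a _ => norm_nonneg _)
    (continuous_phiFun_one x).measurable (.of_forall fun ω => by
      simp only [phiFun_one]
      exact tendsto_sum_of_exhausts (by simpa only [norm_mul_walsh] using hx)
        (monotone_exhaustion _) fun a ha => hsupp a (left_ne_zero_of_mul ha))
  have h2 : ∀ n, L (fun ω => ∑ a ∈ S n, x a * walsh {incl a} ω) = ∑ a ∈ S n, x a * g {incl a} := by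
    intro n
    rw [hL.finset_sum fun a => (hbw a).const_mul _]
    exact Finset.sum_congr rfl fun a _ => by rw [hL.smul _ _ (hbw a), hg]
  simp only [h2] at h1
  refine tendsto_nhds_unique h1 (tendsto_sum_of_exhausts ?_ (monotone_exhaustion _)
    fun a ha => hsupp a (left_ne_zero_of_mul ha))
  refine .of_nonneg_of_le (fun _ => norm_nonneg _) (fun a => ?_) (hx.mul_right ‖g‖)
  rw [norm_mul]
  exact mul_le_mul_of_nonneg_left (lp.norm_apply_le_norm (by simp) g _) (norm_nonneg _)

theorem apply_phiFun (hst : s.toReal.HolderConjugate t.toReal) (hs2 : s ≤ 2)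
    {M : Measure (Cube (CascadeUnion A))} (hM : RieszConvergent s.toReal M)
    {L : (Cube (CascadeUnion A) → ℂ) → ℂ} (hL : DominatedLinear M L)
    (g : lp (fun _ : Finset (CascadeUnion A) => ℂ) t) (hg : ∀ w, L (walsh w) = g w)
    (x : lp (fun _ : A => ℂ) s) : L (phiFun x) = ∑' w, phiLp x w * g w := by
  have hs := ne_one_of_holderConjugate hst
  rw [phiFun_of_ne hs, hL.add _ _ (bddMeasurable_phiFunReal hs2 _)
    ((bddMeasurable_phiFunReal hs2 _).const_mul _), hL.smul _ _ (bddMeasurable_phiFunReal hs2 _),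
    apply_phiFunReal hst hs2 hM hL g hg, apply_phiFunReal hst hs2 hM hL g hg, ← smul_eq_mul,
    ← map_smul, ← map_add, ← phiLp_eq hs, lpPairing_apply]

/-- Apply the general formula to `f ↦ ∫ f · walsh w`, whose values on characters form the unit
vector at `w`. -/
theorem fnTransform_phiFun (hs2 : s ≤ 2) (x : lp (fun _ : A => ℂ) s)
    (w : Finset (CascadeUnion A)) : fnTransform (phiFun x) w = phiLp x w := by
  classical
  have hL := DominatedLinear.of_integral _ (integrable_walsh w (prob (CascadeUnion A)))
  have hsingle : ∀ t : ℝ≥0∞, (∀ v, ∫ ω, walsh v ω * walsh w ω ∂(prob (CascadeUnion A))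
      = lp.single (E := fun _ : Finset (CascadeUnion A) => ℂ) t w 1 v) ∧
      ∑' v, phiLp x v * lp.single (E := fun _ : Finset (CascadeUnion A) => ℂ) t w 1 v
        = phiLp x w := by
    intro t
    constructor
    · intro v
      rw [integral_walsh_mul_walsh, lp.coeFn_single, Pi.single_apply]
    · rw [tsum_eq_single w]
      · simp
      · intro v hv
        simp [hv]
  have hcomm : fnTransform (phiFun x) w = ∫ ω, phiFun x ω * walsh w ω ∂(prob (CascadeUnion A)) :=
    integral_congr_ae (.of_forall fun ω => mul_comm _ _)
  rw [hcomm]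
  rcases eq_or_ne s 1 with rfl | hs
  · exact (apply_phiFun_one hL _ (hsingle ∞).1 x).trans (hsingle ∞).2
  · obtain ⟨t, hst⟩ := exists_holderConjugate (lt_of_le_of_ne hs1.out hs.symm) hs2
    exact (apply_phiFun hst hs2 (rieszConvergent_prob hst.lt.le (toReal_le_two hs2)) hL _
      (hsingle t).1 x).trans (hsingle t).2

end PhiFunctions

/-! ### The measures for exponents above 2. -/

section PhiMeasures

variable {A : Type*} {s t : ℝ≥0∞}

/-- The difference of a functional of measures at the Riesz products `∏ (1 ± z(a) r_a / 2)`. -/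
def rieszDiff {ι : Type*} (h : Measure (Cube ι) → ℂ) (z : ι → ℝ) : ℂ :=
  h (rieszMeasure ((1 / 2 : ℝ) • z)) - h (rieszMeasure (-((1 / 2 : ℝ) • z)))

theorem rieszDiff_neg {ι : Type*} (h : Measure (Cube ι) → ℂ) (z : ι → ℝ) :
    rieszDiff h (-z) = -rieszDiff h z := by
  rw [rieszDiff, rieszDiff, smul_neg, neg_neg, neg_sub]

theorem rieszDiff_integral_walsh {ι : Type*} (hs : 2 < s) {z : ι → ℝ} (hz : ∀ a, |z a| ≤ 1)
    (w : Finset ι) : rieszDiff (fun μ => ∫ ω, walsh w ω ∂μ) z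
      = ((blockSign s w.card * ∏ a ∈ w, z a : ℝ) : ℂ) := by
  have hz2 : ∀ a, |((1 / 2 : ℝ) • z) a| ≤ 1 := fun a => by
    rw [Pi.smul_apply, smul_eq_mul, abs_mul, abs_of_pos (by norm_num)]
    linarith [hz a]
  rw [rieszDiff, (isRieszMeasure_rieszMeasure hz2).transform,
    (isRieszMeasure_rieszMeasure (y := -((1 / 2 : ℝ) • z)) fun a => by
      rw [Pi.neg_apply, abs_neg]; exact hz2 a).transform, blockSign, if_neg hs.not_ge, rieszCoeff,
    rieszCoeff]
  have h1 : ∏ a ∈ w, ((((1 / 2 : ℝ) • z) a : ℝ) : ℂ) = (1 / 2) ^ w.card * ∏ a ∈ w, (z a : ℂ) := by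
    rw [← Finset.prod_const, ← Finset.prod_mul_distrib]
    exact Finset.prod_congr rfl fun a _ => by simp
  have h2 : ∏ a ∈ w, (((-((1 / 2 : ℝ) • z)) a : ℝ) : ℂ)
      = (-1) ^ w.card * ((1 / 2) ^ w.card * ∏ a ∈ w, (z a : ℂ)) := by
    rw [← h1, ← Finset.prod_const, ← Finset.prod_mul_distrib]
    exact Finset.prod_congr rfl fun a _ => by simp
  rw [h1, h2]
  push_cast
  ring

/-- The real part (`false`) or the imaginary part (`true`) of an element of `l^s`. -/
def partLp {ι : Type*} (x : lp (fun _ : ι => ℂ) s) (c : Bool) : lp (fun _ : ι => ℝ) s :=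
  if c then imLp x else reLp x

/-- The sign `1` (`false`) or `-1` (`true`). -/
def signOf (b : Bool) : ℝ := if b then -1 else 1

theorem norm_signOf (b : Bool) : ‖(signOf b : ℂ)‖ = 1 := by
  cases b <;> simp [signOf]

/-- The unit `1` (`false`) or `i` (`true`). -/
def unitOf (c : Bool) : ℂ := if c then Complex.I else 1

theorem norm_unitOf (c : Bool) : ‖unitOf c‖ = 1 := by
  cases c <;> simp [unitOf]

variable [hs1 : Fact (1 ≤ s)]

/-- The coefficients in the expansion of `Φ^{(s)}(x)`, `s > 2`, as a series of Riesz products. -/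
def phiWeight (x : lp (fun _ : A => ℂ) s) (k : ℕ × Bool × Bool) : ℂ :=
  unitOf k.2.2 * signOf k.2.1 * (Complex.I ^ k.1 * (‖cVec (partLp x k.2.2) k.1‖ : ℂ))

/-- The Riesz products in the expansion of `Φ^{(s)}(x)`, `s > 2`. -/
def phiPart (x : lp (fun _ : A => ℂ) s) (k : ℕ × Bool × Bool) : Measure (Cube (CascadeUnion A)) :=
  rieszMeasure (signOf k.2.1 • (1 / 2 : ℝ) • unitVec (cVec (partLp x k.2.2) k.1))

instance (x : lp (fun _ : A => ℂ) s) (k : ℕ × Bool × Bool) : IsProbabilityMeasure (phiPart x k) :=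
  inferInstanceAs (IsProbabilityMeasure (rieszMeasure _))

instance (x : lp (fun _ : A => ℂ) s) (k : ℕ × Bool × Bool) : (phiPart x k).Regular :=
  inferInstanceAs ((rieszMeasure _).Regular)

theorem norm_phiWeight (x : lp (fun _ : A => ℂ) s) (k : ℕ × Bool × Bool) :
    ‖phiWeight x k‖ = ‖cVec (partLp x k.2.2) k.1‖ := by
  rw [phiWeight, norm_mul, norm_I_pow_mul_norm, norm_mul, norm_unitOf, norm_signOf, one_mul,
    one_mul]

theorem sum_norm_phiWeight (x : lp (fun _ : A => ℂ) s) (n : ℕ) :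
    ∑ j : Bool × Bool, ‖phiWeight x (n, j)‖ = 2 * (‖cVec (reLp x) n‖ + ‖cVec (imLp x) n‖) := by
  simp only [norm_phiWeight, Fintype.sum_prod_type, Fintype.sum_bool, partLp]
  simp only [if_true, Bool.false_eq_true, if_false]
  ring

theorem summable_norm_phiWeight (x : lp (fun _ : A => ℂ) s) : Summable fun k => ‖phiWeight x k‖ := by
  refine (summable_prod_of_nonneg fun _ => norm_nonneg _).mpr ⟨fun _ => .of_finite, ?_⟩
  simp only [tsum_fintype, sum_norm_phiWeight]
  exact ((summable_norm_cVec _).add (summable_norm_cVec _)).mul_left 2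

theorem tsum_norm_phiWeight (x : lp (fun _ : A => ℂ) s) :
    ∑' k, ‖phiWeight x k‖ = 2 * (∑' n, ‖cVec (reLp x) n‖ + ∑' n, ‖cVec (imLp x) n‖) := by
  rw [(summable_norm_phiWeight x).tsum_prod]
  simp only [tsum_fintype, sum_norm_phiWeight]
  rw [tsum_mul_left, (summable_norm_cVec _).tsum_add (summable_norm_cVec _)]

/-- At each level the four terms, two signs for each of the two parts, combine into two odd
differences. The functional `h` is either evaluation on a set or integration of a character. -/
theorem hasSum_phiWeight_mul (x : lp (fun _ : A => ℂ) s) {h : Measure (Cube (CascadeUnion A)) → ℂ}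
    (hh : ∀ μ, IsProbabilityMeasure μ → ‖h μ‖ ≤ 1) :
    HasSum (fun n => Complex.I ^ n * (‖cVec (reLp x) n‖ * rieszDiff h (unitVec (cVec (reLp x) n)))
      + Complex.I * (Complex.I ^ n *
        (‖cVec (imLp x) n‖ * rieszDiff h (unitVec (cVec (imLp x) n)))))
      (∑' k, phiWeight x k * h (phiPart x k)) := by
  have hs : Summable fun k => phiWeight x k * h (phiPart x k) :=
    .of_norm_bounded (summable_norm_phiWeight x) fun k => by
      rw [norm_mul]
      exact mul_le_of_le_one_right (norm_nonneg _) (hh _ inferInstance)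
  refine hs.hasSum.prod_fiberwise fun n => ?_
  refine (congrArg (HasSum _ ·) ?_).mp (hasSum_fintype _)
  simp only [Fintype.sum_prod_type, Fintype.sum_bool, phiWeight, phiPart, partLp, unitOf, signOf,
    rieszDiff, if_true, Bool.false_eq_true, if_false, neg_smul, one_smul]
  push_cast
  ring

theorem exists_phiMeasure (x : lp (fun _ : A => ℂ) s) :
    ∃ ν : ComplexMeasure (Cube (CascadeUnion A)),
      (∀ E, MeasurableSet E → ν E = ∑' k, phiWeight x k * (phiPart x k).real E) ∧
      ν.variation ≤ dominatingMeasure (phiWeight x) (phiPart x) :=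
  exists_complexMeasure_sum (summable_norm_phiWeight x)

/-- The measure with the Walsh series `Φ^{(s)}(x)`, for `s > 2`. -/
def phiMeasure (x : lp (fun _ : A => ℂ) s) : ComplexMeasure (Cube (CascadeUnion A)) :=
  (exists_phiMeasure x).choose

theorem phiMeasure_apply (x : lp (fun _ : A => ℂ) s) {E : Set (Cube (CascadeUnion A))}
    (hE : MeasurableSet E) : phiMeasure x E = ∑' k, phiWeight x k * (phiPart x k).real E :=
  (exists_phiMeasure x).choose_spec.1 E hE

theorem variation_phiMeasure_le (x : lp (fun _ : A => ℂ) s) :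
    (phiMeasure x).variation ≤ dominatingMeasure (phiWeight x) (phiPart x) :=
  (exists_phiMeasure x).choose_spec.2

theorem isFiniteMeasure_dominatingMeasure_phi (x : lp (fun _ : A => ℂ) s) :
    IsFiniteMeasure (dominatingMeasure (phiWeight x) (phiPart x)) :=
  isFiniteMeasure_dominatingMeasure (summable_norm_phiWeight x)

theorem isFiniteMeasure_variation_phiMeasure (x : lp (fun _ : A => ℂ) s) :
    IsFiniteMeasure (phiMeasure x).variation := by
  have := isFiniteMeasure_dominatingMeasure_phi x
  exact isFiniteMeasure_of_le _ (variation_phiMeasure_le x)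

theorem regular_variation_phiMeasure (x : lp (fun _ : A => ℂ) s) :
    (phiMeasure x).variation.Regular := by
  have := isFiniteMeasure_dominatingMeasure_phi x
  have := innerRegular_dominatingMeasure (β := phiWeight x) (μ := phiPart x)
  exact regular_of_le (variation_phiMeasure_le x)

theorem variation_phiMeasure_univ_le (x : lp (fun _ : A => ℂ) s) :
    ((phiMeasure x).variation Set.univ).toReal
      ≤ 2 * (∑' n, ‖cVec (reLp x) n‖ + ∑' n, ‖cVec (imLp x) n‖) := by
  rw [← tsum_norm_phiWeight]
  refine ENNReal.toReal_le_of_le_ofReal (tsum_nonneg fun _ => norm_nonneg _) ?_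
  rw [← dominatingMeasure_univ (μ := phiPart x) (summable_norm_phiWeight x)]
  exact variation_phiMeasure_le x _

/-- For negative `c` the two Riesz measures of each pair change places, so the sums are compared
after grouping into odd differences. -/
theorem phiMeasure_smul (c : ℝ) (x : lp (fun _ : A => ℂ) s) :
    phiMeasure ((c : ℂ) • x) = (c : ℂ) • phiMeasure x := by
  ext E hE
  have hh : ∀ μ : Measure (Cube (CascadeUnion A)), IsProbabilityMeasure μ →
      ‖((μ.real E : ℝ) : ℂ)‖ ≤ 1 := fun μ _ => by
    rw [Complex.norm_real, Real.norm_of_nonneg measureReal_nonneg]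
    exact measureReal_le_one
  have key : ∀ (n : ℕ) (v : lp (fun _ : A => ℝ) s),
      (‖cVec (c • v) n‖ : ℂ) * rieszDiff (fun μ => (μ.real E : ℂ)) (unitVec (cVec (c • v) n))
        = c * (‖cVec v n‖ * rieszDiff (fun μ => (μ.real E : ℂ)) (unitVec (cVec v n))) := by
    intro n v
    rw [cVec_smul]
    exact norm_mul_unitVec_smul (rieszDiff_neg _) c (cVec v n)
  rw [smul_apply, phiMeasure_apply _ hE, phiMeasure_apply _ hE, smul_eq_mul]
  refine (hasSum_phiWeight_mul _ hh).unique ?_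
  refine (congrArg (HasSum · _) (funext fun n => ?_)).mp ((hasSum_phiWeight_mul x hh).mul_left _)
  rw [reLp_smul, imLp_smul, key, key]
  ring

theorem measTransform_phiMeasure (hs : 2 < s) (x : lp (fun _ : A => ℂ) s)
    (w : Finset (CascadeUnion A)) : measTransform (phiMeasure x) w = phiLp x w := by
  have hs' : s ≠ 1 := by rintro rfl; exact absurd hs (by norm_num)
  have h1 : measTransform (phiMeasure x) w = ∑' k, phiWeight x k * ∫ ω, walsh w ω ∂(phiPart x k) :=
    vectorIntegral_eq_tsum (summable_norm_phiWeight x) (fun _ hE => phiMeasure_apply x hE)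
      (variation_phiMeasure_le x) ⟨measurable_walsh w, 1, fun ω => (norm_walsh w ω).le⟩
  have hh : ∀ μ : Measure (Cube (CascadeUnion A)), IsProbabilityMeasure μ →
      ‖∫ ω, walsh w ω ∂μ‖ ≤ 1 := fun μ _ => by
    have := norm_integral_le_of_norm_le_const (μ := μ) (f := walsh w)
      (.of_forall fun ω => (norm_walsh w ω).le)
    simpa using this
  have key : ∀ (n : ℕ) (v : lp (fun _ : A => ℝ) s), (‖cVec v n‖ : ℂ) *
      rieszDiff (fun μ => ∫ ω, walsh w ω ∂μ) (unitVec (cVec v n))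
        = (liftCoeff n (blockCoeff s (cVec v n)) w : ℂ) := by
    intro n v
    rw [liftCoeff_blockCoeff, rieszDiff_integral_walsh hs (abs_unitVec_le_one _),
      ← Complex.ofReal_mul]
  have h2 := hasSum_phiWeight_mul x hh
  simp only [key] at h2
  rw [h1, phiLp_eq hs', lp.coeFn_add, Pi.add_apply, lp.coeFn_smul, Pi.smul_apply, smul_eq_mul]
  exact h2.unique ((hasSum_phiRealLp_apply _ w).add
    ((hasSum_phiRealLp_apply _ w).mul_left Complex.I))

theorem sum_abs_mul_le_of_inUnitBall {ι : Type*} {p q : ℝ} (hpq : p.HolderConjugate q)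
    {z y : ι → ℝ} (hy : InUnitBall q y) (T : Finset ι) :
    ∑ a ∈ T, |z a * y a| ≤ (∑ a ∈ T, |z a| ^ p) ^ (1 / p) := by
  have h := Real.inner_le_Lp_mul_Lq T (fun a => |z a|) (fun a => |y a|) hpq
  simp only [abs_abs] at h
  simp only [abs_mul]
  refine h.trans (mul_le_of_le_one_right ?_ ?_)
  · exact Real.rpow_nonneg (Finset.sum_nonneg fun a _ => by positivity) _
  · exact Real.rpow_le_one (Finset.sum_nonneg fun a _ => by positivity) (hy T)
      (one_div_nonneg.mpr hpq.symm.nonneg)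

/-- Every summand is the Riesz measure of a vector in the unit ball of `l^s`, so Hölder supplies the
convergence criterion; the summands are countably many, hence so are the null sets. -/
theorem rieszConvergent_dominatingMeasure (hts : t.toReal.HolderConjugate s.toReal)
    (ht2 : t.toReal ≤ 2) (x : lp (fun _ : A => ℂ) s) :
    RieszConvergent t.toReal (dominatingMeasure (phiWeight x) (phiPart x)) := by
  have hs := ne_top_of_holderConjugate hts.symm
  refine fun z hz => ae_dominatingMeasure fun k => ?_
  set v := cVec (partLp x k.2.2) k.1
  have hle : ∀ b, |(signOf k.2.1 • (1 / 2 : ℝ) • unitVec v) b| ≤ |unitVec v b| := by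
    intro b
    have h1 : |signOf k.2.1| = 1 := by
      have := norm_signOf k.2.1
      rwa [Complex.norm_real] at this
    rw [Pi.smul_apply, Pi.smul_apply, smul_eq_mul, smul_eq_mul, abs_mul, h1, abs_mul, one_mul,
      abs_of_pos (by norm_num : (0 : ℝ) < 1 / 2)]
    linarith [abs_nonneg (unitVec v b)]
  have hball : InUnitBall s.toReal (signOf k.2.1 • (1 / 2 : ℝ) • unitVec v) := fun S =>
    (Finset.sum_le_sum fun b _ => Real.rpow_le_rpow (abs_nonneg _) (hle b)
      hts.symm.nonneg).trans (inUnitBall_unitVec hs v S)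
  exact ae_tendsto_rieszFun hts.lt.le ht2 hz (sum_abs_mul_le_of_inUnitBall hts hball)
    (isRieszMeasure_rieszMeasure fun b => (hle b).trans (abs_unitVec_le_one v b))

end PhiMeasures

/-! ### The lower bound `2/π` for Rademacher series. -/

section PhiOneLowerBound

theorem integral_abs_cos : ∫ θ in (0 : ℝ)..Real.pi, |Real.cos θ| = 2 := by
  have hper : Function.Periodic (fun θ : ℝ => |Real.cos θ|) Real.pi := fun θ => by
    simp only [Real.cos_add_pi, abs_neg]
  have h := hper.intervalIntegral_add_eq 0 (-(Real.pi / 2))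
  rw [zero_add] at h
  rw [h, show -(Real.pi / 2) + Real.pi = Real.pi / 2 by ring]
  have h2 : ∫ θ in (-(Real.pi / 2))..(Real.pi / 2), |Real.cos θ|
      = ∫ θ in (-(Real.pi / 2))..(Real.pi / 2), Real.cos θ := by
    refine intervalIntegral.integral_congr fun θ hθ => ?_
    rw [Set.uIcc_of_le (by linarith [Real.pi_pos])] at hθ
    exact abs_of_nonneg (Real.cos_nonneg_of_mem_Icc hθ)
  rw [h2, integral_cos, Real.sin_neg, Real.sin_pi_div_two]
  norm_num

/-- In polar form the integrand is `‖x‖ |cos (θ + arg x)|`, and `|cos|` has period `π`. -/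
theorem integral_abs_re_exp_mul (x : ℂ) :
    ∫ θ in (0 : ℝ)..Real.pi, |(Complex.exp (θ * Complex.I) * x).re| = 2 * ‖x‖ := by
  have h : ∀ θ : ℝ, |(Complex.exp (θ * Complex.I) * x).re| = ‖x‖ * |Real.cos (θ + x.arg)| := by
    intro θ
    have : Complex.exp (θ * Complex.I) * x
        = (‖x‖ : ℂ) * Complex.exp (((θ + x.arg : ℝ) : ℂ) * Complex.I) := by
      conv_lhs => rw [← Complex.norm_mul_exp_arg_mul_I x]
      push_cast
      rw [add_mul, Complex.exp_add]
      ring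
    rw [this, Complex.re_ofReal_mul, Complex.exp_ofReal_mul_I_re, abs_mul, abs_norm]
  simp only [h]
  have hper : Function.Periodic (fun θ : ℝ => |Real.cos θ|) Real.pi := fun θ => by
    simp only [Real.cos_add_pi, abs_neg]
  rw [intervalIntegral.integral_const_mul,
    intervalIntegral.integral_comp_add_right (fun θ => |Real.cos θ|), zero_add, add_comm Real.pi,
    hper.intervalIntegral_add_eq x.arg 0, zero_add, integral_abs_cos, mul_comm]

variable {A : Type*}

theorem sum_abs_re_le {x : lp (fun _ : A => ℂ) 1} {K : ℝ}
    (hK : ∀ ω : Cube (CascadeUnion A), ‖phiFun x ω‖ ≤ K) (θ : ℝ) (T : Finset A) :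
    ∑ a ∈ T, |(Complex.exp (θ * Complex.I) * x a).re| ≤ K := by
  classical
  set e := Complex.exp (θ * Complex.I)
  have he : ‖e‖ = 1 := Complex.norm_exp_ofReal_mul_I θ
  -- The Rademacher characters are independent coordinates, so `ω` can take the sign of `Re (e x a)`
  -- at every `a` at once.
  set ω : Cube (CascadeUnion A) :=
    (Function.extend incl (fun a => if 0 ≤ (e * x a).re then (1 : ℤˣ) else -1) 1 :
      CascadeUnion A → ℤˣ)
  have hω : ∀ a, (e * (x a * walsh {incl a} ω)).re = |(e * x a).re| := by
    intro a
    have h1 : ω (incl a) = if 0 ≤ (e * x a).re then (1 : ℤˣ) else -1 :=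
      incl_injective.extend_apply _ _ a
    have h2 : rad (incl a) ω = if 0 ≤ (e * x a).re then 1 else -1 := by
      rw [rad, h1]
      split_ifs <;> simp
    rw [walsh_singleton, ← mul_assoc, Complex.re_mul_ofReal, h2]
    split_ifs with h
    · rw [mul_one, abs_of_nonneg h]
    · rw [mul_neg_one, abs_of_neg (not_le.mp h)]
  have hs : Summable fun a => x a * walsh {incl a} ω :=
    .of_norm (by simpa only [norm_mul_walsh] using summable_norm_lp_one x)
  have h1 : HasSum (fun a => |(e * x a).re|) (e * phiFun x ω).re := by
    rw [phiFun_one]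
    have := (Complex.hasSum_re (hs.hasSum.mul_left e))
    simpa only [hω] using this
  calc ∑ a ∈ T, |(e * x a).re| ≤ (e * phiFun x ω).re :=
        sum_le_hasSum T (fun a _ => abs_nonneg _) h1
    _ ≤ ‖e * phiFun x ω‖ := Complex.re_le_norm _
    _ ≤ K := by rw [norm_mul, he, one_mul]; exact hK ω

/-- Integrate the bound for `∑ |Re (e^{iθ} x a)|` over `0 ≤ θ ≤ π`: the left side becomes `2 ∑ ‖x
a‖`, the right side `π K`. -/
theorem two_div_pi_mul_norm_le {x : lp (fun _ : A => ℂ) 1} {K : ℝ}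
    (hK : ∀ ω : Cube (CascadeUnion A), ‖phiFun x ω‖ ≤ K) : 2 / Real.pi * ‖x‖ ≤ K := by
  have hπ := Real.pi_pos
  have h : ∀ T : Finset A, ∑ a ∈ T, ‖x a‖ ≤ Real.pi / 2 * K := by
    intro T
    have hint : ∀ a ∈ T, IntervalIntegrable
        (fun θ : ℝ => |(Complex.exp (θ * Complex.I) * x a).re|) volume 0 Real.pi := fun a _ => by
      refine Continuous.intervalIntegrable ?_ _ _
      fun_prop
    have h1 := intervalIntegral.integral_mono_on (μ := volume) hπ.le
      (IntervalIntegrable.sum T hint) (g := fun _ => K) intervalIntegrable_const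
      fun θ _ => by
        rw [Finset.sum_apply]
        exact sum_abs_re_le hK θ T
    rw [intervalIntegral.integral_const, sub_zero, smul_eq_mul] at h1
    have h2 : ∫ θ in (0 : ℝ)..Real.pi,
        (∑ a ∈ T, fun θ : ℝ => |(Complex.exp (θ * Complex.I) * x a).re|) θ
          = 2 * ∑ a ∈ T, ‖x a‖ := by
      simp only [Finset.sum_apply]
      rw [intervalIntegral.integral_finsetSum hint, Finset.mul_sum]
      exact Finset.sum_congr rfl fun a _ => integral_abs_re_exp_mul (x a)
    rw [h2] at h1
    linarith
  rw [norm_lp_one]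
  calc 2 / Real.pi * ∑' a, ‖x a‖ ≤ 2 / Real.pi * (Real.pi / 2 * K) := by
        refine mul_le_mul_of_nonneg_left ((summable_norm_lp_one x).tsum_le_of_sum_le h)
          (by positivity)
    _ = K := by field_simp

end PhiOneLowerBound

/-! ### The maps into `L^∞_{(s)}` and `M_{(s)}`. -/

section Maps

variable {A : Type*} {s t : ℝ≥0∞}

theorem memLp_top_of_bddMeasurable {X : Type*} [MeasurableSpace X] {μ : Measure X} {f : X → ℂ}
    (hf : BddMeasurable f) : MemLp f ∞ μ := by
  obtain ⟨hf, C, hC⟩ := hf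
  exact memLp_top_of_bound hf.aestronglyMeasurable C (.of_forall hC)

theorem fnTransform_congr_ae {ι : Type*} {f g : Cube ι → ℂ} (h : f =ᵐ[prob ι] g) :
    fnTransform f = fnTransform g := by
  funext w
  refine integral_congr_ae ?_
  filter_upwards [h] with ω hω
  rw [hω]

/-- Haar measure charges every nonempty open set, so for continuous functions the essential bound
holds at every point. -/
theorem norm_le_norm_toLp_of_continuous {ι : Type*} {f : Cube ι → ℂ} (hf : Continuous f)
    (hf' : MemLp f ∞ (prob ι)) (ω : Cube ι) : ‖f ω‖ ≤ ‖hf'.toLp f‖ := by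
  have hae : ∀ᵐ ω ∂(prob ι), ‖f ω‖ ≤ ‖hf'.toLp f‖ := by
    have h : ∀ᵐ ω ∂(prob ι), ‖f ω‖ₑ ≤ eLpNorm f ∞ (prob ι) := by
      rw [eLpNorm_exponent_top]
      exact enorm_ae_le_eLpNormEssSup f _
    filter_upwards [h] with ω hω
    rw [Lp.norm_toLp, ← toReal_enorm]
    exact ENNReal.toReal_mono hf'.2.ne hω
  by_contra! hlt
  have hopen : IsOpen {ω | ‖hf'.toLp f‖ < ‖f ω‖} := isOpen_lt continuous_const hf.norm
  have h0 : prob ι {ω | ‖hf'.toLp f‖ < ‖f ω‖} = 0 := by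
    have := ae_iff.mp hae
    simpa only [not_le] using this
  exact Set.notMem_empty ω ((hopen.measure_eq_zero_iff (prob ι)).mp h0 ▸ hlt)

theorem norm_measTransform_le {ι : Type*} (ν : ComplexMeasure (Cube ι)) [IsFiniteMeasure ν.variation]
    (w : Finset ι) : ‖measTransform ν w‖ ≤ (ν.variation Set.univ).toReal := by
  have h := VectorMeasure.norm_integral_le_of_norm_le_const (μ := ν)
    (B := ContinuousLinearMap.mul ℝ ℂ) (f := walsh w) (C := 1) (.of_forall fun ω => (norm_walsh w ω).le)
  simpa [measTransform, cint, Measure.real] using h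

/-- The zero function, as an element of `L^∞_{(s)}`. -/
def LInfSpace.zero {ι : Type*} (s : ℝ≥0∞) : LInfSpace s ι :=
  ⟨0, by
    have : fnTransform (0 : Cube ι → ℂ) = 0 := by
      funext w
      simp [fnTransform]
    rw [fnTransform_congr_ae (Lp.coeFn_zero ℂ ∞ (prob ι)), this]
    exact zero_memℓp⟩

/-- The zero measure, as an element of `M_{(s)}`. -/
def MSpace.zero {ι : Type*} (s : ℝ≥0∞) : MSpace s ι :=
  ⟨0, by rw [VectorMeasure.variation_zero]; exact ⟨inferInstance, inferInstance⟩, by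
    have : measTransform (0 : ComplexMeasure (Cube ι)) = 0 := by
      funext w
      exact VectorMeasure.integral_zero_vectorMeasure
    rw [this]
    exact zero_memℓp⟩

/-- The element of `L^∞_{(s)}` with the Walsh series `Φ^{(s)}(x)`, for `1 ≤ s ≤ 2`. -/
def LInfSpace.ofPhi [Fact (1 ≤ s)] (hs2 : s ≤ 2) (x : lp (fun _ : A => ℂ) s) :
    LInfSpace s (CascadeUnion A) :=
  ⟨(memLp_top_of_bddMeasurable (bddMeasurable_phiFun hs2 x)).toLp (phiFun x), by
    rw [fnTransform_congr_ae (MemLp.coeFn_toLp _), funext (fnTransform_phiFun hs2 x)]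
    exact lp.memℓp (phiLp x)⟩

/-- The element of `M_{(s)}` with the Walsh series `Φ^{(s)}(x)`, for `s > 2`. -/
def MSpace.ofPhi [Fact (1 ≤ s)] (hs : 2 < s) (x : lp (fun _ : A => ℂ) s) :
    MSpace s (CascadeUnion A) :=
  ⟨phiMeasure x, ⟨isFiniteMeasure_variation_phiMeasure x, regular_variation_phiMeasure x⟩, by
    rw [funext (measTransform_phiMeasure hs x)]
    exact lp.memℓp (phiLp x)⟩

/-- The map `Φ^{(s)}` for `1 ≤ s ≤ 2`, and `0` for the other exponents. -/
def phiLInf (s : ℝ≥0∞) (x : lp (fun _ : A => ℂ) s) : LInfSpace s (CascadeUnion A) :=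
  open Classical in
  if h : 1 ≤ s ∧ s ≤ 2 then
    haveI := Fact.mk h.1
    LInfSpace.ofPhi h.2 x
  else LInfSpace.zero s

/-- The map `Φ^{(s)}` for `s > 2`, and `0` for the other exponents. -/
def phiM (s : ℝ≥0∞) (x : lp (fun _ : A => ℂ) s) : MSpace s (CascadeUnion A) :=
  open Classical in
  if h : 2 < s then
    haveI := Fact.mk (one_le_two.trans h.le)
    MSpace.ofPhi h x
  else MSpace.zero s

variable [hs1 : Fact (1 ≤ s)]

theorem phiLInf_val (hs2 : s ≤ 2) (x : lp (fun _ : A => ℂ) s) :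
    (phiLInf s x).1 = (memLp_top_of_bddMeasurable (bddMeasurable_phiFun hs2 x)).toLp (phiFun x) := by
  rw [phiLInf, dif_pos ⟨hs1.out, hs2⟩]
  rfl

theorem coeFn_phiLInf (hs2 : s ≤ 2) (x : lp (fun _ : A => ℂ) s) :
    ((phiLInf s x).1 : Cube (CascadeUnion A) → ℂ) =ᵐ[prob (CascadeUnion A)] phiFun x := by
  rw [phiLInf_val hs2]
  exact MemLp.coeFn_toLp _

theorem hat_phiLInf (hs2 : s ≤ 2) (x : lp (fun _ : A => ℂ) s) : (phiLInf s x).hat = phiLp x := by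
  ext w
  have : (phiLInf s x).hat w = fnTransform (phiLInf s x).1 w := rfl
  rw [this, fnTransform_congr_ae (coeFn_phiLInf hs2 x), fnTransform_phiFun hs2]

theorem norm_phiLInf_le (hs2 : s ≤ 2) (x : lp (fun _ : A => ℂ) s) {C : ℝ}
    (hC : ∀ ω : Cube (CascadeUnion A), ‖phiFun x ω‖ ≤ C) : ‖(phiLInf s x).1‖ ≤ C := by
  have hC0 : 0 ≤ C := (norm_nonneg _).trans (hC (1 : Cube (CascadeUnion A)))
  have h := Lp.norm_le_of_ae_bound (f := (phiLInf s x).1) hC0 (by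
    filter_upwards [coeFn_phiLInf hs2 x] with ω hω
    rw [hω]
    exact hC ω)
  simpa using h

theorem phiLInf_smul (hs2 : s ≤ 2) (c : ℝ) (x : lp (fun _ : A => ℂ) s) :
    (phiLInf s ((c : ℂ) • x)).1 = (c : ℂ) • (phiLInf s x).1 := by
  rw [phiLInf_val hs2, phiLInf_val hs2, ← MemLp.toLp_const_smul]
  exact MemLp.toLp_congr _ _ (.of_forall fun ω => phiFun_smul c x ω)

theorem phiM_val (hs : 2 < s) (x : lp (fun _ : A => ℂ) s) : (phiM s x).1 = phiMeasure x := by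
  rw [phiM, dif_pos hs]
  rfl

theorem hat_phiM (hs : 2 < s) (x : lp (fun _ : A => ℂ) s) : (phiM s x).hat = phiLp x := by
  ext w
  have : (phiM s x).hat w = measTransform (phiM s x).1 w := rfl
  rw [this, phiM_val hs, measTransform_phiMeasure hs]

theorem tv_phiM_le (hs : 2 < s) (x : lp (fun _ : A => ℂ) s) :
    (phiM s x).tv ≤ 2 * (∑' n, ‖cVec (reLp x) n‖ + ∑' n, ‖cVec (imLp x) n‖) := by
  rw [MSpace.tv, phiM_val hs]
  exact variation_phiMeasure_univ_le x

theorem tv_phiM_le_mul_norm (hs : 2 < s) (x : lp (fun _ : A => ℂ) s) :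
    (phiM s x).tv ≤ 4 / (1 - deltaConst s) * ‖x‖ := by
  have h0 : 0 < 1 - deltaConst s := sub_pos.mpr (deltaConst_lt_one hs1.out)
  have h1 : ∑' n, ‖cVec (reLp x) n‖ ≤ ‖x‖ / (1 - deltaConst s) :=
    (tsum_norm_cVec_le _).trans (by gcongr; exact norm_reLp_le x)
  have h2 : ∑' n, ‖cVec (imLp x) n‖ ≤ ‖x‖ / (1 - deltaConst s) :=
    (tsum_norm_cVec_le _).trans (by gcongr; exact norm_imLp_le x)
  calc (phiM s x).tv ≤ 2 * (‖x‖ / (1 - deltaConst s) + ‖x‖ / (1 - deltaConst s)) :=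
        (tv_phiM_le hs x).trans (by gcongr)
    _ = _ := by ring

/-- Only level 0 contributes, so no geometric series enters: two Riesz measures for each of the real
and imaginary parts. -/
theorem tv_phiM_top_le (x : lp (fun _ : A => ℂ) ∞) : (phiM ∞ x).tv ≤ 4 * ‖x‖ := by
  have h : ∀ u : lp (fun _ : A => ℝ) ∞, ∑' n, ‖cVec u n‖ = ‖u‖ := by
    intro u
    rw [tsum_eq_single 0]
    · rfl
    · intro n hn
      obtain ⟨m, rfl⟩ := Nat.exists_eq_succ_of_ne_zero hn
      rw [cVec_succ_top rfl, norm_zero]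
  have h1 := tv_phiM_le (by simp) x
  rw [h, h] at h1
  linarith [norm_reLp_le x, norm_imLp_le x]

theorem norm_le_tv_phiM_top (x : lp (fun _ : A => ℂ) ∞) : ‖x‖ ≤ (phiM ∞ x).tv := by
  refine lp.norm_le_of_forall_le ENNReal.toReal_nonneg fun a => ?_
  have := (phiM ∞ x).2.1.1
  rw [← phiLp_incl x a, ← hat_phiM (by simp) x]
  exact norm_measTransform_le (phiM ∞ x).1 {incl a}

theorem phiM_smul (hs : 2 < s) (c : ℝ) (x : lp (fun _ : A => ℂ) s) :
    (phiM s ((c : ℂ) • x)).1 = (c : ℂ) • (phiM s x).1 := by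
  rw [phiM_val hs, phiM_val hs, phiMeasure_smul]

end Maps

/-! ### The integral formulas for conjugate exponents. -/

section Conjugate

variable {A : Type*} {s t : ℝ≥0∞}

theorem two_lt_of_conjugate (hs : s < 2) (hst : s⁻¹ + t⁻¹ = 1) : 2 < t := by
  by_contra! ht
  have h := ENNReal.add_lt_add_of_lt_of_le (by simp) (ENNReal.inv_lt_inv.mpr hs)
    (ENNReal.inv_le_inv.mpr ht)
  rw [ENNReal.inv_two_add_inv_two, hst] at h
  exact lt_irrefl _ h

theorem eq_one_or_holderConjugate (hs : s < 2) (hst : s⁻¹ + t⁻¹ = 1) :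
    (s = 1 ∧ t = ∞) ∨ s.toReal.HolderConjugate t.toReal := by
  by_cases ht : t = ∞
  · left
    subst ht
    simpa using hst
  · right
    have : ENNReal.HolderConjugate s t := ⟨by simpa using hst⟩
    exact ENNReal.HolderConjugate.toReal_of_ne_top (hs.trans ENNReal.ofNat_lt_top).ne ht

theorem phiLp_mul_phiLp [Fact (1 ≤ s)] [Fact (1 ≤ t)] (hs : s < 2) (hst : s⁻¹ + t⁻¹ = 1)
    (x : lp (fun _ : A => ℂ) s) (y : lp (fun _ : A => ℂ) t) :
    Summable (fun w => phiLp x w * phiLp y w) ∧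
      HasSum (fun a => x a * y a) (∑' w, phiLp x w * phiLp y w) := by
  rcases eq_one_or_holderConjugate hs hst with ⟨rfl, rfl⟩ | h
  · have h := phiLp_mul_hasSum_one (x := x) (phiLp y)
    refine ⟨Summable.of_norm h.1, ?_⟩
    have h2 := h.2
    simp only [phiLp_incl] at h2
    exact h2
  · exact ⟨(summable_norm_mul_lp h (phiLp x) (phiLp y)).of_norm, hasSum_mul_tsum_phiLp h x y⟩

/-- The function is fixed before `y`. Its defining limits hold almost everywhere for the measure
dominating `Φ(y)`, so integration against `Φ(y)` is an admissible functional; for `s = 1` uniform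
convergence suffices. -/
theorem cint_phiFun_phiMeasure [Fact (1 ≤ s)] [Fact (1 ≤ t)] (hs : s < 2) (hst : s⁻¹ + t⁻¹ = 1)
    (x : lp (fun _ : A => ℂ) s) (y : lp (fun _ : A => ℂ) t) :
    cint (phiFun x) (phiMeasure y) = ∑' w, phiLp x w * phiLp y w := by
  have := isFiniteMeasure_variation_phiMeasure y
  have hL := dominatedLinear_vectorIntegral (variation_phiMeasure_le y)
  have hg := measTransform_phiMeasure (two_lt_of_conjugate hs hst) y
  rcases eq_one_or_holderConjugate hs hst with ⟨rfl, rfl⟩ | h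
  · exact apply_phiFun_one hL (phiLp y) hg x
  · exact apply_phiFun h hs.le (rieszConvergent_dominatingMeasure h (toReal_le_two hs.le) y) hL
      (phiLp y) hg x

theorem integral_phiFun_mul_phiFun (x y : lp (fun _ : A => ℂ) 2) :
    ∫ ω, phiFun x ω * phiFun y ω ∂(prob (CascadeUnion A)) = ∑' w, phiLp x w * phiLp y w := by
  have hst : (2 : ℝ≥0∞).toReal.HolderConjugate (2 : ℝ≥0∞).toReal := by
    simpa using Real.HolderConjugate.two_two
  have hL := DominatedLinear.of_integral _
    ((bddMeasurable_phiFun le_rfl y).integrable (prob (CascadeUnion A)))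
  exact apply_phiFun hst le_rfl (rieszConvergent_prob hst.lt.le (toReal_le_two le_rfl)) hL
    (phiLp y) (fnTransform_phiFun le_rfl y) x

end Conjugate

end

theorem theorem4p9 (A : Type*) :
    ∃ (Φ : ∀ s : ℝ≥0∞, lp (fun _ : A => ℂ) s → LInfSpace s (CascadeUnion A))
      (Ψ : ∀ s : ℝ≥0∞, lp (fun _ : A => ℂ) s → MSpace s (CascadeUnion A)),
      -- `1 ≤ s ≤ 2`: the maps into `L^∞_{(s)}`
      (∀ (s : ℝ≥0∞) [Fact (1 ≤ s)], s ≤ 2 →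
        (∀ x w, (Φ s x).hat w = phiSeries s x w) ∧
        Function.Injective (Φ s) ∧
        (∀ x (a : A), (Φ s x).hat {incl a} = x a) ∧
        (s = 1 → ∀ x, 2 / Real.pi * ‖x‖ ≤ ‖(Φ s x).1‖ ∧ ‖(Φ s x).1‖ ≤ ‖x‖) ∧
        (1 < s → ∀ x, ‖x‖ ≤ (Φ s x).nrm ∧
          (Φ s x).nrm ≤ 2 * Real.sqrt (Real.exp 1) / (1 - deltaConst s) * ‖x‖) ∧
        (∀ (c : ℝ) x, (Φ s ((c : ℂ) • x)).1 = (c : ℂ) • (Φ s x).1) ∧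
        Continuous (fun x => (Φ s x).hat)) ∧
      -- `2 < s ≤ ∞`: the maps into `M_{(s)}`
      (∀ (s : ℝ≥0∞) [Fact (1 ≤ s)], 2 < s →
        (∀ x w, (Ψ s x).hat w = phiSeries s x w) ∧
        Function.Injective (Ψ s) ∧
        (∀ x (a : A), (Ψ s x).hat {incl a} = x a) ∧
        (∀ x, ‖x‖ ≤ (Ψ s x).nrm ∧ (Ψ s x).nrm ≤ 4 / (1 - deltaConst s) * ‖x‖) ∧
        (s = ∞ → ∀ x, ‖x‖ ≤ (Ψ s x).tv ∧ (Ψ s x).tv ≤ 4 * ‖x‖) ∧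
        (∀ (c : ℝ) x, (Ψ s ((c : ℂ) • x)).1 = (c : ℂ) • (Ψ s x).1) ∧
        Continuous (fun x => (Ψ s x).hat)) ∧
      -- the Parseval-type formula for `1 ≤ s < 2` and the conjugate exponent `t > 2`
      (∀ s t : ℝ≥0∞, 1 ≤ s → s < 2 → s⁻¹ + t⁻¹ = 1 → ∀ x : lp (fun _ : A => ℂ) s,
        (∀ y : lp (fun _ : A => ℂ) t,
          Summable (fun w => (Φ s x).hat w * (Ψ t y).hat w) ∧
          HasSum (fun a => x a * y a) (∑' w, (Φ s x).hat w * (Ψ t y).hat w)) ∧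
        ∃ F : Cube (CascadeUnion A) → ℂ, Measurable F ∧ (∃ C : ℝ, ∀ ω, ‖F ω‖ ≤ C) ∧
          F =ᵐ[Cube.prob (CascadeUnion A)] (Φ s x).1 ∧
          ∀ y : lp (fun _ : A => ℂ) t,
            HasSum (fun a => x a * y a) (Cube.cint F (Ψ t y).1)) ∧
      -- the Parseval-type formula for `s = 2`
      (∀ x y : lp (fun _ : A => ℂ) 2,
        HasSum (fun a => x a * y a)
          (∫ ω, (Φ 2 x).1 ω * (Φ 2 y).1 ω ∂(Cube.prob (CascadeUnion A)))) := by
  refine ⟨phiLInf, phiM, fun s hs1 hs2 => ?_, fun s hs1 hs2 => ?_, fun s t h1 hs2 hst x => ?_,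
    fun x y => ?_⟩
  · have hinc : ∀ x (a : A), (phiLInf s x).hat {incl a} = x a := fun x a => by
      rw [hat_phiLInf hs2, phiLp_incl]
    refine ⟨fun x w => by rw [hat_phiLInf hs2, phiLp_apply], fun x y hxy => ?_, hinc, ?_, ?_,
      phiLInf_smul hs2, ?_⟩
    · ext a
      rw [← hinc x a, ← hinc y a, hxy]
    · rintro rfl x
      refine ⟨two_div_pi_mul_norm_le fun ω => ?_, norm_phiLInf_le hs2 x (norm_phiFun_one_le x)⟩
      rw [phiLInf_val hs2]
      exact norm_le_norm_toLp_of_continuous (continuous_phiFun_one x) _ ω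
    · intro hs x
      refine ⟨?_, max_le (norm_phiLInf_le hs2 x (norm_phiFun_le hs.ne' hs2 x)) ?_⟩
      · refine le_trans ?_ (le_max_right _ _)
        rw [hat_phiLInf hs2]
        exact norm_le_norm_phiLp x
      · rw [hat_phiLInf hs2]
        have h := norm_phiLp_le hs.ne' x
        rwa [blockConst, if_pos hs2] at h
    · simp only [hat_phiLInf hs2]
      exact continuous_phiLp
  · have hinc : ∀ x (a : A), (phiM s x).hat {incl a} = x a := fun x a => by
      rw [hat_phiM hs2, phiLp_incl]
    refine ⟨fun x w => by rw [hat_phiM hs2, phiLp_apply], fun x y hxy => ?_, hinc, ?_, ?_,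
      phiM_smul hs2, ?_⟩
    · ext a
      rw [← hinc x a, ← hinc y a, hxy]
    · intro x
      refine ⟨?_, max_le (tv_phiM_le_mul_norm hs2 x) ?_⟩
      · refine le_trans ?_ (le_max_right _ _)
        rw [hat_phiM hs2]
        exact norm_le_norm_phiLp x
      · rw [hat_phiM hs2]
        have h := norm_phiLp_le (lt_of_le_of_lt one_le_two hs2).ne' x
        rw [blockConst, if_neg hs2.not_ge] at h
        refine h.trans (le_of_eq ?_)
        norm_num
    · rintro rfl x
      exact ⟨norm_le_tv_phiM_top x, tv_phiM_top_le x⟩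
    · simp only [hat_phiM hs2]
      exact continuous_phiLp
  · have ht2 := two_lt_of_conjugate hs2 hst
    have := Fact.mk h1
    have : Fact (1 ≤ t) := ⟨one_le_two.trans ht2.le⟩
    refine ⟨fun y => ?_, phiFun x, (bddMeasurable_phiFun hs2.le x).1,
      (bddMeasurable_phiFun hs2.le x).2, (coeFn_phiLInf hs2.le x).symm, fun y => ?_⟩
    · rw [hat_phiLInf hs2.le, hat_phiM ht2]
      exact phiLp_mul_phiLp hs2 hst x y
    · rw [phiM_val ht2, cint_phiFun_phiMeasure hs2 hst]
      exact (phiLp_mul_phiLp hs2 hst x y).2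
  · have h : ∫ ω, (phiLInf 2 x).1 ω * (phiLInf 2 y).1 ω ∂(Cube.prob (CascadeUnion A))
        = ∫ ω, phiFun x ω * phiFun y ω ∂(Cube.prob (CascadeUnion A)) := by
      refine integral_congr_ae ?_
      filter_upwards [coeFn_phiLInf le_rfl x, coeFn_phiLInf le_rfl y] with ω hx hy
      rw [hx, hy]
    rw [h, integral_phiFun_mul_phiFun]
    exact hasSum_mul_tsum_phiLp (by simpa using Real.HolderConjugate.two_two) x y
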